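/- **Setting.** Sources $1,\dots,K$ generate $X_n=(X_n^1,\dots,X_n^K)$, $n\ge 1$, independent over time. With no change $X_n\sim \mathsf F$ for all $n$; if the change occurs at time $\nu\ge 0$ with post-change distribution $\mathsf G\in\mathcal G$, then $X_n\sim\mathsf F$ for $n\le\nu$ and $X_n\sim \mathsf G$ for $n>\nu$ (law $\mathbb P_\nu^{\mathsf G}$). For $E\subseteq[K]$ let $\mathsf F^E,\mathsf G^E$ be the laws of $X^E=(X^k)_{k\in E}$, let $\mathcal A(\mathsf G)=\{E: |E|=m,\ \mathsf G^E\ne\mathsf F^E\}$ and $\mathcal G^E=\{\mathsf G^E:\mathsf G\in\mathcal G,\ \mathsf G^E\neq\mathsf F^E\}$; assume that $\mathsf G^E$ and $\mathsf F^E$ are mutually absolutely continuous for all $\mathsf G\in\mathcal G$, $E\in\mathcal A(\mathsf G)$. Fix distinct sets ("units") $E_1,\dots,E_N$ of size $m$, $N\ge1$, $\mathcal U=\{E_1,\dots,E_N\}$, with $\mathcal G^{E}$ finite and non-empty for $E\in\mathcal U$; put $\mathsf H^E=|\mathcal G^E|^{-1}\sum_{\mathsf P\in\mathcal G^E}\mathsf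 P$ and $\xi^E=\log\frac{d\mathsf H^E}{d\mathsf F^E}$, $\xi_n^E=\xi^E(X_n^E)$. *Round Robin CUSUM with threshold $A>0$.* $\tilde S_1=E_1$, $Y_0=0$, $Y_n=\max\{Y_{n-1},0\}+\xi_n^{\tilde S_n}$; if $Y_n\le 0$ the next unit in cyclic order is sampled at time $n+1$, if $Y_n\in(0,A)$ the same unit is sampled again, and $\tilde T=\inf\{n\ge1:Y_n\ge A\}$. The delay is $$D^{\mathsf G}(\tilde S,\tilde T)=\sup_{\nu\ge0}\ \operatorname{ess\,sup}\ \mathbb E_\nu^{\mathsf G}\big[\tilde T-\nu\,\big|\,\mathcal F_\nu(\mathsf G),\tilde T>\nu\big],$$ where $\mathcal F_\nu(\mathsf G)$ is the $\sigma$-algebra generated by $\tilde S_t, X_t^{\tilde S_t}$ for those $t\le\nu$ with $\tilde S_t\in\mathcal A(\mathsf G)$. *Quantities.* $\mathcal J_\infty^E=\int\log\frac{d\mathsf F^E}{d\mathsf H^E}d\mathsf F^E$, $\mathcal J_0^E=\int\xi^E d\mathsf G^E$, $\mathcal W_0^E=\int(\xi^E-\mathcal J_0^E)^2d\mathsf G^E$.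 Let $\zeta_-^E$, $\zeta_A^E$ be the first times $n\ge1$ at which $\sum_{t\le n}\xi_t^E$ is $<0$, respectively $>A$ (with all $X_t\sim\mathsf F$ or all $X_t\sim\mathsf G$ as indicated), $\zeta_+^E:=\zeta_0^E$, $q_+^E=\mathsf F(\zeta_+^E=\infty)$, $q_-^E=\mathsf G(\zeta_-^E=\infty)$, $q_A^E=\mathsf G(\zeta_A^E<\zeta_-^E)$. Let $n=|\mathcal A(\mathsf G)\cap\mathcal U|$, list the affected units $\mathcal A(\mathsf G)\cap\mathcal U$ in the order of $E_1,\dots,E_N$, and write $\tilde{\mathcal J}_0^j$, $\tilde q_A^j$, $j\in[n]$, for the quantities of the $j$-th one. Let $\kappa(j,l)\in[n]$ be congruent to $j+l-1$ modulo $n$, and $$\frac1{\mathcal J_*^j}=\sum_{l=1}^{n}\frac{w_l^j}{\tilde{\mathcal J}_0^{\kappa(j,l)}},\qquad w_l^j=\frac{\tilde q_A^{\kappa(j,l)}\prod_{s=1}^{l-1}(1-\tilde q_A^{\kappa(j,s)})}{1-\prod_{s=1}^{n}(1-\tilde q_A^{\kappa(j,s)})}$$ ($w_l^j$ and $\mathcal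 J_*^j$ depend on $A$). **Proposition.** Fix $\mathsf G\in\mathcal G$ with $\mathcal A(\mathsf G)\cap\mathcal U\ne\emptyset$. Assume $\mathcal J_\infty^E\in(0,\infty)$ for every $E\in\mathcal U$, and, for every $E\in\mathcal A(\mathsf G)\cap\mathcal U$, $\mathcal J_0^E\in(0,\infty)$, $\mathcal W_0^E<\infty$, and that the equation $$\int\Big(\frac{d\mathsf H^E}{d\mathsf F^E}\Big)^{-t}d\mathsf G^E=1$$ has exactly one positive real root $t=t_E$. For $A>0$ put $$\omega_2^E(A)=\sup_{0\le r<A}\mathbb E_{\mathsf G}\big[e^{-t_E(\xi_1^E+r)}\,\big|\,\xi_1^E\le -r\big]$$ (over those $r$ for which the condition has positive probability). For $j\in[n]$, with $E$ the $j$-th affected unit, $\omega_0=-t_E$, $\omega_2=\omega_2^E(A)$, $J=\tilde{\mathcal J}_0^j$, $J'=\mathcal J_*^{\kappa(j,2)}$, let $\Phi_j(A)=0$ if $J\ge J'$, and if $J'>J$ $$\Phi_j(A)=\min\Big\{0,\ \frac1{\omega_0}\Big(\log(-A\omega_0)+\log\big(1-\tfrac{J}{J'}\big)-\log\omega_2+1\Big)-J\,\frac{Ae^{\omega_0A}}{\omega_2}\Big(\frac1{J'}-\frac1J\Big)\Big\}.$$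 Then $\Phi_j(A)/A\to0$ as $A\to\infty$ for every $j\in[n]$, and there is a finite constant $C>0$, independent of $A$, such that for every $A>0$ $$D^{\mathsf G}(\tilde S,\tilde T)\le\max_{j\in[n]}\left(\frac{A}{\mathcal J_*^j}\vee\frac{A+\Phi_j(A)}{\mathcal J_*^{\kappa(j,2)}}\vee\frac{A+\Phi_j(A)}{\tilde{\mathcal J}_0^j}\right)+\frac{\sum_{E\in\mathcal U\setminus\mathcal A(\mathsf G)}1/q_+^E}{1-\prod_{E\in\mathcal A(\mathsf G)\cap\mathcal U}(1-q_-^E)}+\max_{E\in\mathcal A(\mathsf G)\cap\mathcal U}\frac1{q_-^E}\Big(1+\frac{\mathcal W_0^E}{(\mathcal J_0^E)^2}\Big)+C .$$ -/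

import Mathlib

open MeasureTheory ProbabilityTheory Filter Topology
open scoped ENNReal

noncomputable section

namespace RoundRobin

variable {K : ℕ} {𝓧 : Fin K → Type*} [∀ k, MeasurableSpace (𝓧 k)]

/-! ### The change-point model -/

/-- The local distribution of the set of sources `E` under the global distribution `P`. -/
def localLaw (P : Measure (∀ k, 𝓧 k)) (E : Finset (Fin K)) : Measure (∀ k : E, 𝓧 k) :=
  P.map E.restrict

/-- The family of the sets of `m` sources whose local distribution differs under `F` and `G`. -/
def affected (F G : Measure (∀ k, 𝓧 k)) (m : ℕ) : Set (Finset (Fin K)) :=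
  {E | E.card = m ∧ localLaw G E ≠ localLaw F E}

/-- The family of the plausible post-change local distributions of `E`. -/
def localFamily (𝒢 : Set (Measure (∀ k, 𝓧 k))) (F : Measure (∀ k, 𝓧 k)) (E : Finset (Fin K)) :
    Set (Measure (∀ k : E, 𝓧 k)) :=
  {P | ∃ G ∈ 𝒢, P = localLaw G E ∧ localLaw G E ≠ localLaw F E}

/-- The uniform mixture of the plausible post-change local distributions of `E`. -/
def mixture (𝒢 : Set (Measure (∀ k, 𝓧 k))) (F : Measure (∀ k, 𝓧 k)) (E : Finset (Fin K)) :
    Measure (∀ k : E, 𝓧 k) :=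
  ((localFamily 𝒢 F E).ncard : ℝ≥0∞)⁻¹ •
    Measure.sum (fun P : localFamily 𝒢 F E => (P : Measure (∀ k : E, 𝓧 k)))

/-- The log-likelihood ratio of the mixture versus the pre-change local distribution of `E`. -/
def xi (𝒢 : Set (Measure (∀ k, 𝓧 k))) (F : Measure (∀ k, 𝓧 k)) (E : Finset (Fin K))
    (x : ∀ k : E, 𝓧 k) : ℝ :=
  llr (mixture 𝒢 F E) (localLaw F E) x

/-- The law of the whole sequence of observations when the change happens at time `ν`.
The coordinate `i : ℕ` is the observation at time `i + 1`. -/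
def changeLaw (F G : Measure (∀ k, 𝓧 k)) (ν : ℕ) : Measure (ℕ → ∀ k, 𝓧 k) :=
  Measure.infinitePi (fun i => if i < ν then F else G)

/-- The law of the whole sequence of observations when there is no change. -/
def noChangeLaw (F : Measure (∀ k, 𝓧 k)) : Measure (ℕ → ∀ k, 𝓧 k) :=
  Measure.infinitePi (fun _ => F)

/-! ### The worst-case conditional expected detection delay

A sampling rule is given by `S i ω`, the set of sources sampled at time `i + 1`. -/

/-- The `σ`-algebra generated by the times, up to time `ν`, at which the sampled set of sources
is affected, together with the sets sampled and the values observed at these times. -/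
@[reducible]
def affectedHistory (F G : Measure (∀ k, 𝓧 k)) (m : ℕ)
    (S : ℕ → (ℕ → ∀ k, 𝓧 k) → Finset (Fin K)) (ν : ℕ) : MeasurableSpace (ℕ → ∀ k, 𝓧 k) :=
  MeasurableSpace.generateFrom
    {s | ∃ i < ν, ∃ E ∈ affected F G m, ∃ B : Set (∀ k : E, 𝓧 k), MeasurableSet B ∧
      s = {ω | S i ω = E ∧ E.restrict (ω i) ∈ B}}

/-- The supremum over the change-points `ν` of the essential supremum of the conditional
expectation of `T - ν` given `{T > ν}` and the history of the affected sources up to `ν`. -/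
def worstDelay (F G : Measure (∀ k, 𝓧 k)) (m : ℕ)
    (S : ℕ → (ℕ → ∀ k, 𝓧 k) → Finset (Fin K)) (T : (ℕ → ∀ k, 𝓧 k) → ℕ∞) : ℝ≥0∞ :=
  ⨆ ν : ℕ, essSup
    (condLExp (affectedHistory F G m S ν) (cond (changeLaw F G ν) {ω | (ν : ℕ∞) < T ω})
      (fun ω => ((T ω : ℕ∞) : ℝ≥0∞) - (ν : ℝ≥0∞)))
    (cond (changeLaw F G ν) {ω | (ν : ℕ∞) < T ω})

/-! ### The Round Robin CUSUM policy -/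

variable {N : ℕ} [NeZero N]

/-- The state at time `n`: the index of the unit sampled at time `n + 1`, and the statistic `Y n`.
Addition in `Fin N` is cyclic. (After the alarm the recursion goes on, which is irrelevant.) -/
def rrState (𝒢 : Set (Measure (∀ k, 𝓧 k))) (F : Measure (∀ k, 𝓧 k))
    (U : Fin N → Finset (Fin K)) (ω : ℕ → ∀ k, 𝓧 k) : ℕ → Fin N × ℝ
  | 0 => (0, 0)
  | n + 1 =>
    let d := (rrState 𝒢 F U ω n).1
    let y := max (rrState 𝒢 F U ω n).2 0 + xi 𝒢 F (U d) ((U d).restrict (ω n))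
    (if y ≤ 0 then d + 1 else d, y)

/-- The sampling rule: `rrSample i` is the unit sampled at time `i + 1`. -/
def rrSample (𝒢 : Set (Measure (∀ k, 𝓧 k))) (F : Measure (∀ k, 𝓧 k))
    (U : Fin N → Finset (Fin K)) (i : ℕ) (ω : ℕ → ∀ k, 𝓧 k) : Finset (Fin K) :=
  U (rrState 𝒢 F U ω i).1

/-- The alarm time: the first `n ≥ 1` with `Y n ≥ A`. -/
def rrStop (𝒢 : Set (Measure (∀ k, 𝓧 k))) (F : Measure (∀ k, 𝓧 k))
    (U : Fin N → Finset (Fin K)) (A : ℝ) (ω : ℕ → ∀ k, 𝓧 k) : ℕ∞ :=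
  sInf {t : ℕ∞ | ∃ n : ℕ, t = n ∧ 1 ≤ n ∧ A ≤ (rrState 𝒢 F U ω n).2}

/-! ### Drifts, variances, and random walk quantities of a unit -/

/-- The drift of the log-likelihood ratio of `E` before the change, with the sign reversed. -/
def Jinf (𝒢 : Set (Measure (∀ k, 𝓧 k))) (F : Measure (∀ k, 𝓧 k)) (E : Finset (Fin K)) : ℝ :=
  ∫ x, llr (localLaw F E) (mixture 𝒢 F E) x ∂(localLaw F E)

/-- The drift of the log-likelihood ratio of `E` after the change. -/
def J0 (𝒢 : Set (Measure (∀ k, 𝓧 k))) (F G : Measure (∀ k, 𝓧 k)) (E : Finset (Fin K)) : ℝ :=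
  ∫ x, xi 𝒢 F E x ∂(localLaw G E)

/-- The variance of the log-likelihood ratio of `E` after the change. -/
def W0 (𝒢 : Set (Measure (∀ k, 𝓧 k))) (F G : Measure (∀ k, 𝓧 k)) (E : Finset (Fin K)) : ℝ :=
  ∫ x, (xi 𝒢 F E x - J0 𝒢 F G E) ^ 2 ∂(localLaw G E)

/-- The random walk whose increments are the log-likelihood ratios of `E`. -/
def walk (𝒢 : Set (Measure (∀ k, 𝓧 k))) (F : Measure (∀ k, 𝓧 k)) (E : Finset (Fin K))
    (ω : ℕ → ∀ k, 𝓧 k) (n : ℕ) : ℝ :=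
  ∑ i ∈ Finset.range n, xi 𝒢 F E (E.restrict (ω i))

/-- The first time `n ≥ 1` at which the random walk of `E` is below `0`. -/
def timeBelow (𝒢 : Set (Measure (∀ k, 𝓧 k))) (F : Measure (∀ k, 𝓧 k)) (E : Finset (Fin K))
    (ω : ℕ → ∀ k, 𝓧 k) : ℕ∞ :=
  sInf {t : ℕ∞ | ∃ n : ℕ, t = n ∧ 1 ≤ n ∧ walk 𝒢 F E ω n < 0}

/-- The first time `n ≥ 1` at which the random walk of `E` is above `a`. -/
def timeAbove (𝒢 : Set (Measure (∀ k, 𝓧 k))) (F : Measure (∀ k, 𝓧 k)) (E : Finset (Fin K))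
    (a : ℝ) (ω : ℕ → ∀ k, 𝓧 k) : ℕ∞ :=
  sInf {t : ℕ∞ | ∃ n : ℕ, t = n ∧ 1 ≤ n ∧ a < walk 𝒢 F E ω n}

/-- The probability, without a change, that the random walk of `E` never exceeds `0`. -/
def qPlus (𝒢 : Set (Measure (∀ k, 𝓧 k))) (F : Measure (∀ k, 𝓧 k)) (E : Finset (Fin K)) : ℝ :=
  (noChangeLaw F).real {ω | timeAbove 𝒢 F E 0 ω = ⊤}

/-- The probability, after the change, that the random walk of `E` never falls below `0`. -/
def qMinus (𝒢 : Set (Measure (∀ k, 𝓧 k))) (F G : Measure (∀ k, 𝓧 k)) (E : Finset (Fin K)) : ℝ :=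
  (changeLaw F G 0).real {ω | timeBelow 𝒢 F E ω = ⊤}

/-- The probability, after the change, that the random walk of `E` exceeds `A` before it falls
below `0`. -/
def qLevel (𝒢 : Set (Measure (∀ k, 𝓧 k))) (F G : Measure (∀ k, 𝓧 k)) (E : Finset (Fin K))
    (A : ℝ) : ℝ :=
  (changeLaw F G 0).real {ω | timeAbove 𝒢 F E A ω < timeBelow 𝒢 F E ω}

/-- `t` is a positive root of `∫ (dH/dF)^(-t) dG = 1`. -/
def IsRoot (𝒢 : Set (Measure (∀ k, 𝓧 k))) (F G : Measure (∀ k, 𝓧 k)) (E : Finset (Fin K))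
    (t : ℝ) : Prop :=
  0 < t ∧ ∫⁻ x, ((mixture 𝒢 F E).rnDeriv (localLaw F E) x) ^ (-t) ∂(localLaw G E) = 1

/-- The positive root of `∫ (dH/dF)^(-t) dG = 1`, when there is exactly one. -/
def root (𝒢 : Set (Measure (∀ k, 𝓧 k))) (F G : Measure (∀ k, 𝓧 k)) (E : Finset (Fin K)) : ℝ :=
  sInf {t : ℝ | IsRoot 𝒢 F G E t}

/-- The constant in Wald's bound: with `t` the root, the largest conditional expectation
of `exp (-t * (ξ + r))` given `ξ ≤ -r`, over the levels `0 ≤ r < A`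
(levels with `ξ > -r` almost surely contribute `0`). -/
def overshoot (𝒢 : Set (Measure (∀ k, 𝓧 k))) (F G : Measure (∀ k, 𝓧 k)) (E : Finset (Fin K))
    (A : ℝ) : ℝ :=
  ⨆ r : Set.Ico (0 : ℝ) A,
    ∫ x, Real.exp (-root 𝒢 F G E * (xi 𝒢 F E x + r)) ∂(cond (localLaw G E) {x | xi 𝒢 F E x ≤ -r})

/-! ### Quantities indexed by the affected units -/

open Classical in
/-- The indices of the affected units. -/
def affIdx (F G : Measure (∀ k, 𝓧 k)) (m : ℕ) (U : Fin N → Finset (Fin K)) : Finset (Fin N) :=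
  Finset.univ.filter (fun d => U d ∈ affected F G m)

/-- The number of affected units. -/
abbrev affNum (F G : Measure (∀ k, 𝓧 k)) (m : ℕ) (U : Fin N → Finset (Fin K)) : ℕ :=
  (affIdx F G m U).card

/-- The affected units, in the order of the enumeration of the units. -/
def affUnit (F G : Measure (∀ k, 𝓧 k)) (m : ℕ) (U : Fin N → Finset (Fin K))
    (j : Fin (affNum F G m U)) : Finset (Fin K) :=
  U ((affIdx F G m U).orderEmbOfFin rfl j)

/-- The element that is reached from `j` after `l` steps in the cyclic order of `Fin n`. -/
def cyc {n : ℕ} (j : Fin n) (l : ℕ) : Fin n :=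
  ⟨((j : ℕ) + l) % n, Nat.mod_lt _ j.pos⟩

/-- With `q j` the probability of stopping at the affected unit `j`, the conditional probability
of stopping at the affected unit `cyc j l` in a cycle that starts from `j`, given that one stops
in this cycle. -/
def weight {n : ℕ} (q : Fin n → ℝ) (j : Fin n) (l : ℕ) : ℝ :=
  (q (cyc j l) * ∏ s ∈ Finset.range l, (1 - q (cyc j s))) /
    (1 - ∏ s ∈ Finset.range n, (1 - q (cyc j s)))

/-- The weighted harmonic mean of the drifts of the affected units, for the cycle starting
from `j` and the threshold `A`. -/
def Jstar (𝒢 : Set (Measure (∀ k, 𝓧 k))) (F G : Measure (∀ k, 𝓧 k)) (m : ℕ)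
    (U : Fin N → Finset (Fin K)) (A : ℝ) (j : Fin (affNum F G m U)) : ℝ :=
  (∑ l ∈ Finset.range (affNum F G m U),
    weight (fun i => qLevel 𝒢 F G (affUnit F G m U i) A) j l *
      (1 / J0 𝒢 F G (affUnit F G m U (cyc j l))))⁻¹

/-- The correction term `Φ_j(A)`. In the second case the formula comes from maximizing, over the
value of the statistic at the change-point, the bound that Wald's inequality provides. -/
def Phi (𝒢 : Set (Measure (∀ k, 𝓧 k))) (F G : Measure (∀ k, 𝓧 k)) (m : ℕ)
    (U : Fin N → Finset (Fin K)) (j : Fin (affNum F G m U)) (A : ℝ) : ℝ :=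
  let ω₀ : ℝ := -root 𝒢 F G (affUnit F G m U j)
  let ω₂ : ℝ := overshoot 𝒢 F G (affUnit F G m U j) A
  let J : ℝ := J0 𝒢 F G (affUnit F G m U j)
  let J' : ℝ := Jstar 𝒢 F G m U A (cyc j 1)
  if J' ≤ J then 0
  else min 0
    (1 / ω₀ * (Real.log (-A * ω₀) + Real.log (1 - J / J') - Real.log ω₂ + 1)
      - J * (A * Real.exp (ω₀ * A) / ω₂) * (1 / J' - 1 / J))

/-- The first-order term of the bound. -/
def firstOrder (𝒢 : Set (Measure (∀ k, 𝓧 k))) (F G : Measure (∀ k, 𝓧 k)) (m : ℕ)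
    (U : Fin N → Finset (Fin K)) (A : ℝ) : ℝ :=
  ⨆ j : Fin (affNum F G m U),
    max (A / Jstar 𝒢 F G m U A j)
      (max ((A + Phi 𝒢 F G m U j A) / Jstar 𝒢 F G m U A (cyc j 1))
        ((A + Phi 𝒢 F G m U j A) / J0 𝒢 F G (affUnit F G m U j)))

/-- The explicit part of the remainder of the bound, which does not depend on the threshold. -/
def secondOrder (𝒢 : Set (Measure (∀ k, 𝓧 k))) (F G : Measure (∀ k, 𝓧 k)) (m : ℕ)
    (U : Fin N → Finset (Fin K)) : ℝ :=
  1 / (1 - ∏ d ∈ affIdx F G m U, (1 - qMinus 𝒢 F G (U d))) *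
      ∑ d ∈ (affIdx F G m U)ᶜ, 1 / qPlus 𝒢 F (U d)
    + ⨆ j : Fin (affNum F G m U),
        1 / qMinus 𝒢 F G (affUnit F G m U j) *
          (1 + W0 𝒢 F G (affUnit F G m U j) / J0 𝒢 F G (affUnit F G m U j) ^ 2)

end RoundRobin

end

open RoundRobin

/-! ### Infinite product measures: resampling and permuting coordinates -/

/-! The delay is bounded by a Lyapunov argument. Every unit `d` and every value `y` of the statistic
receive a potential `Ψ d y` whose post-change expectation drops by at least one with each
observation. Summing the drops up to the alarm shows that the expected remaining time is at most the
potential of the state occupied at the change-point (`sum_measure_alive_le`, `worstDelay_le`).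

For an affected unit with drift `J` the potential starts from the time needed to climb `A - y`,
which is `(A - y) / J` up to a bounded error because the variance is finite
(`exists_passage_potential`). It is corrected by what leaving from below costs or saves, weighted
with Wald's exponential bounds for the probability of that exit (`affected_step`). For an unaffected
unit it is linear in `y`. At a reset the potential is at most `A * b d + c d`, and
`exists_cyclic_levels` solves the resulting inequalities around the cycle: unless all affected
drifts coincide, every `b d` lies below `1 / J` of the slowest unit by a margin `g > 0` that does
not depend on `A`, since a faster unit is reached with positive probability from everywhere.

Only the third entry `(A + Φ) / J` of the maximum, at a slowest affected unit, is then needed.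
Maximizing `(A - y) / J` minus `A * g` times the exit probability over `y` lowers `A / J` by a
logarithm of `A`, and this is the order of `Φ`; replacing the exact difference of reciprocal drifts
by `g` changes the bound by a constant. If all drifts coincide then `g = 0`, but `Φ = 0` too. The
explicit remainder is absorbed in the final constant.

The delicate point is the conditioning. The history records only affected units, so when an
unaffected unit is being sampled at the change-point, the statistic is a negative-drift walk
conditioned to have stayed in `(0, A)` since its last reset. Its mean must be bounded uniformly over
the age of the run and over `A` (`exists_killed_mean_le`). Before the change `exp ξ` has mean one,
so the Laplace transform agrees at `0` and `1`, and Rolle's theorem yields a tilting that centers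
the walk (`exists_expTilt`). The central limit theorem, the cycle lemma and Chernoff's bound show
that the centered walk stays inside the interval, and comes down from height `2 * z` to a bounded
height in about `z ^ 2 / log z` steps, with polynomially small probability at worst. An induction on
time turns this into tails of order `z ^ κ * exp (-θ * z)` (`ExpTilt.exists_tail_le`). -/

theorem measurePreserving_update_infinitePi {X : ℕ → Type*} [∀ i, MeasurableSpace (X i)]
    (μ : ∀ i, Measure (X i)) [∀ i, IsProbabilityMeasure (μ i)] (n : ℕ) :
    MeasurePreserving (fun p : (∀ i, X i) × X n => Function.update p.1 n p.2)
      ((Measure.infinitePi μ).prod (μ n)) (Measure.infinitePi μ) := by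
  have hm : Measurable (fun p : (∀ i, X i) × X n => Function.update p.1 n p.2) :=
    measurable_update'
  refine ⟨hm, Measure.eq_infinitePi μ fun s t ht => ?_⟩
  rw [Measure.map_apply hm (MeasurableSet.pi s.countable_toSet fun i _ => ht i)]
  by_cases hn : n ∈ s
  · have : (fun p : (∀ i, X i) × X n => Function.update p.1 n p.2) ⁻¹' ((s : Set ℕ).pi t)
        = (((s.erase n : Finset ℕ) : Set ℕ).pi t) ×ˢ (t n) := by
      ext ⟨ω, x⟩
      simp only [Set.mem_preimage, Set.mem_pi, Set.mem_prod, Finset.coe_erase, Set.mem_sdiff,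
        Finset.mem_coe, Set.mem_singleton_iff]
      constructor
      · intro h
        refine ⟨fun i hi => ?_, ?_⟩
        · have := h i hi.1
          rwa [Function.update_of_ne hi.2] at this
        · simpa using h n hn
      · rintro ⟨h1, h2⟩ i hi
        by_cases hin : i = n
        · subst hin; simpa using h2
        · rw [Function.update_of_ne hin]; exact h1 i ⟨hi, hin⟩
    rw [this, Measure.prod_prod, Measure.infinitePi_pi _ (fun i _ => ht i), mul_comm,
      Finset.mul_prod_erase s (fun i => μ i (t i)) hn]
  · have : (fun p : (∀ i, X i) × X n => Function.update p.1 n p.2) ⁻¹' ((s : Set ℕ).pi t)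
        = ((s : Set ℕ).pi t) ×ˢ Set.univ := by
      ext ⟨ω, x⟩
      simp only [Set.mem_preimage, Set.mem_pi, Set.mem_prod, Finset.mem_coe, Set.mem_univ, and_true]
      refine forall₂_congr fun i hi => ?_
      rw [Function.update_of_ne (by rintro rfl; exact hn hi)]
    rw [this, Measure.prod_prod, Measure.infinitePi_pi _ (fun i _ => ht i), measure_univ, mul_one]

/-- Resampling one coordinate leaves the product law unchanged. All one-step arguments, for the
killed walk and for the policy, integrate out the newest observation in this way. -/
theorem lintegral_infinitePi_update {X : ℕ → Type*} [∀ i, MeasurableSpace (X i)]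
    (μ : ∀ i, Measure (X i)) [∀ i, IsProbabilityMeasure (μ i)] (n : ℕ)
    {f : (∀ i, X i) → ℝ≥0∞} (hf : Measurable f) :
    ∫⁻ ω, f ω ∂(Measure.infinitePi μ)
      = ∫⁻ ω, ∫⁻ x, f (Function.update ω n x) ∂(μ n) ∂(Measure.infinitePi μ) := by
  have h := measurePreserving_update_infinitePi μ n
  rw [← h.lintegral_comp hf]
  exact lintegral_prod _ (hf.comp h.measurable).aemeasurable

theorem measurePreserving_perm_infinitePi (lam : Measure ℝ) [IsProbabilityMeasure lam]
    (e : Equiv.Perm ℕ) :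
    MeasurePreserving (fun ω : ℕ → ℝ => fun i => ω (e i))
      (Measure.infinitePi fun _ : ℕ => lam) (Measure.infinitePi fun _ : ℕ => lam) := by
  have hm : Measurable (fun ω : ℕ → ℝ => fun i => ω (e i)) :=
    measurable_pi_lambda _ fun i => measurable_pi_apply _
  refine ⟨hm, Measure.eq_infinitePi _ fun s t ht => ?_⟩
  rw [Measure.map_apply hm (MeasurableSet.pi s.countable_toSet fun i _ => ht i)]
  have : (fun ω : ℕ → ℝ => fun i => ω (e i)) ⁻¹' ((s : Set ℕ).pi t)
      = ((s.map e.toEmbedding : Finset ℕ) : Set ℕ).pi (fun i => t (e.symm i)) := by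
    ext ω
    simp only [Set.mem_preimage, Set.mem_pi, Finset.mem_coe, Finset.mem_map_equiv]
    exact ⟨fun h i hi => by simpa using h _ hi, fun h i hi => by simpa using h (e i) (by simpa)⟩
  rw [this, Measure.infinitePi_pi _ (fun i _ => ht _)]
  simp

/-! ### Random walks killed outside an interval -/

/-- The partial sums of a sequence. -/
def psum (ω : ℕ → ℝ) (n : ℕ) : ℝ := ∑ i ∈ Finset.range n, ω i

@[simp] theorem psum_zero (ω : ℕ → ℝ) : psum ω 0 = 0 := by simp [psum]

theorem psum_succ (ω : ℕ → ℝ) (n : ℕ) : psum ω (n + 1) = psum ω n + ω n :=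
  Finset.sum_range_succ _ _

@[fun_prop]
theorem measurable_psum (n : ℕ) : Measurable fun ω : ℕ → ℝ => psum ω n := by
  unfold psum
  fun_prop

theorem psum_update_of_le (ω : ℕ → ℝ) {i n : ℕ} (h : i ≤ n) (u : ℝ) :
    psum (Function.update ω n u) i = psum ω i := by
  refine Finset.sum_congr rfl fun j hj => ?_
  rw [Function.update_of_ne]
  have := Finset.mem_range.1 hj
  omega

theorem psum_update_succ (ω : ℕ → ℝ) (n : ℕ) (u : ℝ) :
    psum (Function.update ω n u) (n + 1) = psum ω n + u := by
  rw [psum_succ, psum_update_of_le ω le_rfl]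
  simp

/-- The transition operator of the random walk with step law `lam`, killed outside `D`. -/
noncomputable def killed (lam : Measure ℝ) (D : Set ℝ) (f : ℝ → ℝ≥0∞) (x : ℝ) : ℝ≥0∞ :=
  ∫⁻ u, (D).indicator f (x + u) ∂lam

theorem measurable_killed (lam : Measure ℝ) [SFinite lam] {D : Set ℝ} (hD : MeasurableSet D) {f : ℝ → ℝ≥0∞}
    (hf : Measurable f) : Measurable (killed lam D f) := by
  unfold killed
  have : Measurable (fun p : ℝ × ℝ => (D).indicator f (p.1 + p.2)) :=
    (hf.indicator hD).comp (measurable_fst.add measurable_snd)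
  exact this.lintegral_prod_right'

theorem measurable_killed_iterate (lam : Measure ℝ) [SFinite lam] {D : Set ℝ} (hD : MeasurableSet D) {f : ℝ → ℝ≥0∞}
    (hf : Measurable f) (n : ℕ) : Measurable ((killed lam D)^[n] f) := by
  induction n generalizing f with
  | zero => simpa
  | succ n ih => rw [Function.iterate_succ_apply]; exact ih (measurable_killed lam hD hf)

theorem killed_mono (lam : Measure ℝ) (D : Set ℝ) {f g : ℝ → ℝ≥0∞}
    (h : ∀ y ∈ D, f y ≤ g y) (x : ℝ) : killed lam D f x ≤ killed lam D g x := by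
  refine lintegral_mono fun u => ?_
  by_cases hu : x + u ∈ D
  · simp only [Set.indicator_of_mem hu]; exact h _ hu
  · simp only [Set.indicator_of_notMem hu]; exact le_rfl

theorem killed_iterate_mono (lam : Measure ℝ) (D : Set ℝ) {f g : ℝ → ℝ≥0∞} (n : ℕ)
    (h : ∀ y, f y ≤ g y) (x : ℝ) :
    (killed lam D)^[n] f x ≤ (killed lam D)^[n] g x := by
  induction n generalizing f g x with
  | zero => exact h x
  | succ n ih =>
    rw [Function.iterate_succ_apply, Function.iterate_succ_apply]
    exact ih (killed_mono lam D fun y _ => h y) x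

/-- For a positive number of steps only the values on `D` matter. -/
theorem killed_iterate_mono_of_pos (lam : Measure ℝ) (D : Set ℝ) {f g : ℝ → ℝ≥0∞} {n : ℕ} (hn : n ≠ 0)
    (h : ∀ y ∈ D, f y ≤ g y) (x : ℝ) :
    (killed lam D)^[n] f x ≤ (killed lam D)^[n] g x := by
  obtain ⟨n, rfl⟩ := Nat.exists_eq_succ_of_ne_zero hn
  rw [Function.iterate_succ_apply, Function.iterate_succ_apply]
  exact killed_iterate_mono lam D n (killed_mono lam D h) x

theorem killed_const_mul (lam : Measure ℝ) [SFinite lam] {D : Set ℝ} (hD : MeasurableSet D) (c : ℝ≥0∞) {f : ℝ → ℝ≥0∞}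
    (hf : Measurable f) : killed lam D (fun y => c * f y) = fun x => c * killed lam D f x := by
  ext x
  unfold killed
  rw [← lintegral_const_mul c]
  · refine lintegral_congr fun u => ?_
    by_cases hu : x + u ∈ D <;> simp [hu]
  · exact (hf.indicator hD).comp (measurable_const.add measurable_id)

theorem killed_iterate_const_mul (lam : Measure ℝ) [SFinite lam] {D : Set ℝ} (hD : MeasurableSet D) (c : ℝ≥0∞)
    {f : ℝ → ℝ≥0∞} (hf : Measurable f) (n : ℕ) :
    (killed lam D)^[n] (fun y => c * f y) = fun x => c * (killed lam D)^[n] f x := by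
  induction n generalizing f with
  | zero => rfl
  | succ n ih =>
    rw [Function.iterate_succ_apply, killed_const_mul lam hD c hf, ih (measurable_killed lam hD hf),
      Function.iterate_succ_apply]

theorem killed_add (lam : Measure ℝ) [SFinite lam] {D : Set ℝ} (hD : MeasurableSet D) {f g : ℝ → ℝ≥0∞}
    (hf : Measurable f) :
    killed lam D (fun y => f y + g y) = fun x => killed lam D f x + killed lam D g x := by
  ext x
  unfold killed
  rw [← lintegral_add_left]
  · refine lintegral_congr fun u => ?_
    by_cases hu : x + u ∈ D <;> simp [hu]
  · exact (hf.indicator hD).comp (measurable_const.add measurable_id)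

theorem killed_iterate_add (lam : Measure ℝ) [SFinite lam] {D : Set ℝ} (hD : MeasurableSet D) {f g : ℝ → ℝ≥0∞}
    (hf : Measurable f) (n : ℕ) :
    (killed lam D)^[n] (fun y => f y + g y)
      = fun x => (killed lam D)^[n] f x + (killed lam D)^[n] g x := by
  induction n generalizing f g with
  | zero => rfl
  | succ n ih =>
    rw [Function.iterate_succ_apply, killed_add lam hD hf, ih (measurable_killed lam hD hf),
      Function.iterate_succ_apply, Function.iterate_succ_apply]

theorem killed_tsum (lam : Measure ℝ) [SFinite lam] {D : Set ℝ} (hD : MeasurableSet D) {f : ℕ → ℝ → ℝ≥0∞}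
    (hf : ∀ i, Measurable (f i)) :
    killed lam D (fun y => ∑' i, f i y) = fun x => ∑' i, killed lam D (f i) x := by
  ext x
  unfold killed
  rw [← lintegral_tsum]
  · refine lintegral_congr fun u => ?_
    by_cases hu : x + u ∈ D <;> simp [hu]
  · exact fun i =>
      (((hf i).indicator hD).comp (measurable_const.add measurable_id)).aemeasurable

theorem killed_iterate_tsum (lam : Measure ℝ) [SFinite lam] {D : Set ℝ} (hD : MeasurableSet D) {f : ℕ → ℝ → ℝ≥0∞}
    (hf : ∀ i, Measurable (f i)) (n : ℕ) :
    (killed lam D)^[n] (fun y => ∑' i, f i y) = fun x => ∑' i, (killed lam D)^[n] (f i) x := by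
  induction n generalizing f with
  | zero => rfl
  | succ n ih =>
    rw [Function.iterate_succ_apply, killed_tsum lam hD hf, ih fun i => measurable_killed lam hD (hf i)]
    rfl

/-- The event that the walk started at `x` stays in `D` during the first `n` steps. -/
def stay (D : Set ℝ) (x : ℝ) (n : ℕ) : Set (ℕ → ℝ) :=
  -- The starting point is not tested: a run starts at `0`, which lies outside `Ioo 0 A`.
  {ω | ∀ i, 1 ≤ i → i ≤ n → x + psum ω i ∈ D}

theorem measurableSet_imp {α : Type*} [MeasurableSpace α] (p : Prop) {s : Set α}
    (hs : MeasurableSet s) : MeasurableSet {a | p → a ∈ s} := by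
  by_cases hp : p
  · simpa [hp] using hs
  · simp [hp]

theorem measurableSet_forall_psum {p : ℕ → ℝ → Prop} (hp : ∀ i, MeasurableSet {y | p i y}) :
    MeasurableSet {ω : ℕ → ℝ | ∀ i, p i (psum ω i)} := by
  rw [Set.ofPred_forall]
  exact MeasurableSet.iInter fun i => measurable_psum i (hp i)

theorem measurableSet_stay {D : Set ℝ} (hD : MeasurableSet D) (x : ℝ) (n : ℕ) : MeasurableSet (stay D x n) := by
  refine measurableSet_forall_psum (p := fun i y => 1 ≤ i → i ≤ n → x + y ∈ D) fun i => ?_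
  exact measurableSet_imp _ (measurableSet_imp _
    ((measurable_const.add measurable_id) hD))

theorem killed_iterate_eq_lintegral (lam : Measure ℝ) [IsProbabilityMeasure lam] {D : Set ℝ} (hD : MeasurableSet D)
    {f : ℝ → ℝ≥0∞} (hf : Measurable f) (n : ℕ) (x : ℝ) :
    (killed lam D)^[n] f x = ∫⁻ ω, (stay D x n).indicator (fun ω => f (x + psum ω n)) ω
      ∂(Measure.infinitePi fun _ : ℕ => lam) := by
  induction n generalizing f with
  | zero =>
    have : stay D x 0 = Set.univ := by
      ext ω; simp only [stay, Set.mem_ofPred_eq, Set.mem_univ, iff_true]; omega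
    simp [this]
  | succ n ih =>
    -- The innermost application of the operator is the last step of the walk; it is matched with
    -- the integral over coordinate `n`.
    rw [Function.iterate_succ_apply, ih (measurable_killed lam hD hf)]
    rw [lintegral_infinitePi_update (fun _ : ℕ => lam) n
      (f := (stay D x (n + 1)).indicator (fun ω => f (x + psum ω (n + 1))))]
    · refine lintegral_congr fun ω => ?_
      by_cases hω : ω ∈ stay D x n
      · rw [Set.indicator_of_mem hω, killed]
        refine lintegral_congr fun u => ?_
        by_cases hu : x + psum ω n + u ∈ D
        · rw [Set.indicator_of_mem hu, Set.indicator_of_mem]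
          · rw [psum_update_succ, add_assoc]
          · intro i h1 h2
            rcases Nat.lt_or_ge n i with h | h
            · obtain rfl : i = n + 1 := by omega
              rwa [psum_update_succ, ← add_assoc]
            · rw [psum_update_of_le ω h]; exact hω i h1 h
        · rw [Set.indicator_of_notMem hu, Set.indicator_of_notMem]
          intro h
          apply hu
          have := h (n + 1) (by omega) le_rfl
          rwa [psum_update_succ, ← add_assoc] at this
      · rw [Set.indicator_of_notMem hω]
        symm
        rw [lintegral_eq_zero_iff' ?_]
        · refine Eventually.of_forall fun u => ?_
          refine Set.indicator_of_notMem ?_ _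
          · intro h
            apply hω
            intro i h1 h2
            have := h i h1 (by omega)
            rwa [psum_update_of_le ω h2] at this
        · have h1 : Measurable (fun u => Function.update ω n u) := measurable_update ω
          exact (((hf.comp (measurable_const.add (measurable_psum (n + 1)))).indicator
            (measurableSet_stay hD x (n + 1))).comp h1).aemeasurable
    · exact (hf.comp (measurable_const.add (measurable_psum (n + 1)))).indicator
        (measurableSet_stay hD x (n + 1))

/-- A lower bound for the killed operator by the probability of an event of paths. -/
theorem le_killed_iterate (lam : Measure ℝ) [IsProbabilityMeasure lam] {D : Set ℝ} (hD : MeasurableSet D)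
    {f : ℝ → ℝ≥0∞} (hf : Measurable f) (n : ℕ) (x : ℝ) {E : Set (ℕ → ℝ)}
    {c : ℝ≥0∞} (hE : ∀ ω ∈ E, ω ∈ stay D x n ∧ c ≤ f (x + psum ω n)) :
    c * (Measure.infinitePi fun _ : ℕ => lam) E ≤ (killed lam D)^[n] f x := by
  rw [killed_iterate_eq_lintegral lam hD hf]
  -- `E` need not be measurable, so it is enlarged to a measurable event with the same two
  -- properties.
  have h1 : c * (Measure.infinitePi fun _ : ℕ => lam) E ≤
      c * (Measure.infinitePi fun _ : ℕ => lam)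
        (stay D x n ∩ {ω | c ≤ f (x + psum ω n)}) := by
    gcongr
    exact fun ω hω => ⟨(hE ω hω).1, (hE ω hω).2⟩
  refine h1.trans ?_
  have hm : MeasurableSet (stay D x n ∩ {ω | c ≤ f (x + psum ω n)}) :=
    (measurableSet_stay hD x n).inter
      (measurableSet_le measurable_const (hf.comp (measurable_const.add (measurable_psum n))))
  rw [← lintegral_indicator_const hm]
  refine lintegral_mono fun ω => ?_
  by_cases h : ω ∈ stay D x n ∩ {ω | c ≤ f (x + psum ω n)}
  · rw [Set.indicator_of_mem h, Set.indicator_of_mem h.1]; exact h.2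
  · rw [Set.indicator_of_notMem h]; exact zero_le

/-! ### Cyclic rearrangements -/

/-- The cyclic rotation by `r` of the first `n` coordinates. -/
def rotatePerm (n r : ℕ) (hr : r < n) : Equiv.Perm ℕ where
  toFun i := if i < n then (if i + r < n then i + r else i + r - n) else i
  invFun i := if i < n then (if i < r then i + n - r else i - r) else i
  left_inv i := by
    dsimp only
    split_ifs <;> omega
  right_inv i := by
    dsimp only
    split_ifs <;> omega

/-- The reversal of the first `n` coordinates. -/
def reversePerm (n : ℕ) : Equiv.Perm ℕ where
  toFun i := if i < n then n - 1 - i else i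
  invFun i := if i < n then n - 1 - i else i
  left_inv i := by
    dsimp only
    split_ifs <;> omega
  right_inv i := by
    dsimp only
    split_ifs <;> omega

theorem psum_rotatePerm (ω : ℕ → ℝ) {n r : ℕ} (hr : r < n) {j : ℕ} (hj : j ≤ n) :
    psum (fun i => ω (rotatePerm n r hr i)) j =
      if r + j ≤ n then psum ω (r + j) - psum ω r
      else psum ω n - psum ω r + psum ω (r + j - n) := by
  induction j with
  | zero => simp [hr.le]
  | succ j ih =>
    rw [psum_succ, ih (by omega)]
    have hj' : j < n := by omega
    rcases lt_trichotomy (r + j + 1) (n + 1) with h | h | h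
    · rw [if_pos (by omega), if_pos (by omega), ← add_assoc, psum_succ]
      simp only [rotatePerm, Equiv.coe_fn_mk, hj', if_true]
      rw [if_pos (by omega), add_comm j r]
      ring
    · rw [if_pos (by omega), if_neg (by omega)]
      simp only [rotatePerm, Equiv.coe_fn_mk, hj', if_true]
      rw [if_neg (by omega)]
      have h1 : j + r - n = 0 := by omega
      have h2 : r + (j + 1) - n = 1 := by omega
      have h3 : r + j = n := by omega
      rw [h1, h2, h3, psum_succ, psum_zero]
      ring
    · rw [if_neg (by omega), if_neg (by omega)]
      simp only [rotatePerm, Equiv.coe_fn_mk, hj', if_true]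
      rw [if_neg (by omega)]
      have h2 : r + (j + 1) - n = (r + j - n) + 1 := by omega
      have h1 : j + r - n = r + j - n := by omega
      rw [h1, h2, psum_succ]
      ring

theorem psum_reversePerm (ω : ℕ → ℝ) {n j : ℕ} (hj : j ≤ n) :
    psum (fun i => ω (reversePerm n i)) j = psum ω n - psum ω (n - j) := by
  induction j with
  | zero => simp
  | succ j ih =>
    rw [psum_succ, ih (by omega)]
    have hj' : j < n := by omega
    simp only [reversePerm, Equiv.coe_fn_mk, hj', if_true]
    have : n - j = (n - 1 - j) + 1 := by omega
    rw [this, psum_succ]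
    have : n - (j + 1) = n - 1 - j := by omega
    rw [this]
    ring

/-- Choosing the last minimizer makes the later inequalities strict, which becomes strict positivity
after rotation. -/
theorem exists_last_argmin (s : ℕ → ℝ) {n : ℕ} (hn : 0 < n) :
    ∃ r < n, (∀ i < n, s r ≤ s i) ∧ ∀ i < n, r < i → s r < s i := by
  induction n with
  | zero => omega
  | succ n ih =>
    rcases Nat.eq_zero_or_pos n with rfl | hn'
    · exact ⟨0, by omega, fun i hi => by rw [show i = 0 by omega], fun i hi h => by omega⟩
    · obtain ⟨r, hr, h1, h2⟩ := ih hn'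
      by_cases h : s n ≤ s r
      · refine ⟨n, by omega, fun i hi => ?_, fun i hi h => by omega⟩
        rcases Nat.lt_succ_iff_lt_or_eq.1 hi with h' | rfl
        · exact h.trans (h1 i h')
        · exact le_rfl
      · refine ⟨r, by omega, fun i hi => ?_, fun i hi hri => ?_⟩
        · rcases Nat.lt_succ_iff_lt_or_eq.1 hi with h' | rfl
          · exact h1 i h'
          · exact (not_le.1 h).le
        · rcases Nat.lt_succ_iff_lt_or_eq.1 hi with h' | rfl
          · exact h2 i h' hri
          · exact not_le.1 h

theorem psum_const_mul (σ : ℝ) (ω : ℕ → ℝ) (n : ℕ) :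
    psum (fun i => σ * ω i) n = σ * psum ω n := by
  simp [psum, Finset.mul_sum]

/-- The cycle lemma: some rotation of a path with positive sum stays positive. -/
theorem exists_rotate_pos (ω : ℕ → ℝ) {n : ℕ} (hn : 0 < n) (h : 0 < psum ω n) :
    ∃ (r : ℕ) (hr : r < n), ∀ j, 1 ≤ j → j ≤ n →
      0 < psum (fun i => ω (rotatePerm n r hr i)) j := by
  -- Let the path start at its last minimum: before the wrap-around the later values are strictly
  -- larger, and after it the positive total has been added.
  obtain ⟨r, hr, h1, h2⟩ := exists_last_argmin (psum ω) hn
  refine ⟨r, hr, fun j hj hjn => ?_⟩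
  rw [psum_rotatePerm ω hr hjn]
  have h0 := h1 0 hn
  rw [psum_zero] at h0
  split_ifs with hc
  · rcases hc.lt_or_eq with hlt | heq
    · linarith [h2 (r + j) hlt (by omega)]
    · rw [heq]; linarith
  · linarith [h1 (r + j - n) (by omega)]

/-- Among the paths whose sum lies in a set of positive values, a proportion at least `1 / n`
stays positive. -/
theorem measure_psum_pos_ge (lam : Measure ℝ) [IsProbabilityMeasure lam] (σ : ℝ) {n : ℕ}
    (hn : 0 < n) {I : Set ℝ} (hI : MeasurableSet I) (hIpos : ∀ y ∈ I, 0 < σ * y) :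
    (Measure.infinitePi fun _ : ℕ => lam) {ω | psum ω n ∈ I} ≤
      n * (Measure.infinitePi fun _ : ℕ => lam)
        {ω | (∀ j, 1 ≤ j → j ≤ n → 0 < σ * psum ω j) ∧ psum ω n ∈ I} := by
  set G := {ω : ℕ → ℝ | (∀ j, 1 ≤ j → j ≤ n → 0 < σ * psum ω j) ∧ psum ω n ∈ I} with hG
  have hGm : MeasurableSet G := by
    refine MeasurableSet.inter ?_ (measurable_psum n hI)
    refine measurableSet_forall_psum (p := fun i y => 1 ≤ i → i ≤ n → 0 < σ * y) fun i => ?_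
    exact measurableSet_imp _ (measurableSet_imp _ (measurableSet_lt (f := fun _ : ℝ => (0 : ℝ))
      (g := fun y : ℝ => σ * y) measurable_const (by fun_prop)))
  -- One of the `n` rotations is good and each has the law of the original path, so the union bound
  -- loses only the factor `n`.
  have hsub : {ω : ℕ → ℝ | psum ω n ∈ I} ⊆
      ⋃ r : Fin n, (fun ω : ℕ → ℝ => fun i => ω (rotatePerm n r r.2 i)) ⁻¹' G := by
    intro ω hω
    have h0 : 0 < psum (fun i => σ * ω i) n := by rw [psum_const_mul]; exact hIpos _ hω
    obtain ⟨r, hr, h⟩ := exists_rotate_pos (fun i => σ * ω i) hn h0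
    refine Set.mem_iUnion.2 ⟨⟨r, hr⟩, fun j hj hjn => ?_, ?_⟩
    · have := h j hj hjn
      rwa [psum_const_mul σ (fun i => ω (rotatePerm n r hr i))] at this
    · rw [psum_rotatePerm ω hr le_rfl]
      have : (if r + n ≤ n then psum ω (r + n) - psum ω r
          else psum ω n - psum ω r + psum ω (r + n - n)) = psum ω n := by
        split_ifs with hc
        · obtain rfl : r = 0 := by omega
          simp
        · rw [Nat.add_sub_cancel]; ring
      rw [this]
      exact hω
  refine (measure_mono hsub).trans ((measure_iUnion_le _).trans ?_)
  rw [tsum_fintype]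
  have : ∀ r : Fin n, (Measure.infinitePi fun _ : ℕ => lam)
      ((fun ω : ℕ → ℝ => fun i => ω (rotatePerm n r r.2 i)) ⁻¹' G)
      = (Measure.infinitePi fun _ : ℕ => lam) G := fun r =>
    (measurePreserving_perm_infinitePi lam _).measure_preimage hGm.nullMeasurableSet
  simp [this]

/-- The reversed version of `measure_psum_pos_ge`: the walk attains its strict record at time
`n`. -/
theorem measure_psum_record_ge (lam : Measure ℝ) [IsProbabilityMeasure lam] (σ : ℝ) {n : ℕ}
    (hn : 0 < n) {I : Set ℝ} (hI : MeasurableSet I) (hIpos : ∀ y ∈ I, 0 < σ * y) :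
    (Measure.infinitePi fun _ : ℕ => lam) {ω | psum ω n ∈ I} ≤
      n * (Measure.infinitePi fun _ : ℕ => lam)
        {ω | (∀ j < n, σ * psum ω j < σ * psum ω n) ∧ psum ω n ∈ I} := by
  refine (measure_psum_pos_ge lam σ hn hI hIpos).trans (mul_le_mul' le_rfl ?_)
  -- Time reversal turns sums from the start into sums up to the end, so positivity along the path
  -- becomes a strict record at time `n`.
  have hmp := measurePreserving_perm_infinitePi lam (reversePerm n)
  have hm : MeasurableSet {ω : ℕ → ℝ | (∀ j < n, σ * psum ω j < σ * psum ω n) ∧ psum ω n ∈ I} := by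
    refine MeasurableSet.inter (s₁ := {ω : ℕ → ℝ | ∀ j < n, σ * psum ω j < σ * psum ω n}) ?_
      (measurable_psum n hI)
    rw [Set.ofPred_forall]
    exact MeasurableSet.iInter fun i => measurableSet_imp _ (measurableSet_lt
      (f := fun ω : ℕ → ℝ => σ * psum ω i) (g := fun ω => σ * psum ω n)
      (by fun_prop) (by fun_prop))
  refine le_of_le_of_eq (measure_mono fun ω hω => ?_) (hmp.measure_preimage hm.nullMeasurableSet)
  simp only [Set.mem_preimage, Set.mem_ofPred_eq] at hω ⊢
  rw [psum_reversePerm ω le_rfl]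
  simp only [Nat.sub_self, psum_zero, sub_zero]
  refine ⟨fun j hj => ?_, hω.2⟩
  rw [psum_reversePerm ω hj.le]
  have := hω.1 (n - j) (by omega) (by omega)
  linarith

/-! ### Quantitative bounds for centered random walks -/

/-- The law of an i.i.d. sequence with common law `lam`. -/
noncomputable abbrev iidLaw (lam : Measure ℝ) : Measure (ℕ → ℝ) :=
  Measure.infinitePi fun _ : ℕ => lam

theorem killed_univ_iterate (lam : Measure ℝ) [IsProbabilityMeasure lam]
    {f : ℝ → ℝ≥0∞} (hf : Measurable f) (n : ℕ) (x : ℝ) :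
    (killed lam Set.univ)^[n] f x = ∫⁻ ω, f (x + psum ω n) ∂(iidLaw lam) := by
  rw [killed_iterate_eq_lintegral lam MeasurableSet.univ hf]
  have : stay Set.univ x n = Set.univ := by
    ext ω; simp [stay]
  simp [this]

/-- Killing only decreases the integral, and without killing each step multiplies the exponential by
the Laplace transform. -/
theorem killed_iterate_exp_le (lam : Measure ℝ) [IsProbabilityMeasure lam] {D : Set ℝ}
    (hD : MeasurableSet D) (s : ℝ) (n : ℕ) (x : ℝ) :
    (killed lam D)^[n] (fun y => ENNReal.ofReal (Real.exp (s * y))) x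
      ≤ (∫⁻ u, ENNReal.ofReal (Real.exp (s * u)) ∂lam) ^ n * ENNReal.ofReal (Real.exp (s * x)) := by
  have hm : Measurable fun y : ℝ => ENNReal.ofReal (Real.exp (s * y)) := by fun_prop
  induction n generalizing x with
  | zero => simp
  | succ n ih =>
    rw [Function.iterate_succ_apply]
    have h1 : ∀ y, killed lam D (fun y => ENNReal.ofReal (Real.exp (s * y))) y
        ≤ (∫⁻ u, ENNReal.ofReal (Real.exp (s * u)) ∂lam) * ENNReal.ofReal (Real.exp (s * y)) := by
      intro y
      rw [← lintegral_mul_const _ hm, killed]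
      refine lintegral_mono fun u => (Set.indicator_le_self _ _ _).trans ?_
      rw [← ENNReal.ofReal_mul (Real.exp_nonneg _), ← Real.exp_add]
      refine le_of_eq ?_
      congr 2
      ring
    refine (killed_iterate_mono lam D n h1 x).trans ?_
    rw [killed_iterate_const_mul lam hD _ hm]
    refine (mul_le_mul' le_rfl (ih x)).trans (le_of_eq ?_)
    ring

/-- Markov property at time `k₁`: a first stage that misses the target by at most `r` leaves a
displacement of size at most `r` to the second stage. -/
theorem measure_psum_add_ge (lam : Measure ℝ) [IsProbabilityMeasure lam] {k₁ k₂ : ℕ} {y r M : ℝ}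
    {a b : ℝ≥0∞} (h₁ : a ≤ iidLaw lam {ω | |psum ω k₁ - y| ≤ r})
    (h₂ : ∀ y', |y'| ≤ r → b ≤ iidLaw lam {ω | |psum ω k₂ - y'| ≤ M}) :
    b * a ≤ iidLaw lam {ω | |psum ω (k₁ + k₂) - y| ≤ M} := by
  have hI : MeasurableSet {z : ℝ | |z - y| ≤ M} :=
    measurableSet_le (by fun_prop) measurable_const
  have hf : Measurable ({z : ℝ | |z - y| ≤ M}.indicator (1 : ℝ → ℝ≥0∞)) :=
    measurable_one.indicator hI
  have key : ∀ n x, (killed lam Set.univ)^[n] ({z : ℝ | |z - y| ≤ M}.indicator (1 : ℝ → ℝ≥0∞)) x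
      = iidLaw lam {ω | |x + psum ω n - y| ≤ M} := by
    intro n x
    rw [killed_univ_iterate lam hf]
    have : (fun ω => {z : ℝ | |z - y| ≤ M}.indicator (1 : ℝ → ℝ≥0∞) (x + psum ω n))
        = ({ω : ℕ → ℝ | |x + psum ω n - y| ≤ M}).indicator 1 := by
      ext ω
      simp [Set.indicator_apply]
    rw [this, lintegral_indicator_one]
    exact measurableSet_le (by fun_prop) measurable_const
  have h := key (k₁ + k₂) 0
  simp only [zero_add] at h
  rw [← h, Function.iterate_add_apply]
  refine (mul_le_mul' le_rfl h₁).trans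
    (le_killed_iterate lam MeasurableSet.univ (measurable_killed_iterate lam MeasurableSet.univ hf k₂)
      k₁ 0 fun ω hω => ⟨fun i _ _ => trivial, ?_⟩)
  rw [key]
  have h3 := h₂ (y - psum ω k₁) (by rw [abs_sub_comm]; exact hω)
  refine h3.trans (measure_mono fun ω' hω' => ?_)
  have : |psum ω' k₂ - (y - psum ω k₁)| ≤ M := hω'
  change |0 + psum ω k₁ + psum ω' k₂ - y| ≤ M
  convert this using 2
  ring

theorem gaussianReal_Ioo_pos {v : NNReal} (hv : v ≠ 0) {a b : ℝ} (hab : a < b) :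
    0 < gaussianReal 0 v (Set.Ioo a b) := by
  rw [pos_iff_ne_zero]
  intro h
  have := gaussianReal_absolutelyContinuous' 0 hv h
  rw [Real.volume_Ioo] at this
  simp only [ENNReal.ofReal_eq_zero] at this
  linarith

theorem tendsto_walk_gaussian (lam : Measure ℝ) [IsProbabilityMeasure lam]
    (hL2 : MemLp id 2 lam) (h0 : ∫ x, x ∂lam = 0) {Ω : Type} [MeasurableSpace Ω] {P' : Measure Ω}
    [IsProbabilityMeasure P'] {Y : Ω → ℝ}
    (hY : HasLaw Y (gaussianReal 0 Var[id; lam].toNNReal) P') :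
    TendstoInDistribution (fun (n : ℕ) (ω : ℕ → ℝ) => (√n)⁻¹ * psum ω n) atTop Y
      (fun _ => iidLaw lam) P' := by
  have hlaw : ∀ i : ℕ, (iidLaw lam).map (fun ω : ℕ → ℝ => ω i) = lam := fun i =>
    Measure.infinitePi_map_eval _ i
  have hmp : ∀ i : ℕ, MeasurePreserving (fun ω : ℕ → ℝ => ω i) (iidLaw lam) lam := fun i =>
    ⟨by fun_prop, hlaw i⟩
  have hme : ∀ i : ℕ, AEMeasurable (fun ω : ℕ → ℝ => ω i) (iidLaw lam) := fun i =>
    (measurable_pi_apply i).aemeasurable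
  have hvar : Var[fun ω : ℕ → ℝ => ω 0; iidLaw lam] = Var[id; lam] := by
    conv_rhs => rw [← hlaw 0]
    rw [variance_map (by fun_prop) (hme 0)]
    rfl
  have hmean : (iidLaw lam)[fun ω : ℕ → ℝ => ω 0] = 0 := by
    rw [← h0]
    conv_rhs => rw [← hlaw 0]
    rw [integral_map (hme 0) (by fun_prop)]
  have h := tendstoInDistribution_inv_sqrt_mul_sum_sub (P := iidLaw lam) (P' := P') (Y := Y)
    (X := fun i (ω : ℕ → ℝ) => ω i) (by rw [hvar]; exact hY)
    (hL2.comp_measurePreserving (hmp 0))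
    (iIndepFun_infinitePi (X := fun _ (x : ℝ) => x) (fun _ => measurable_id))
    (fun i => ⟨hme i, hme 0, by rw [hlaw, hlaw]⟩)
  rw [hmean] at h
  simpa [psum] using h

/-- The central limit theorem concerns fixed intervals, whereas the target `y` varies with `h`. On
the scale `√h` finitely many cells cover all targets, and the Gaussian law charges each of them. -/
theorem exists_clt_stage (lam : Measure ℝ) [IsProbabilityMeasure lam]
    (hL2 : MemLp id 2 lam) (h0 : ∫ x, x ∂lam = 0) (hv : 0 < Var[id; lam]) :
    ∃ c : ℝ, 0 < c ∧ ∃ h₀ : ℕ, ∀ h ≥ h₀, ∀ y : ℝ, |y| ≤ 2 * √h →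
      ENNReal.ofReal c ≤ iidLaw lam {ω | |psum ω h - y| ≤ √h / 2} := by
  set v : NNReal := Var[id; lam].toNNReal with hvdef
  have hv0 : v ≠ 0 := by rw [hvdef]; simpa using hv
  have hclt := tendsto_walk_gaussian lam hL2 h0 (P' := gaussianReal 0 v) (Y := id)
    ⟨by fun_prop, by simp [hvdef]⟩
  have key : ∀ i : ℤ, ∃ c : ℝ, 0 < c ∧ ∀ᶠ n : ℕ in atTop, ENNReal.ofReal c ≤
      iidLaw lam {ω | (√n)⁻¹ * psum ω n ∈ Set.Ioo ((i : ℝ) / 4) ((i + 1 : ℝ) / 4)} := by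
    intro i
    have h1 := ProbabilityMeasure.le_liminf_measure_open_of_tendsto hclt.tendsto
      (isOpen_Ioo (a := (i : ℝ) / 4) (b := (i + 1 : ℝ) / 4))
    simp only [ProbabilityMeasure.coe_mk, Measure.map_id] at h1
    have hpos := gaussianReal_Ioo_pos hv0 (show (i : ℝ) / 4 < (i + 1 : ℝ) / 4 by linarith)
    obtain ⟨c, hc0, hc⟩ := exists_between (hpos.trans_le h1)
    have hctop : c ≠ ∞ := by
      intro h
      rw [h] at hc
      exact not_top_lt hc
    refine ⟨c.toReal, ENNReal.toReal_pos hc0.ne' hctop, ?_⟩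
    filter_upwards [eventually_lt_of_lt_liminf hc] with n hn
    rw [ENNReal.ofReal_toReal hctop]
    refine hn.le.trans (le_of_eq ?_)
    rw [Measure.map_apply (by fun_prop) measurableSet_Ioo]
    rfl
  choose c hc hev using key
  have hall : ∀ᶠ n : ℕ in atTop, ∀ i ∈ Finset.Icc (-8 : ℤ) 8, ENNReal.ofReal (c i) ≤
      iidLaw lam {ω | (√n)⁻¹ * psum ω n ∈ Set.Ioo ((i : ℝ) / 4) ((i + 1 : ℝ) / 4)} :=
    (Finset.eventually_all _).2 fun i _ => hev i
  obtain ⟨h₀, hh₀⟩ := eventually_atTop.1 (hall.and (eventually_gt_atTop 0))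
  have hne : (Finset.Icc (-8 : ℤ) 8).Nonempty := ⟨0, by simp⟩
  refine ⟨(Finset.Icc (-8 : ℤ) 8).inf' hne c, ?_, h₀, fun h hh y hy => ?_⟩
  · rw [Finset.lt_inf'_iff]; exact fun i _ => hc i
  obtain ⟨h1, hpos⟩ := hh₀ h hh
  have hs : 0 < √(h : ℝ) := Real.sqrt_pos.2 (by exact_mod_cast hpos)
  -- Cells have width `√h / 4`, so lying in the cell of `y` is enough; `|y| ≤ 2 * √h` puts the index
  -- in `[-8, 8]`.
  set i : ℤ := ⌊4 * y / √h⌋ with hi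
  have hfl := Int.floor_le (4 * y / √h)
  have hfl2 := Int.lt_floor_add_one (4 * y / √h)
  rw [← hi] at hfl hfl2
  rw [le_div_iff₀ hs] at hfl
  rw [div_lt_iff₀ hs] at hfl2
  rw [abs_le] at hy
  have him : i ∈ Finset.Icc (-8 : ℤ) 8 := by
    rw [Finset.mem_Icc]
    constructor
    · rw [hi, Int.le_floor, le_div_iff₀ hs]; push_cast; linarith
    · rw [hi, Int.floor_le_iff, div_lt_iff₀ hs]; push_cast; linarith
  refine (ENNReal.ofReal_le_ofReal (Finset.inf'_le _ him)).trans ((h1 i him).trans ?_)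
  refine measure_mono fun ω hω => ?_
  obtain ⟨ha, hb⟩ := hω
  rw [inv_mul_eq_div, lt_div_iff₀ hs] at ha
  rw [inv_mul_eq_div, div_lt_iff₀ hs] at hb
  change |psum ω h - y| ≤ √h / 2
  rw [abs_le]
  constructor <;> nlinarith

theorem exists_measure_psum_abs_le (lam : Measure ℝ) [IsProbabilityMeasure lam] (n : ℕ) :
    ∃ M : ℝ, ENNReal.ofReal (1 / 2) ≤ iidLaw lam {ω | |psum ω n| ≤ M} := by
  have hmono : Monotone fun m : ℕ => {ω : ℕ → ℝ | |psum ω n| ≤ m} := by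
    intro a b hab ω hω
    exact le_trans (show |psum ω n| ≤ a from hω) (by exact_mod_cast hab)
  have h := tendsto_measure_iUnion_atTop (μ := iidLaw lam) hmono
  have hU : ⋃ m : ℕ, {ω : ℕ → ℝ | |psum ω n| ≤ m} = Set.univ := by
    ext ω
    simp only [Set.mem_iUnion, Set.mem_univ, iff_true]
    exact exists_nat_ge |psum ω n|
  rw [hU, measure_univ] at h
  have h2 : ∀ᶠ m : ℕ in atTop, ENNReal.ofReal (1 / 2) < iidLaw lam {ω : ℕ → ℝ | |psum ω n| ≤ m} :=
    h.eventually_const_lt (by rw [ENNReal.ofReal_lt_one]; norm_num)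
  obtain ⟨m, hm⟩ := h2.exists
  exact ⟨m, hm.le⟩

/-- A polynomial lower bound for the local probabilities of a centered random walk. -/
theorem exists_local_lower_bound (lam : Measure ℝ) [IsProbabilityMeasure lam]
    (hL2 : MemLp id 2 lam) (h0 : ∫ x, x ∂lam = 0) (hv : 0 < Var[id; lam]) :
    ∃ (M : ℝ) (q : ℕ), 0 < M ∧ ∀ n : ℕ, 1 ≤ n → ∀ y : ℝ, |y| ≤ √n →
      ENNReal.ofReal (1 / 2 * (1 / n) ^ q) ≤ iidLaw lam {ω | |psum ω n - y| ≤ M} := by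
  obtain ⟨c, hc, h₀, hstage⟩ := exists_clt_stage lam hL2 h0 hv
  -- Each halving of the time costs the factor `c > (1 / 2) ^ q`, so `log₂ n` halvings cost at most
  -- `n ^ q`.
  obtain ⟨q, hq⟩ := exists_pow_lt_of_lt_one hc (show (1 / 2 : ℝ) < 1 by norm_num)
  choose M₀ hM₀ using exists_measure_psum_abs_le lam
  set n₀ := 2 * h₀ + 2 with hn₀
  set M : ℝ := ∑ i ∈ Finset.range n₀, |M₀ i| + n₀ with hM
  have hMpos : 0 < M := by
    have : (0 : ℝ) ≤ ∑ i ∈ Finset.range n₀, |M₀ i| := Finset.sum_nonneg fun i _ => abs_nonneg _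
    have : (0 : ℝ) < n₀ := by rw [hn₀]; positivity
    linarith
  have key : ∀ n : ℕ, 1 ≤ n → ∀ y : ℝ, |y| ≤ √n →
      ENNReal.ofReal (1 / 2 * ((1 / 2) ^ q) ^ (Nat.log 2 n)) ≤
        iidLaw lam {ω | |psum ω n - y| ≤ M} := by
    intro n
    induction n using Nat.strong_induction_on with
    | _ n ih =>
      intro hn y hy
      rcases Nat.lt_or_ge n n₀ with hlt | hge
      · have h1 : ENNReal.ofReal (1 / 2 * ((1 / 2) ^ q) ^ (Nat.log 2 n)) ≤
            ENNReal.ofReal (1 / 2) := by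
          refine ENNReal.ofReal_le_ofReal ?_
          have : ((1 / 2 : ℝ) ^ q) ^ (Nat.log 2 n) ≤ 1 :=
            pow_le_one₀ (by positivity) (pow_le_one₀ (by norm_num) (by norm_num))
          linarith
        refine h1.trans ((hM₀ n).trans (measure_mono fun ω hω => ?_))
        have h2 : |psum ω n| ≤ M₀ n := hω
        have h3 : |M₀ n| ≤ ∑ i ∈ Finset.range n₀, |M₀ i| :=
          Finset.single_le_sum (f := fun i => |M₀ i|) (fun i _ => abs_nonneg _)
            (Finset.mem_range.2 hlt)
        have h4 : √(n : ℝ) ≤ n₀ := by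
          rw [Real.sqrt_le_left (by positivity)]
          have a1 : (n : ℝ) ≤ n₀ := by exact_mod_cast hlt.le
          have a2 : (1 : ℝ) ≤ n₀ := by exact_mod_cast (show 1 ≤ n₀ by omega)
          nlinarith
        change |psum ω n - y| ≤ M
        calc |psum ω n - y| ≤ |psum ω n| + |y| := abs_sub _ _
          _ ≤ M := by linarith [le_abs_self (M₀ n)]
      -- The first half of the time brings the walk within `√k₁ / 2 ≤ √k₂` of the target, so the
      -- induction hypothesis covers the remaining displacement.
      · set k₁ := (n + 1) / 2 with hk₁
        set k₂ := n / 2 with hk₂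
        have hsum : k₁ + k₂ = n := by omega
        have hlog : Nat.log 2 n = Nat.log 2 k₂ + 1 := by
          rw [hk₂, Nat.log_div_base]
          have : 0 < Nat.log 2 n := Nat.log_pos (by norm_num) (by omega)
          omega
        have hk14 : (k₁ : ℝ) ≤ 4 * k₂ := by exact_mod_cast (show k₁ ≤ 4 * k₂ by omega)
        have hnk : (n : ℝ) ≤ 4 * k₁ := by exact_mod_cast (show n ≤ 4 * k₁ by omega)
        have e4 : ∀ x : ℝ, √(4 * x) = 2 * √x := by
          intro x
          rw [Real.sqrt_mul (by norm_num), show (4 : ℝ) = 2 ^ 2 by norm_num,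
            Real.sqrt_sq (by norm_num)]
        have s1 : √(n : ℝ) ≤ 2 * √k₁ := by rw [← e4]; exact Real.sqrt_le_sqrt hnk
        have s2 : √(k₁ : ℝ) / 2 ≤ √k₂ := by
          have := Real.sqrt_le_sqrt hk14
          rw [e4] at this
          linarith
        have A := hstage k₁ (by omega) y (hy.trans s1)
        have B := fun y' (hy' : |y'| ≤ √(k₁ : ℝ) / 2) =>
          ih k₂ (by omega) (by omega) y' (hy'.trans s2)
        have := measure_psum_add_ge lam A B
        rw [hsum] at this
        refine le_trans ?_ this
        rw [← ENNReal.ofReal_mul (by positivity), hlog, pow_succ]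
        refine ENNReal.ofReal_le_ofReal ?_
        rw [← mul_assoc]
        exact mul_le_mul_of_nonneg_left hq.le (by positivity)
  refine ⟨M, q, hMpos, fun n hn y hy => le_trans ?_ (key n hn y hy)⟩
  refine ENNReal.ofReal_le_ofReal (mul_le_mul_of_nonneg_left ?_ (by norm_num))
  rw [← pow_mul, mul_comm q, pow_mul]
  refine pow_le_pow_left₀ (by positivity) ?_ q
  rw [one_div_pow]
  refine one_div_le_one_div_of_le (by positivity) ?_
  exact_mod_cast Nat.pow_log_le_self 2 (by omega)

/-- Chernoff bound for the maximal displacement. -/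
theorem measure_exists_psum_gt_le (lam : Measure ℝ) [IsProbabilityMeasure lam] {s C R : ℝ}
    (hs : 0 ≤ s) (hC : 0 ≤ C)
    (h₁ : ∫⁻ u, ENNReal.ofReal (Real.exp (s * u)) ∂lam ≤ ENNReal.ofReal (Real.exp (C * s ^ 2)))
    (h₂ : ∫⁻ u, ENNReal.ofReal (Real.exp (-s * u)) ∂lam ≤ ENNReal.ofReal (Real.exp (C * s ^ 2)))
    (n : ℕ) :
    iidLaw lam {ω | ∃ i ≤ n, R < |psum ω i|} ≤
      ENNReal.ofReal (2 * (n + 1) * Real.exp (-s * R + C * s ^ 2 * n)) := by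
  -- Exponential Markov inequality at a single time. A union bound over the `n + 1` times and both
  -- signs then suffices, as polynomial factors are harmless later.
  have one : ∀ t : ℝ, |t| = s → ∫⁻ u, ENNReal.ofReal (Real.exp (t * u)) ∂lam ≤
      ENNReal.ofReal (Real.exp (C * s ^ 2)) → ∀ i ≤ n,
      iidLaw lam {ω | s * R < t * psum ω i} ≤
        ENNReal.ofReal (Real.exp (-s * R + C * s ^ 2 * n)) := by
    intro t ht hb i hi
    have hm : Measurable fun y : ℝ => ENNReal.ofReal (Real.exp (t * y)) := by fun_prop
    have h := killed_iterate_exp_le lam MeasurableSet.univ t i 0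
    rw [killed_univ_iterate lam hm] at h
    simp only [zero_add, mul_zero, Real.exp_zero, ENNReal.ofReal_one, mul_one] at h
    have h3 : ENNReal.ofReal (Real.exp (s * R)) * iidLaw lam {ω | s * R < t * psum ω i} ≤
        ENNReal.ofReal (Real.exp (C * s ^ 2)) ^ i := by
      refine le_trans ?_ (h.trans (pow_le_pow_left' hb i))
      refine le_trans ?_ (mul_meas_ge_le_lintegral (μ := iidLaw lam)
        (hm.comp (measurable_psum i)) (ENNReal.ofReal (Real.exp (s * R))))
      refine mul_le_mul' le_rfl (measure_mono fun ω hω => ?_)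
      exact ENNReal.ofReal_le_ofReal (Real.exp_le_exp.2 (le_of_lt hω))
    have h4 : ENNReal.ofReal (Real.exp (C * s ^ 2)) ^ i ≤
        ENNReal.ofReal (Real.exp (C * s ^ 2 * n)) := by
      rw [← ENNReal.ofReal_pow (Real.exp_nonneg _), ← Real.exp_nat_mul]
      refine ENNReal.ofReal_le_ofReal (Real.exp_le_exp.2 ?_)
      have : (i : ℝ) ≤ n := by exact_mod_cast hi
      nlinarith [mul_nonneg hC (sq_nonneg s)]
    have h5 := h3.trans h4
    rw [Real.exp_add, ENNReal.ofReal_mul (Real.exp_nonneg _)]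
    calc iidLaw lam {ω | s * R < t * psum ω i}
        = ENNReal.ofReal (Real.exp (-s * R)) * (ENNReal.ofReal (Real.exp (s * R)) *
            iidLaw lam {ω | s * R < t * psum ω i}) := by
          rw [← mul_assoc, ← ENNReal.ofReal_mul (Real.exp_nonneg _), ← Real.exp_add]
          simp
      _ ≤ _ := mul_le_mul' le_rfl h5
  rcases hs.eq_or_lt with rfl | hspos
  · refine prob_le_one.trans ?_
    rw [← ENNReal.ofReal_one]
    refine ENNReal.ofReal_le_ofReal ?_
    simp
    have : (0 : ℝ) ≤ n := by positivity
    linarith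
  have hsub : {ω : ℕ → ℝ | ∃ i ≤ n, R < |psum ω i|} ⊆
      ⋃ i : Fin (n + 1), ({ω | s * R < s * psum ω i} ∪ {ω | s * R < -s * psum ω i}) := by
    rintro ω ⟨i, hi, h⟩
    refine Set.mem_iUnion.2 ⟨⟨i, by omega⟩, ?_⟩
    rcases lt_abs.1 h with h | h
    · exact Or.inl (mul_lt_mul_of_pos_left h hspos)
    · right
      change s * R < -s * psum ω i
      nlinarith
  refine (measure_mono hsub).trans ((measure_iUnion_le _).trans ?_)
  rw [tsum_fintype]
  have : ∀ i : Fin (n + 1), iidLaw lam ({ω | s * R < s * psum ω i} ∪ {ω | s * R < -s * psum ω i})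
      ≤ 2 * ENNReal.ofReal (Real.exp (-s * R + C * s ^ 2 * n)) := by
    intro i
    refine (measure_union_le _ _).trans ?_
    rw [two_mul]
    exact add_le_add (one s (abs_of_nonneg hs) h₁ i (by omega))
      (one (-s) (by rw [abs_neg, abs_of_nonneg hs]) h₂ i (by omega))
  refine (Finset.sum_le_sum fun i _ => this i).trans (le_of_eq ?_)
  rw [Finset.sum_const, Finset.card_univ, Fintype.card_fin, nsmul_eq_mul,
    ENNReal.ofReal_mul (by positivity), ENNReal.ofReal_mul (by norm_num)]
  rw [show ((n : ℝ) + 1) = ((n + 1 : ℕ) : ℝ) by push_cast; ring, ENNReal.ofReal_natCast]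
  simp only [ENNReal.ofReal_ofNat]
  ring

/-! ### Polynomial lower bounds for centered walks confined to an interval -/

/-- A centered law with nonzero variance and Gaussian-type exponential moments near zero. -/
structure CenteredLaw (lam : Measure ℝ) (C s₀ : ℝ) : Prop where
  memLp : MemLp id 2 lam
  mean : ∫ x, x ∂lam = 0
  var_pos : 0 < Var[id; lam]
  C_nonneg : 0 ≤ C
  s₀_pos : 0 < s₀
  exp_le : ∀ s, |s| ≤ s₀ →
    ∫⁻ u, ENNReal.ofReal (Real.exp (s * u)) ∂lam ≤ ENNReal.ofReal (Real.exp (C * s ^ 2))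

theorem eventually_mul_log_pow_le (B : ℝ) (m : ℕ) :
    ∀ᶠ z : ℕ in atTop, B * Real.log z ^ m ≤ z := by
  have h := (Real.isLittleO_pow_log_id_atTop (n := m)).comp_tendsto tendsto_natCast_atTop_atTop
  have h2 := h.bound (c := 1 / (|B| + 1)) (by positivity)
  filter_upwards [h2] with z hz
  simp only [Function.comp_apply, Real.norm_eq_abs, id, Nat.abs_cast] at hz
  calc B * Real.log z ^ m ≤ |B * Real.log z ^ m| := le_abs_self _
    _ = |B| * |Real.log z ^ m| := abs_mul _ _
    _ ≤ |B| * (1 / (|B| + 1) * z) := by gcongr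
    _ = (|B| / (|B| + 1)) * z := by ring
    _ ≤ 1 * z := by
        gcongr
        rw [div_le_one (by positivity)]
        linarith
    _ = z := one_mul _

theorem eventually_le_log (B : ℝ) : ∀ᶠ z : ℕ in atTop, B ≤ Real.log z :=
  (Real.tendsto_log_atTop.comp tendsto_natCast_atTop_atTop).eventually_ge_atTop B

theorem exp_neg_mul_log {z : ℕ} (hz : 0 < z) (m : ℕ) :
    Real.exp (-(m : ℝ) * Real.log z) = (1 / (z : ℝ)) ^ m := by
  have : (0 : ℝ) < z := by exact_mod_cast hz
  rw [show -(m : ℝ) * Real.log z = (m : ℝ) * Real.log (1 / z) by rw [one_div, Real.log_inv]; ring,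
    Real.exp_nat_mul, Real.exp_log (by positivity)]

/-- An event of polynomial probability essentially keeps it when the walk is moreover required to
stay within distance `z / 4` of its starting point, for `z ^ 2 / log z` steps. -/
theorem exists_confined_lower_bound (lam : Measure ℝ) [IsProbabilityMeasure lam] {C s₀ : ℝ}
    (hl : CenteredLaw lam C s₀) {c : ℝ} (hc : 0 < c) (q : ℕ) :
    ∃ K₀ : ℝ, 1 ≤ K₀ ∧ ∀ K ≥ K₀, ∀ᶠ z : ℕ in atTop, ∀ n : ℕ, 1 ≤ n →
      n * (K * Real.log z) ≤ 2 * (z : ℝ) ^ 2 → ∀ G : Set (ℕ → ℝ),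
      ENNReal.ofReal (c * (1 / n) ^ q) ≤ n * iidLaw lam G →
      ENNReal.ofReal ((1 / (z : ℝ)) ^ (2 * q + 3)) ≤
        iidLaw lam (G ∩ {ω | ∀ i ≤ n, |psum ω i| ≤ z / 4}) := by
  -- `L` is chosen for Chernoff's bound at `s = L * log z / z`: the linear term yields `(2 * q + 7)
  -- * log z`, and `n * K * log z ≤ 2 * z ^ 2` with `K` large keeps the quadratic term below `log
  -- z`. The resulting power of `1 / z` beats the lower bound for `G`.
  set L : ℝ := 4 * (2 * q + 7) with hL
  have hLpos : 0 < L := by positivity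
  refine ⟨2 * C * L ^ 2 + 2, by nlinarith [hl.C_nonneg, sq_nonneg L, mul_nonneg hl.C_nonneg (sq_nonneg L)], fun K hK => ?_⟩
  have hCL : 0 ≤ C * L ^ 2 := mul_nonneg hl.C_nonneg (sq_nonneg L)
  filter_upwards [eventually_le_log 1, eventually_mul_log_pow_le (L / s₀) 1,
    eventually_ge_atTop (⌈(5 : ℝ) / c⌉₊), eventually_ge_atTop 2] with z hlog hzs hzc hz2 n hn hnK G hG
  have hz0 : 0 < z := by omega
  have hzR : (2 : ℝ) ≤ z := by exact_mod_cast hz2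
  have hn1 : (1 : ℝ) ≤ n := by exact_mod_cast hn
  have hKpos : 2 ≤ K := by linarith
  have hnz : (n : ℝ) ≤ z ^ 2 := by
    have h1 : (n : ℝ) * 2 ≤ n * (K * Real.log z) := by
      gcongr
      nlinarith
    nlinarith
  set s : ℝ := L * Real.log z / z with hs
  have hs0 : 0 ≤ s := by rw [hs]; have : 0 ≤ Real.log z := by linarith
                         positivity
  have hss : s ≤ s₀ := by
    rw [hs, div_le_iff₀ (by positivity)]
    rw [pow_one, div_mul_eq_mul_div, div_le_iff₀ hl.s₀_pos] at hzs
    linarith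
  have hch := measure_exists_psum_gt_le lam (s := s) (C := C) (R := z / 4) hs0 hl.C_nonneg
    (hl.exp_le s (by rwa [abs_of_nonneg hs0])) (by
      have := hl.exp_le (-s) (by rwa [abs_neg, abs_of_nonneg hs0])
      rwa [neg_sq] at this) n
  have hexp : -s * (z / 4) + C * s ^ 2 * n ≤ -((2 * q + 6 : ℕ) : ℝ) * Real.log z := by
    have e1 : s * (z / 4) = (2 * q + 7) * Real.log z := by
      rw [hs, hL]; field_simp
    have e2 : C * s ^ 2 * n ≤ Real.log z := by
      have : C * s ^ 2 * n = C * L ^ 2 * Real.log z * (Real.log z * n) / z ^ 2 := by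
        rw [hs]; field_simp
      rw [this, div_le_iff₀ (by positivity)]
      have h3 : 2 * (C * L ^ 2) * (Real.log z * n) ≤ 2 * (z : ℝ) ^ 2 := by
        refine le_trans ?_ hnK
        rw [show (n : ℝ) * (K * Real.log z) = K * (Real.log z * n) by ring]
        gcongr
        linarith
      calc C * L ^ 2 * Real.log z * (Real.log z * n)
          = Real.log z * (C * L ^ 2 * (Real.log z * n)) := by ring
        _ ≤ Real.log z * z ^ 2 := by gcongr; linarith
    push_cast
    nlinarith
  have hbad : iidLaw lam {ω | ∃ i ≤ n, (z : ℝ) / 4 < |psum ω i|} ≤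
      ENNReal.ofReal (4 * (z : ℝ) ^ 2 * (1 / (z : ℝ)) ^ (2 * q + 6)) := by
    refine hch.trans (ENNReal.ofReal_le_ofReal ?_)
    rw [← exp_neg_mul_log hz0]
    have h2 : 2 * ((n : ℝ) + 1) ≤ 4 * (z : ℝ) ^ 2 := by nlinarith
    exact mul_le_mul h2 (Real.exp_le_exp.2 hexp) (Real.exp_pos _).le (by positivity)
  have hsplit : iidLaw lam G ≤ iidLaw lam (G ∩ {ω | ∀ i ≤ n, |psum ω i| ≤ z / 4}) +
      iidLaw lam {ω | ∃ i ≤ n, (z : ℝ) / 4 < |psum ω i|} := by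
    refine (measure_mono ?_).trans (measure_union_le _ _)
    intro ω hω
    by_cases h : ∀ i ≤ n, |psum ω i| ≤ z / 4
    · exact Or.inl ⟨hω, h⟩
    · right
      push Not at h
      exact h
  -- Since `n ≤ z ^ 2`, a polynomial bound in `n` is a polynomial bound in `z`.
  have hGlow : ENNReal.ofReal (c * (1 / (z : ℝ)) ^ (2 * q + 2)) ≤ iidLaw lam G := by
    have h1 : ENNReal.ofReal (c * (1 / (z : ℝ)) ^ (2 * q + 2)) ≤
        ENNReal.ofReal (1 / n) * ENNReal.ofReal (c * (1 / n) ^ q) := by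
      rw [← ENNReal.ofReal_mul (by positivity)]
      refine ENNReal.ofReal_le_ofReal ?_
      rw [show (1 : ℝ) / n * (c * (1 / n) ^ q) = c * (1 / n) ^ (q + 1) by ring,
        show 2 * q + 2 = 2 * (q + 1) by ring, pow_mul]
      gcongr
      rw [one_div_pow]
      gcongr
    refine h1.trans ((mul_le_mul' le_rfl hG).trans (le_of_eq ?_))
    rw [← mul_assoc, ← ENNReal.ofReal_natCast n, ← ENNReal.ofReal_mul (by positivity),
      one_div_mul_cancel (by positivity), ENNReal.ofReal_one, one_mul]
  have hfin : ENNReal.ofReal ((1 / (z : ℝ)) ^ (2 * q + 3)) +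
      ENNReal.ofReal (4 * (z : ℝ) ^ 2 * (1 / (z : ℝ)) ^ (2 * q + 6)) ≤
      ENNReal.ofReal (c * (1 / (z : ℝ)) ^ (2 * q + 2)) := by
    rw [← ENNReal.ofReal_add (by positivity) (by positivity)]
    refine ENNReal.ofReal_le_ofReal ?_
    have hc5 : 5 / c ≤ z := (Nat.le_ceil _).trans (by exact_mod_cast hzc)
    rw [div_le_iff₀ hc] at hc5
    have e : (1 / (z : ℝ)) ^ (2 * q + 3) + 4 * (z : ℝ) ^ 2 * (1 / (z : ℝ)) ^ (2 * q + 6) =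
        (1 / (z : ℝ)) ^ (2 * q + 2) * (1 / z + 4 / z ^ 2) := by
      rw [show 2 * q + 3 = (2 * q + 2) + 1 by ring, show 2 * q + 6 = (2 * q + 2) + 4 by ring,
        pow_add _ _ 1, pow_add _ _ 4]
      generalize (1 / (z : ℝ)) ^ (2 * q + 2) = P
      field_simp
    rw [e, mul_comm c]
    gcongr
    have : (4 : ℝ) / z ^ 2 ≤ 4 / z := by
      gcongr
      nlinarith
    calc 1 / (z : ℝ) + 4 / z ^ 2 ≤ 1 / z + 4 / z := by linarith
      _ = 5 / z := by ring
      _ ≤ c := by rw [div_le_iff₀ (by positivity)]; linarith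
  have htop : iidLaw lam {ω | ∃ i ≤ n, (z : ℝ) / 4 < |psum ω i|} ≠ ∞ := measure_ne_top _ _
  rw [← ENNReal.add_le_add_iff_right htop]
  refine le_trans ?_ (hGlow.trans hsplit)
  exact (add_le_add le_rfl hbad).trans hfin

/-- A centered law without mass on one side of `0` would be degenerate. -/
theorem CenteredLaw.measure_pos (lam : Measure ℝ) [IsProbabilityMeasure lam] {C s₀ : ℝ}
    (hl : CenteredLaw lam C s₀) {σ : ℝ} (hσ : σ ≠ 0) :
    ∃ b : ℝ, 0 < b ∧ 0 < lam {u | 0 < σ * u ∧ σ * u ≤ b} := by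
  by_contra! hcon
  have h1 : ∀ m : ℕ, lam {u | 0 < σ * u ∧ σ * u ≤ (m + 1 : ℝ)} = 0 := fun m =>
    le_antisymm (hcon _ (by positivity)) zero_le
  have h2 : ∀ᵐ u ∂lam, 0 ≤ -(σ * u) := by
    rw [ae_iff]
    refine measure_mono_null ?_ (measure_iUnion_null h1)
    intro u hu
    have hu' : 0 < σ * u := by
      have : ¬ (0 ≤ -(σ * u)) := hu
      linarith
    obtain ⟨m, hm⟩ := exists_nat_ge (σ * u)
    exact Set.mem_iUnion.2 ⟨m, hu', by linarith⟩
  have hint : Integrable (fun u : ℝ => -(σ * u)) lam :=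
    ((hl.memLp.integrable (by norm_num)).const_mul σ).neg
  have h3 : ∫ u, -(σ * u) ∂lam = 0 := by
    rw [integral_neg, integral_const_mul, hl.mean]; simp
  have h4 := (integral_eq_zero_iff_of_nonneg_ae h2 hint).1 h3
  have h5 : (id : ℝ → ℝ) =ᵐ[lam] fun _ => 0 := by
    filter_upwards [h4] with u hu
    have : -(σ * u) = 0 := hu
    have : σ * u = 0 := by linarith
    rcases mul_eq_zero.1 this with h | h
    · exact absurd h hσ
    · exact h
  have := hl.var_pos
  rw [variance_congr h5, variance_eq_integral (by fun_prop)] at this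
  simp at this

theorem measurableSet_mul_mem_Ioc (σ b : ℝ) : MeasurableSet {u : ℝ | 0 < σ * u ∧ σ * u ≤ b} :=
  measurableSet_Ioc.preimage (measurable_const_mul σ)

/-- The walk is just on one side of its starting point with polynomial probability. -/
theorem CenteredLaw.exists_psum_near (lam : Measure ℝ) [IsProbabilityMeasure lam] {C s₀ : ℝ}
    (hl : CenteredLaw lam C s₀) {σ : ℝ} (hσ : |σ| = 1) :
    ∃ (b c : ℝ) (q : ℕ), 0 < c ∧ ∀ n : ℕ, 1 ≤ n →
      ENNReal.ofReal (c * (1 / n) ^ q) ≤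
        iidLaw lam {ω | psum ω n ∈ {y | 0 < σ * y ∧ σ * y ≤ b}} := by
  obtain ⟨M, q, hM, hloc⟩ := exists_local_lower_bound lam hl.memLp hl.mean hl.var_pos
  have hσ0 : σ ≠ 0 := by rintro rfl; simp at hσ
  have hσ2 : σ * σ = 1 := by rw [← abs_mul_abs_self, hσ]; norm_num
  obtain ⟨b, hb, hp⟩ := hl.measure_pos lam hσ0
  set p := (lam {u | 0 < σ * u ∧ σ * u ≤ b}).toReal with hpdef
  have hp0 : 0 < p := ENNReal.toReal_pos hp.ne' (measure_ne_top _ _)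
  have hp1 : p ≤ 1 := by
    have := ENNReal.toReal_mono ENNReal.one_ne_top (prob_le_one (μ := lam) (s := {u | 0 < σ * u ∧ σ * u ≤ b}))
    simpa using this
  set n₁ : ℕ := ⌈9 * M ^ 2⌉₊ with hn₁
  refine ⟨3 * M + n₁ * b, min (1 / 2) (p ^ n₁), q, by positivity, fun n hn => ?_⟩
  have hn1 : (1 : ℝ) ≤ n := by exact_mod_cast hn
  have hpow : (1 / (n : ℝ)) ^ q ≤ 1 := pow_le_one₀ (by positivity) (by rw [div_le_one] <;> linarith)
  -- For small `n` the local estimate is not available, and all steps are taken on the prescribed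
  -- side. For `n ≥ 9 * M ^ 2` the target is `σ * (2 * M)`, which an error `M` cannot move across
  -- `0`.
  rcases Nat.lt_or_ge n n₁ with hlt | hge
  · have hpi := Measure.infinitePi_pi (fun _ : ℕ => lam) (s := Finset.range n)
      (t := fun _ => {u | 0 < σ * u ∧ σ * u ≤ b})
      (fun _ _ => measurableSet_mul_mem_Ioc σ b)
    rw [Finset.prod_const, Finset.card_range] at hpi
    have h1 : ENNReal.ofReal (min (1 / 2) (p ^ n₁) * (1 / n) ^ q) ≤ ENNReal.ofReal (p ^ n) := by
      refine ENNReal.ofReal_le_ofReal ?_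
      calc min (1 / 2) (p ^ n₁) * (1 / n) ^ q ≤ p ^ n₁ * 1 := by
            gcongr
            exact min_le_right _ _
        _ ≤ p ^ n := by rw [mul_one]; exact pow_le_pow_of_le_one hp0.le hp1 hlt.le
    refine h1.trans ?_
    rw [ENNReal.ofReal_pow hp0.le, hpdef, ENNReal.ofReal_toReal (measure_ne_top _ _), ← hpi]
    refine measure_mono fun ω hω => ?_
    have hω' : ∀ i < n, 0 < σ * ω i ∧ σ * ω i ≤ b := fun i hi => hω i (by simpa using hi)
    change 0 < σ * psum ω n ∧ σ * psum ω n ≤ 3 * M + n₁ * b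
    rw [psum, Finset.mul_sum]
    constructor
    · exact Finset.sum_pos (fun i hi => (hω' i (Finset.mem_range.1 hi)).1) ⟨0, Finset.mem_range.2 (by omega)⟩
    · calc ∑ i ∈ Finset.range n, σ * ω i ≤ ∑ i ∈ Finset.range n, b :=
            Finset.sum_le_sum fun i hi => (hω' i (Finset.mem_range.1 hi)).2
        _ = n * b := by simp
        _ ≤ n₁ * b := by gcongr
        _ ≤ 3 * M + n₁ * b := by linarith
  · have hM2 : |σ * (2 * M)| ≤ √n := by
      rw [abs_mul, hσ, one_mul, abs_of_pos (by positivity)]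
      refine Real.le_sqrt_of_sq_le ?_
      have : 9 * M ^ 2 ≤ n := (Nat.le_ceil _).trans (by exact_mod_cast hge)
      nlinarith
    refine le_trans ?_ ((hloc n hn _ hM2).trans (measure_mono fun ω hω => ?_))
    · refine ENNReal.ofReal_le_ofReal ?_
      gcongr
      exact min_le_left _ _
    · have h1 : |psum ω n - σ * (2 * M)| ≤ M := hω
      have h2 : |σ * psum ω n - 2 * M| ≤ M := by
        have : σ * psum ω n - 2 * M = σ * (psum ω n - σ * (2 * M)) := by
          linear_combination (2 * M) * hσ2
        rwa [this, abs_mul, hσ, one_mul]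
      rw [abs_le] at h2
      change 0 < σ * psum ω n ∧ σ * psum ω n ≤ 3 * M + n₁ * b
      have : 0 ≤ n₁ * b := by positivity
      constructor <;> linarith

/-- Polynomial lower bound for staying in `(0, A)` without ending much higher. -/
theorem CenteredLaw.exists_hold (lam : Measure ℝ) [IsProbabilityMeasure lam] {C s₀ : ℝ}
    (hl : CenteredLaw lam C s₀) :
    ∃ (b : ℝ) (Q : ℕ) (K₀ : ℝ), 0 ≤ b ∧ 1 ≤ K₀ ∧ ∀ K ≥ K₀, ∀ᶠ z : ℕ in atTop, ∀ A : ℝ, (z : ℝ) < A →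
      ∀ n : ℕ, 1 ≤ n → n * (K * Real.log z) ≤ 2 * (z : ℝ) ^ 2 → ∀ x : ℝ, 0 ≤ x → x < A →
      ENNReal.ofReal ((1 / (z : ℝ)) ^ Q) ≤
        (killed lam (Set.Ioo 0 A))^[n] ((Set.Iic (x + b)).indicator 1) x := by
  have one : ∀ σ : ℝ, |σ| = 1 → ∃ (b : ℝ) (Q : ℕ) (K₀ : ℝ), 1 ≤ K₀ ∧ ∀ K ≥ K₀, ∀ᶠ z : ℕ in atTop,
      ∀ n : ℕ, 1 ≤ n → n * (K * Real.log z) ≤ 2 * (z : ℝ) ^ 2 →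
      ENNReal.ofReal ((1 / (z : ℝ)) ^ Q) ≤
        iidLaw lam ({ω | (∀ j, 1 ≤ j → j ≤ n → 0 < σ * psum ω j) ∧
          psum ω n ∈ {y | 0 < σ * y ∧ σ * y ≤ b}} ∩ {ω | ∀ i ≤ n, |psum ω i| ≤ z / 4}) := by
    intro σ hσ
    obtain ⟨b, c, q, hc, h⟩ := hl.exists_psum_near lam hσ
    obtain ⟨K₀, hK₀, h'⟩ := exists_confined_lower_bound lam hl hc q
    refine ⟨b, 2 * q + 3, K₀, hK₀, fun K hK => ?_⟩
    filter_upwards [h' K hK] with z hz n hn hnK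
    refine hz n hn hnK _ ((h n hn).trans (measure_psum_pos_ge lam σ (by omega) ?_ fun y hy => hy.1))
    exact measurableSet_mul_mem_Ioc σ b
  obtain ⟨b₁, Q₁, K₁, hK₁, h₁⟩ := one 1 (by norm_num)
  obtain ⟨b₂, Q₂, K₂, hK₂, h₂⟩ := one (-1) (by norm_num)
  refine ⟨max b₁ 0, max Q₁ Q₂, max K₁ K₂, le_max_right _ _, hK₁.trans (le_max_left _ _),
    fun K hK => ?_⟩
  filter_upwards [h₁ K ((le_max_left _ _).trans hK), h₂ K ((le_max_right _ _).trans hK),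
    eventually_ge_atTop 1] with z hz₁ hz₂ hz A hA n hn hnK x hx hxA
  have hzR : (1 : ℝ) ≤ z := by exact_mod_cast hz
  have hm : Measurable ((Set.Iic (x + max b₁ 0)).indicator (1 : ℝ → ℝ≥0∞)) :=
    measurable_one.indicator measurableSet_Iic
  have hpw : ∀ Q' ≤ max Q₁ Q₂, ENNReal.ofReal ((1 / (z : ℝ)) ^ (max Q₁ Q₂)) ≤
      ENNReal.ofReal ((1 / (z : ℝ)) ^ Q') := fun Q' hQ' =>
    ENNReal.ofReal_le_ofReal (pow_le_pow_of_le_one (by positivity)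
      (by rw [div_le_one] <;> linarith) hQ')
  -- From below `z / 2` the walk moves up, otherwise down: the sign guards one barrier and the
  -- confinement to `z / 4` guards the other.
  rcases le_or_gt x (z / 2) with hxz | hxz
  · refine (hpw Q₁ (le_max_left _ _)).trans ((hz₁ n hn hnK).trans ?_)
    rw [← one_mul (iidLaw lam _)]
    refine le_killed_iterate lam measurableSet_Ioo hm n x fun ω hω => ⟨fun i h1 h2 => ?_, ?_⟩
    · have a1 := hω.1.1 i h1 h2
      have a2 := abs_le.1 (hω.2 i h2)
      constructor <;> linarith
    · have a1 := hω.1.2.2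
      rw [Set.indicator_of_mem]
      · rfl
      · change x + psum ω n ≤ x + max b₁ 0
        linarith [le_max_left b₁ 0]
  · refine (hpw Q₂ (le_max_right _ _)).trans ((hz₂ n hn hnK).trans ?_)
    rw [← one_mul (iidLaw lam _)]
    refine le_killed_iterate lam measurableSet_Ioo hm n x fun ω hω => ⟨fun i h1 h2 => ?_, ?_⟩
    · have a1 := hω.1.1 i h1 h2
      have a2 := abs_le.1 (hω.2 i h2)
      constructor <;> linarith
    · have a1 := hω.1.2.1
      rw [Set.indicator_of_mem]
      · rfl
      · change x + psum ω n ≤ x + max b₁ 0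
        linarith [le_max_right b₁ 0]

/-- The walk reaches a prescribed window, staying on one side of its starting point or of its
final point, with polynomial probability. -/
theorem CenteredLaw.exists_psum_window (lam : Measure ℝ) [IsProbabilityMeasure lam] {C s₀ : ℝ}
    (hl : CenteredLaw lam C s₀) :
    ∃ (M : ℝ) (Q : ℕ) (K₀ : ℝ), 0 < M ∧ 1 ≤ K₀ ∧ ∀ K ≥ K₀, ∀ᶠ z : ℕ in atTop, ∀ n : ℕ, 1 ≤ n →
      n * (K * Real.log z) ≤ 2 * (z : ℝ) ^ 2 → ∀ y : ℝ, |y| ≤ √n → ∀ σ : ℝ, |σ| = 1 → M < σ * y →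
      ENNReal.ofReal ((1 / (z : ℝ)) ^ Q) ≤ iidLaw lam
        ({ω | (∀ j, 1 ≤ j → j ≤ n → 0 < σ * psum ω j) ∧ psum ω n ∈ {v | |v - y| ≤ M}} ∩
          {ω | ∀ i ≤ n, |psum ω i| ≤ z / 4}) ∧
      ENNReal.ofReal ((1 / (z : ℝ)) ^ Q) ≤ iidLaw lam
        ({ω | (∀ j < n, σ * psum ω j < σ * psum ω n) ∧ psum ω n ∈ {v | |v - y| ≤ M}} ∩
          {ω | ∀ i ≤ n, |psum ω i| ≤ z / 4}) := by
  obtain ⟨M, q, hM, hloc⟩ := exists_local_lower_bound lam hl.memLp hl.mean hl.var_pos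
  obtain ⟨K₀, hK₀, hconf⟩ := exists_confined_lower_bound lam hl (c := 1 / 2) (by norm_num) q
  refine ⟨M, 2 * q + 3, K₀, hM, hK₀, fun K hK => ?_⟩
  filter_upwards [hconf K hK] with z hz n hn hnK y hy σ hσ hMy
  have hσ2 : σ * σ = 1 := by rw [← abs_mul_abs_self, hσ]; norm_num
  have hI : MeasurableSet {v : ℝ | |v - y| ≤ M} :=
    measurableSet_le (by fun_prop) measurable_const
  have hpos : ∀ v ∈ {v : ℝ | |v - y| ≤ M}, 0 < σ * v := by
    intro v hv
    have h1 : |σ * v - σ * y| ≤ M := by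
      rw [← mul_sub, abs_mul, hσ, one_mul]
      exact hv
    linarith [(abs_le.1 h1).1]
  exact ⟨hz n hn hnK _ ((hloc n hn y hy).trans (measure_psum_pos_ge lam σ (by omega) hI hpos)),
    hz n hn hnK _ ((hloc n hn y hy).trans (measure_psum_record_ge lam σ (by omega) hI hpos))⟩

/-- Moving the killed walk by successive blocks of `h` steps. -/
theorem killed_iterate_blocks (lam : Measure ℝ) [IsProbabilityMeasure lam] {A a r R e : ℝ}
    {η B : ℝ≥0∞} {h : ℕ} (hr : 0 ≤ r) (ha : r + R < a)
    (hη : ∀ y, |y| ≤ 2 * r → η ≤ iidLaw lam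
      ({ω | |psum ω h - y| ≤ r} ∩ {ω | ∀ i ≤ h, |psum ω i| ≤ R}))
    {f : ℝ → ℝ≥0∞} (hf : Measurable f) (hae : a ≤ e) (heA : e ≤ A - a)
    (hB : ∀ y, |y - e| ≤ r → B ≤ f y) (j : ℕ) (x p : ℝ) (hxp : |x - p| ≤ r)
    (hpe : |p - e| ≤ j * r) (hap : a ≤ p) (hpA : p ≤ A - a) :
    η ^ j * B ≤ (killed lam (Set.Ioo 0 A))^[h * j] f x := by
  induction j generalizing x p with
  | zero =>
    have : p = e := by
      have : |p - e| ≤ 0 := by simpa using hpe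
      linarith [abs_nonpos_iff.1 this]
    subst this
    simpa using hB x hxp
  | succ j ih =>
    -- `p` is an ideal position moving toward `e` by at most `r` per block, while the walk stays
    -- within `r` of it. Aiming at the next ideal position from the actual one asks for a
    -- displacement of at most `2 * r`, so errors do not accumulate.
    obtain ⟨p', h1, h2, h3, h4⟩ : ∃ p', |p' - p| ≤ r ∧ |p' - e| ≤ j * r ∧ a ≤ p' ∧ p' ≤ A - a := by
      push_cast at hpe
      have hj : 0 ≤ j * r := by positivity
      rw [abs_le] at hpe
      rcases le_total p e with hle | hle
      · refine ⟨min e (p + r), ?_, ?_, ?_, ?_⟩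
        · rw [abs_le]
          rcases min_cases e (p + r) with h | h <;> constructor <;> linarith
        · rw [abs_le]
          rcases min_cases e (p + r) with h | h <;> constructor <;> linarith
        · exact le_min hae (by linarith)
        · exact (min_le_left _ _).trans heA
      · refine ⟨max e (p - r), ?_, ?_, ?_, ?_⟩
        · rw [abs_le]
          rcases max_cases e (p - r) with h | h <;> constructor <;> linarith
        · rw [abs_le]
          rcases max_cases e (p - r) with h | h <;> constructor <;> linarith
        · exact hae.trans (le_max_left _ _)
        · exact max_le heA (by linarith)
    rw [show h * (j + 1) = h + h * j by ring, Function.iterate_add_apply]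
    have hm := measurable_killed_iterate lam (measurableSet_Ioo (a := (0 : ℝ)) (b := A)) hf (h * j)
    have hy : |p' - x| ≤ 2 * r := by
      calc |p' - x| = |(p' - p) - (x - p)| := by ring_nf
        _ ≤ |p' - p| + |x - p| := abs_sub _ _
        _ ≤ 2 * r := by linarith
    have key := le_killed_iterate lam (measurableSet_Ioo (a := (0 : ℝ)) (b := A)) hm h x
      (E := {ω | |psum ω h - (p' - x)| ≤ r} ∩ {ω | ∀ i ≤ h, |psum ω i| ≤ R})
      (c := η ^ j * B) fun ω hω => ⟨fun i _ hi => ?_, ?_⟩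
    · refine le_trans ?_ key
      rw [pow_succ, mul_assoc, mul_comm η B, ← mul_assoc]
      exact mul_le_mul' le_rfl (hη _ hy)
    · have a1 := abs_le.1 (hω.2 i hi)
      rw [abs_le] at hxp
      constructor <;> linarith
    · refine ih _ p' ?_ h2 h3 h4
      have : |psum ω h - (p' - x)| ≤ r := hω.1
      rwa [show x + psum ω h - p' = psum ω h - (p' - x) by ring]

set_option maxHeartbeats 1000000 in
/-- The numerical facts behind the choice of the blocks. -/
theorem exists_block_params (K K₂ s₀ M : ℝ) (hK : 1 ≤ K) (hK₂ : 144 * K + 64 ≤ K₂) (hs₀ : 0 < s₀)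
    (h₀ : ℕ) : ∀ᶠ z : ℕ in atTop, ∀ k : ℕ,
      (z : ℝ) ^ 2 ≤ k * (K * Real.log z) → k * (K * Real.log z) ≤ 2 * (z : ℝ) ^ 2 →
      ∃ k₁ J h k₃ : ℕ, k = k₁ + (h * J + k₃) ∧ 1 ≤ k₁ ∧ k₁ ≤ k ∧ k₁ ≤ k₃ ∧ k₃ ≤ k ∧ h₀ ≤ h ∧
        (J : ℝ) ≤ 2 * K₂ * Real.log z ∧ K₂ * Real.log z * h ≤ k₁ ∧ M ≤ √k₁ ∧ √k₁ ≤ z / 4 ∧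
        √h ≤ √k₁ / 8 ∧ 3 * z ≤ J * √h ∧ (h : ℝ) ≤ z ^ 2 ∧ 16 * Real.log z / √k₁ ≤ s₀ := by
  filter_upwards [eventually_le_log 8, eventually_mul_log_pow_le (32 * K * K₂ * (h₀ + 1)) 2,
    eventually_mul_log_pow_le (8 * K) 1, eventually_mul_log_pow_le (2048 * K / s₀ ^ 2) 3,
    eventually_ge_atTop ⌈M ^ 2⌉₊, eventually_ge_atTop 8] with z hlog hb1 hb2 hb3 hM hz8 k hk1 hk2
  set l := Real.log z with hl
  have hz : (8 : ℝ) ≤ z := by exact_mod_cast hz8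
  have hKl : 8 ≤ K * l := by nlinarith
  have hKlz : 8 * K * l ≤ z := by simpa using hb2
  have hkz : (8 * z : ℝ) ≤ k := by
    have : 8 * z * (K * l) ≤ k * (K * l) := by nlinarith
    exact le_of_mul_le_mul_right this (by linarith)
  have hk8 : 8 ≤ k := by
    have : (8 : ℝ) ≤ k := by linarith
    exact_mod_cast this
  -- A quarter of the time serves to get away from the barriers, at most another quarter is cut into
  -- `J ≈ K₂ * log z` blocks, and the rest is for the final descent. The blocks cover `J * √h ≈ √(J
  -- * k₁)`, which exceeds `3 * z` because `k₁ ≥ z ^ 2 / (8 * K * log z)` and `K₂ ≥ 144 * K`; their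
  -- number is logarithmic, so their cost is polynomial.
  set k₁ := k / 4 with hk₁
  have hk₁8 : (k : ℝ) / 8 ≤ k₁ := by
    have : k ≤ 8 * k₁ := by omega
    have : (k : ℝ) ≤ 8 * k₁ := by exact_mod_cast this
    linarith
  have hk₁4 : (4 : ℝ) * k₁ ≤ k := by
    have : 4 * k₁ ≤ k := by omega
    exact_mod_cast this
  have hzk₁ : (z : ℝ) ≤ k₁ := by linarith
  have hz2k₁ : (z : ℝ) ^ 2 ≤ 8 * (k₁ * (K * l)) := by nlinarith
  have hk₁z2 : k₁ * (K * l) ≤ (z : ℝ) ^ 2 / 2 := by nlinarith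
  have hK₂l : 64 ≤ K₂ * l := by nlinarith
  set J := ⌈K₂ * l⌉₊ with hJ
  have hJ1 : K₂ * l ≤ J := Nat.le_ceil _
  have hJ2 : (J : ℝ) ≤ 2 * K₂ * l := by
    have := Nat.ceil_lt_add_one (a := K₂ * l) (by linarith)
    linarith
  have hJ0 : 0 < J := by
    have : (0 : ℝ) < J := by linarith
    exact_mod_cast this
  set h := k₁ / J with hh
  have hhJ : h * J ≤ k₁ := Nat.div_mul_le_self _ _
  have hhJ' : k₁ < h * J + J := by
    have := Nat.lt_div_mul_add (a := k₁) hJ0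
    simpa [hh] using this
  have hJR : (0 : ℝ) < J := by exact_mod_cast hJ0
  have hhJR : (h : ℝ) * J ≤ k₁ := by exact_mod_cast hhJ
  have hhJR' : (k₁ : ℝ) < h * J + J := by exact_mod_cast hhJ'
  have hbig : (h₀ + 1 : ℝ) * (2 * J) ≤ k₁ := by
    have h1 : (h₀ + 1 : ℝ) * (2 * J) ≤ (h₀ + 1) * (4 * K₂ * l) :=
      mul_le_mul_of_nonneg_left (by linarith) (by positivity)
    have h2 : (h₀ + 1) * (4 * K₂ * l) * (8 * (K * l)) ≤ k₁ * (8 * (K * l)) := by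
      calc (h₀ + 1) * (4 * K₂ * l) * (8 * (K * l)) = 32 * K * K₂ * (h₀ + 1) * l ^ 2 := by ring
        _ ≤ z := hb1
        _ ≤ z ^ 2 := by nlinarith
        _ ≤ k₁ * (8 * (K * l)) := by linarith
    exact h1.trans (le_of_mul_le_mul_right h2 (by linarith))
  have hh₀R : (h₀ : ℝ) + 1 ≤ h := by
    have h1 : ((h₀ + 1 : ℕ) : ℝ) * (J : ℕ) ≤ (k₁ : ℕ) := by
      push_cast
      nlinarith [mul_nonneg (Nat.cast_nonneg (α := ℝ) h₀) hJR.le]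
    have h2 : h₀ + 1 ≤ h := (Nat.le_div_iff_mul_le hJ0).2 (by exact_mod_cast h1)
    exact_mod_cast h2
  have hh₀ : h₀ ≤ h := by
    have : (h₀ : ℝ) ≤ h := by linarith
    exact_mod_cast this
  have hh1 : (1 : ℝ) ≤ h := by linarith [Nat.cast_nonneg (α := ℝ) h₀]
  have hk₁pos : (0 : ℝ) < k₁ := by linarith
  have h64 : 64 * (h : ℝ) ≤ k₁ := by nlinarith
  refine ⟨k₁, J, h, k - k₁ - h * J, by omega, by omega, by omega, by omega, by omega, hh₀, hJ2, ?_,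
    ?_, ?_, ?_, ?_, ?_, ?_⟩
  · nlinarith
  · refine Real.le_sqrt_of_sq_le ?_
    have : M ^ 2 ≤ z := (Nat.le_ceil _).trans (by exact_mod_cast hM)
    linarith
  · rw [Real.sqrt_le_left (by positivity)]
    nlinarith
  · rw [Real.sqrt_le_left (by positivity), div_pow, Real.sq_sqrt hk₁pos.le]
    linarith
  · have h1 : (3 * z : ℝ) ≤ √(J ^ 2 * h) := by
      refine Real.le_sqrt_of_sq_le ?_
      have h2 : (k₁ : ℝ) ≤ 2 * (h * J) := by nlinarith
      have h3 : K₂ * l * (k₁ / 2) ≤ (J : ℝ) ^ 2 * h := by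
        calc K₂ * l * (k₁ / 2) ≤ J * (h * J) := by gcongr; linarith
          _ = J ^ 2 * h := by ring
      have h4 : 144 * (K * l) * (k₁ / 2) ≤ K₂ * l * (k₁ / 2) := by
        gcongr ?_ * _
        nlinarith
      nlinarith
    rwa [Real.sqrt_mul (by positivity), Real.sqrt_sq hJR.le] at h1
  · nlinarith
  · rw [div_le_iff₀ (by positivity)]
    have h1 : (16 * l) ^ 2 ≤ (s₀ * √k₁) ^ 2 := by
      rw [mul_pow s₀, Real.sq_sqrt hk₁pos.le]
      rw [div_mul_eq_mul_div, div_le_iff₀ (by positivity)] at hb3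
      have h2 : 2048 * K * l ^ 3 ≤ 8 * (k₁ * (K * l)) * s₀ ^ 2 := by
        calc 2048 * K * l ^ 3 ≤ z * s₀ ^ 2 := hb3
          _ ≤ z ^ 2 * s₀ ^ 2 := by gcongr; nlinarith
          _ ≤ _ := by gcongr
      have h3 : (16 * l) ^ 2 * (8 * (K * l)) ≤ s₀ ^ 2 * k₁ * (8 * (K * l)) := by nlinarith
      exact le_of_mul_le_mul_right h3 (by linarith)
    exact (abs_le_of_sq_le_sq' h1 (by positivity)).2

/-- Polynomial lower bound for descending from height at most `2 * z` to a bounded height inside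
`(0, A)`, in a number of steps of order `z ^ 2 / log z`. -/
theorem CenteredLaw.exists_descend (lam : Measure ℝ) [IsProbabilityMeasure lam] {C s₀ : ℝ}
    (hl : CenteredLaw lam C s₀) :
    ∃ (b K₀ : ℝ), 0 ≤ b ∧ 1 ≤ K₀ ∧ ∀ K ≥ K₀, ∃ p : ℕ, ∀ᶠ z : ℕ in atTop, ∀ A : ℝ, (z : ℝ) < A →
      ∀ k : ℕ, (z : ℝ) ^ 2 ≤ k * (K * Real.log z) → k * (K * Real.log z) ≤ 2 * (z : ℝ) ^ 2 →
      ∀ x : ℝ, 0 ≤ x → x ≤ 2 * z → x < A →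
      ENNReal.ofReal ((1 / (z : ℝ)) ^ p) ≤
        (killed lam (Set.Ioo 0 A))^[k] ((Set.Iic b).indicator 1) x := by
  obtain ⟨M, Q, K₀, hM, hK₀, hwin⟩ := hl.exists_psum_window lam
  obtain ⟨c, hc, h₀, hstage⟩ := exists_clt_stage lam hl.memLp hl.mean hl.var_pos
  refine ⟨3 * M, K₀, by positivity, hK₀, fun K hK => ?_⟩
  have hK1 : 1 ≤ K := hK₀.trans hK
  set K₂ : ℝ := 144 * K + 64 + 256 * C with hK₂
  have hC := hl.C_nonneg
  -- A block succeeds with probability at least `c / 2`, so `J ≤ 2 * K₂ * log z` blocks cost at most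
  -- the factor `z ^ p₂`.
  obtain ⟨r₀, hr₀⟩ : ∃ r₀ : ℕ, Real.exp (-r₀) ≤ c / 2 := by
    obtain ⟨r₀, hr₀⟩ := exists_nat_ge (-Real.log (c / 2))
    refine ⟨r₀, ?_⟩
    rw [← Real.log_le_log_iff (Real.exp_pos _) (by positivity), Real.log_exp]
    linarith
  set p₂ : ℕ := ⌈r₀ * (2 * K₂)⌉₊ with hp₂
  refine ⟨Q + (p₂ + Q), ?_⟩
  filter_upwards [hwin K hK, exists_block_params K K₂ s₀ (12 * M + 12) hK1 (by linarith) hl.s₀_pos h₀,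
    eventually_le_log 1, eventually_ge_atTop ⌈8 / c⌉₊, eventually_ge_atTop 1] with
    z hwin hpar hlog hzc hz1 A hzA k hk1 hk2 x hx0 hx2 hxA
  obtain ⟨k₁, J, h, k₃, hk, hk₁1, hk₁k, hk₁₃, hk₃k, hh₀, hJ, hhk₁, hMk₁, hk₁z, hhk, hJz, hhz, hss⟩ :=
    hpar k hk1 hk2
  have hzR : (1 : ℝ) ≤ z := by exact_mod_cast hz1
  have hKl : 0 ≤ K * Real.log z := mul_nonneg (by linarith) (by linarith)
  have hmono : ∀ n : ℕ, n ≤ k → n * (K * Real.log z) ≤ 2 * (z : ℝ) ^ 2 := fun n hn =>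
    (mul_le_mul_of_nonneg_right (by exact_mod_cast hn) hKl).trans hk2
  set w := √(k₁ : ℝ) with hw
  have hwpos : 0 < w := by linarith
  have hw2 : w ^ 2 = k₁ := Real.sq_sqrt (by positivity)
  have hm0 : Measurable ((Set.Iic (3 * M)).indicator (1 : ℝ → ℝ≥0∞)) :=
    measurable_one.indicator measurableSet_Iic
  have hD : MeasurableSet (Set.Ioo 0 A) := measurableSet_Ioo
  have hm3 := measurable_killed_iterate lam hD hm0 k₃
  have hm2 := measurable_killed_iterate lam hD hm3 (h * J)
  rw [hk, Function.iterate_add_apply, Function.iterate_add_apply]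
  -- the last phase
  have phase3 : ∀ y, |y - w / 2| ≤ √h → ENNReal.ofReal ((1 / (z : ℝ)) ^ Q) ≤
      (killed lam (Set.Ioo 0 A))^[k₃] ((Set.Iic (3 * M)).indicator 1) y := by
    intro y hy
    have hy' := abs_le.1 (hy.trans hhk)
    have hk₃w : w ≤ √k₃ := Real.sqrt_le_sqrt (by exact_mod_cast hk₁₃)
    -- The target height is `2 * M`, reached with a strict record minimum at the end: the earlier
    -- path lies above the final height, hence above `0`.
    have hwin3 := (hwin k₃ (hk₁1.trans hk₁₃) (hmono k₃ hk₃k) (-(y - 2 * M)) (by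
      rw [abs_neg, abs_le]; constructor <;> linarith) (-1) (by norm_num) (by linarith)).2
    refine hwin3.trans ?_
    rw [← one_mul (iidLaw lam _)]
    refine le_killed_iterate lam hD hm0 k₃ y fun ω hω => ?_
    have hend : |psum ω k₃ - -(y - 2 * M)| ≤ M := hω.1.2
    rw [abs_le] at hend
    refine ⟨fun i _ hi => ?_, ?_⟩
    · have a2 := abs_le.1 (hω.2 i hi)
      constructor
      · rcases hi.lt_or_eq with hlt | rfl
        · have := hω.1.1 i hlt
          linarith
        · linarith
      · linarith
    · rw [Set.indicator_of_mem]
      · rfl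
      · change y + psum ω k₃ ≤ 3 * M
        linarith
  -- one block
  have hblock : ∀ y, |y| ≤ 2 * √h → ENNReal.ofReal (Real.exp (-r₀)) ≤ iidLaw lam
      ({ω | |psum ω h - y| ≤ √h} ∩ {ω | ∀ i ≤ h, |psum ω i| ≤ w / 4}) := by
    intro y hy
    set s : ℝ := 16 * Real.log z / w with hs
    have hs0 : 0 ≤ s := by
      have : 0 ≤ Real.log z := by linarith
      rw [hs]; positivity
    have hch := measure_exists_psum_gt_le lam (s := s) (C := C) (R := w / 4) hs0 hC
      (hl.exp_le s (by rwa [abs_of_nonneg hs0])) (by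
        have := hl.exp_le (-s) (by rwa [abs_neg, abs_of_nonneg hs0])
        rwa [neg_sq] at this) h
    have hexp : -s * (w / 4) + C * s ^ 2 * h ≤ -((3 : ℕ) : ℝ) * Real.log z := by
      have e1 : s * (w / 4) = 4 * Real.log z := by
        rw [hs]; field_simp; norm_num
      have e2 : C * s ^ 2 * h ≤ Real.log z := by
        have : C * s ^ 2 * h = 256 * C * Real.log z * h * Real.log z / k₁ := by
          rw [hs, ← hw2]; field_simp; ring
        have hk₁p : (0 : ℝ) < k₁ := by exact_mod_cast hk₁1
        rw [this, div_le_iff₀ hk₁p]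
        have h3 : 256 * C * Real.log z * h ≤ K₂ * Real.log z * h := by
          gcongr
          rw [hK₂]; linarith
        have := mul_le_mul_of_nonneg_right (h3.trans hhk₁) (show 0 ≤ Real.log z by linarith)
        linarith
      push_cast
      linarith
    have hbad : iidLaw lam {ω | ∃ i ≤ h, w / 4 < |psum ω i|} ≤ ENNReal.ofReal (c / 2) := by
      refine hch.trans (ENNReal.ofReal_le_ofReal ?_)
      have h2 : 2 * ((h : ℝ) + 1) ≤ 4 * (z : ℝ) ^ 2 := by nlinarith
      have h3 := Real.exp_le_exp.2 hexp
      rw [exp_neg_mul_log hz1] at h3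
      refine (mul_le_mul h2 h3 (Real.exp_pos _).le (by positivity)).trans ?_
      have : 4 * (z : ℝ) ^ 2 * (1 / z) ^ 3 = 4 / z := by field_simp
      rw [this, div_le_iff₀ (by positivity)]
      have hc8 : 8 / c ≤ z := (Nat.le_ceil _).trans (by exact_mod_cast hzc)
      rw [div_le_iff₀ hc] at hc8
      linarith
    have hgood := hstage h hh₀ y hy
    have hsplit : iidLaw lam {ω | |psum ω h - y| ≤ √h / 2} ≤
        iidLaw lam ({ω | |psum ω h - y| ≤ √h} ∩ {ω | ∀ i ≤ h, |psum ω i| ≤ w / 4}) +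
        iidLaw lam {ω | ∃ i ≤ h, w / 4 < |psum ω i|} := by
      refine (measure_mono ?_).trans (measure_union_le _ _)
      intro ω hω
      by_cases h' : ∀ i ≤ h, |psum ω i| ≤ w / 4
      · refine Or.inl ⟨?_, h'⟩
        have : |psum ω h - y| ≤ √h / 2 := hω
        exact this.trans (by linarith [Real.sqrt_nonneg (h : ℝ)])
      · right
        push Not at h'
        exact h'
    have htop : ENNReal.ofReal (c / 2) ≠ ∞ := ENNReal.ofReal_ne_top
    refine (ENNReal.ofReal_le_ofReal hr₀).trans ?_
    rw [← ENNReal.add_le_add_iff_right htop, ← ENNReal.ofReal_add (by positivity) (by positivity),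
      add_halves]
    exact hgood.trans (hsplit.trans (add_le_add le_rfl hbad))
  have phase2 : ∀ y, w / 2 ≤ y → y ≤ A - w / 2 → y ≤ 3 * z →
      ENNReal.ofReal ((1 / (z : ℝ)) ^ p₂) * ENNReal.ofReal ((1 / (z : ℝ)) ^ Q) ≤
      (killed lam (Set.Ioo 0 A))^[h * J] ((killed lam (Set.Ioo 0 A))^[k₃]
        ((Set.Iic (3 * M)).indicator 1)) y := by
    intro y hy1 hy2 hy3
    have := killed_iterate_blocks lam (A := A) (a := w / 2) (r := √h) (R := w / 4) (e := w / 2)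
      (Real.sqrt_nonneg _) (by linarith) hblock hm3 le_rfl (by linarith) phase3 J y y
      (by simp [Real.sqrt_nonneg]) (by rw [abs_le]; constructor <;> linarith) hy1 hy2
    refine le_trans (mul_le_mul' ?_ le_rfl) this
    rw [← ENNReal.ofReal_pow (Real.exp_pos _).le, ← Real.exp_nat_mul, ← exp_neg_mul_log hz1]
    refine ENNReal.ofReal_le_ofReal (Real.exp_le_exp.2 ?_)
    have h1 : (J : ℝ) * r₀ ≤ (r₀ * (2 * K₂)) * Real.log z := by
      calc (J : ℝ) * r₀ ≤ (2 * K₂ * Real.log z) * r₀ := by gcongr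
        _ = _ := by ring
    have h2 : (r₀ * (2 * K₂)) * Real.log z ≤ p₂ * Real.log z := by
      gcongr
      exact Nat.le_ceil _
    linarith
  -- the first phase
  have phase1 : ∀ σ : ℝ, |σ| = 1 → (σ = 1 → x ≤ z / 2) → (σ = -1 → z / 2 < x) →
      (∀ ω : ℕ → ℝ, ω ∈ ({ω | (∀ j, 1 ≤ j → j ≤ k₁ → 0 < σ * psum ω j) ∧
        psum ω k₁ ∈ {v | |v - σ * w| ≤ M}} ∩ {ω | ∀ i ≤ k₁, |psum ω i| ≤ z / 4}) →
        ω ∈ stay (Set.Ioo 0 A) x k₁ ∧ w / 2 ≤ x + psum ω k₁ ∧ x + psum ω k₁ ≤ A - w / 2 ∧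
          x + psum ω k₁ ≤ 3 * z) := by
    intro σ hσ h1 h2 ω hω
    have hend : |psum ω k₁ - σ * w| ≤ M := hω.1.2
    have hlast := abs_le.1 (hω.2 k₁ le_rfl)
    rw [abs_le] at hend
    rcases (abs_eq (by norm_num : (0 : ℝ) ≤ 1)).1 hσ with rfl | rfl
    · have := h1 rfl
      refine ⟨fun i hi1 hi2 => ?_, by linarith, by linarith, by linarith⟩
      have a1 := hω.1.1 i hi1 hi2
      have a2 := abs_le.1 (hω.2 i hi2)
      constructor <;> linarith
    · have := h2 rfl
      refine ⟨fun i hi1 hi2 => ?_, by linarith, by linarith, by linarith⟩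
      have a1 := hω.1.1 i hi1 hi2
      have a2 := abs_le.1 (hω.2 i hi2)
      constructor <;> linarith
  -- A displacement of about `w = √k₁`, upward from below `z / 2` and downward otherwise, leaves
  -- room `w / 2` at both barriers for the blocks.
  obtain ⟨σ, hσ, h1, h2⟩ : ∃ σ : ℝ, |σ| = 1 ∧ (σ = 1 → x ≤ z / 2) ∧ (σ = -1 → z / 2 < x) := by
    rcases le_or_gt x (z / 2) with h | h
    · exact ⟨1, by norm_num, fun _ => h, fun h => by norm_num at h⟩
    · exact ⟨-1, by norm_num, fun h => by norm_num at h, fun _ => h⟩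
  have hσ2 : σ * (σ * w) = w := by
    rw [← mul_assoc, ← abs_mul_abs_self, hσ]; ring
  have hwin1 := (hwin k₁ hk₁1 (hmono k₁ hk₁k) (σ * w) (by
    rw [abs_mul, hσ, one_mul, abs_of_pos hwpos]) σ hσ (by rw [hσ2]; linarith)).1
  have := le_killed_iterate lam hD hm2 k₁ x
    (c := ENNReal.ofReal ((1 / (z : ℝ)) ^ p₂) * ENNReal.ofReal ((1 / (z : ℝ)) ^ Q))
    fun ω hω => ⟨(phase1 σ hσ h1 h2 ω hω).1, phase2 _ (phase1 σ hσ h1 h2 ω hω).2.1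
      (phase1 σ hσ h1 h2 ω hω).2.2.1 (phase1 σ hσ h1 h2 ω hω).2.2.2⟩
  refine le_trans ?_ this
  rw [pow_add, pow_add, ENNReal.ofReal_mul (by positivity), ENNReal.ofReal_mul (by positivity),
    mul_comm (ENNReal.ofReal ((1 / (z : ℝ)) ^ Q))]
  exact mul_le_mul' le_rfl hwin1

/-! ### Exponential tilting and tightness of the walk conditioned to survive -/

/-- `lam'` is the exponential tilting of `lam` with parameter `θ`, normalized by `ρ`. -/
structure ExpTilt (lam lam' : Measure ℝ) (θ ρ : ℝ) : Prop where
  θ_pos : 0 < θ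
  ρ_pos : 0 < ρ
  lintegral_eq : ∀ g : ℝ → ℝ≥0∞, Measurable g →
    ∫⁻ u, g u ∂lam = ENNReal.ofReal ρ * ∫⁻ u, ENNReal.ofReal (Real.exp (-θ * u)) * g u ∂lam'

/-- The density of a path under tilting depends only on its length and its endpoints, so killing
does not interfere with the change of measure. -/
theorem ExpTilt.killed_iterate {lam lam' : Measure ℝ} [IsProbabilityMeasure lam]
    [IsProbabilityMeasure lam'] {θ ρ : ℝ} (ht : ExpTilt lam lam' θ ρ) {D : Set ℝ}
    (hD : MeasurableSet D) {f : ℝ → ℝ≥0∞} (hf : Measurable f) (n : ℕ) :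
    (killed lam D)^[n] f = fun x => ENNReal.ofReal (ρ ^ n * Real.exp (θ * x)) *
      (killed lam' D)^[n] (fun y => ENNReal.ofReal (Real.exp (-θ * y)) * f y) x := by
  have hρ := ht.ρ_pos
  induction n with
  | zero =>
    ext x
    simp only [Function.iterate_zero, id, pow_zero, one_mul]
    rw [← mul_assoc, ← ENNReal.ofReal_mul (by positivity), ← Real.exp_add]
    simp
  | succ n ih =>
    ext x
    rw [Function.iterate_succ_apply', Function.iterate_succ_apply', ih]
    set g := (killed lam' D)^[n] (fun y => ENNReal.ofReal (Real.exp (-θ * y)) * f y) with hg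
    have hgm : Measurable g := measurable_killed_iterate lam' hD (by fun_prop) n
    unfold killed
    have hm : Measurable fun u : ℝ => D.indicator g (x + u) :=
      (hgm.indicator hD).comp (measurable_const_add x)
    have hm2 : Measurable fun u : ℝ =>
        D.indicator (fun x => ENNReal.ofReal (ρ ^ n * Real.exp (θ * x)) * g x) (x + u) :=
      ((Measurable.mul (by fun_prop) hgm).indicator hD).comp (measurable_const_add x)
    rw [ht.lintegral_eq _ hm2, ← lintegral_const_mul _ (by fun_prop), ← lintegral_const_mul _ hm]
    refine lintegral_congr fun u => ?_
    by_cases hu : x + u ∈ D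
    · simp only [Set.indicator_of_mem hu]
      rw [← mul_assoc, ← mul_assoc, ← ENNReal.ofReal_mul (by positivity),
        ← ENNReal.ofReal_mul (by positivity)]
      congr 2
      have e : Real.exp (-θ * u) * Real.exp (θ * (x + u)) = Real.exp (θ * x) := by
        rw [← Real.exp_add]
        congr 1
        ring
      linear_combination ρ ^ (n + 1) * e
    · simp [Set.indicator_of_notMem hu]

theorem killed_iterate_mono_Ico (lam : Measure ℝ) {A : ℝ} {f g : ℝ → ℝ≥0∞} (n : ℕ)
    (h : ∀ y, 0 ≤ y → y < A → f y ≤ g y) {x : ℝ} (hx : 0 ≤ x) (hxA : x < A) :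
    (killed lam (Set.Ioo 0 A))^[n] f x ≤ (killed lam (Set.Ioo 0 A))^[n] g x := by
  rcases Nat.eq_zero_or_pos n with rfl | hn
  · exact h x hx hxA
  · exact killed_iterate_mono_of_pos lam _ hn.ne' (fun y hy => h y hy.1.le hy.2) x

/-- Exponential upper bound for the killed walk. -/
theorem ExpTilt.killed_iterate_ge_le {lam lam' : Measure ℝ} [IsProbabilityMeasure lam]
    [IsProbabilityMeasure lam'] {θ ρ C s₀ : ℝ} (ht : ExpTilt lam lam' θ ρ)
    (hl : CenteredLaw lam' C s₀) {D : Set ℝ} (hD : MeasurableSet D) {δ : ℝ} (hδ : 0 ≤ δ)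
    (hδs : δ ≤ s₀) (hδθ : δ ≤ θ) (n : ℕ) (c x : ℝ) :
    (killed lam D)^[n] ((Set.Ici c).indicator 1) x ≤
      ENNReal.ofReal ((ρ * Real.exp (C * δ ^ 2)) ^ n * Real.exp ((θ - δ) * (x - c))) := by
  have hρ := ht.ρ_pos
  have h1 : ∀ y, (Set.Ici c).indicator (1 : ℝ → ℝ≥0∞) y ≤
      ENNReal.ofReal (Real.exp (-(θ - δ) * c)) * ENNReal.ofReal (Real.exp ((θ - δ) * y)) := by
    intro y
    by_cases hy : y ∈ Set.Ici c
    · rw [Set.indicator_of_mem hy, Pi.one_apply, ← ENNReal.ofReal_mul (by positivity),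
        ← Real.exp_add, ENNReal.one_le_ofReal, Real.one_le_exp_iff]
      have : c ≤ y := hy
      nlinarith
    · rw [Set.indicator_of_notMem hy]
      exact zero_le
  -- Replacing the exponent `θ` by `θ - δ` costs only `exp (C * δ ^ 2)` per step, because the tilted
  -- law is centered.
  have h2 : ∫⁻ u, ENNReal.ofReal (Real.exp ((θ - δ) * u)) ∂lam ≤
      ENNReal.ofReal (ρ * Real.exp (C * δ ^ 2)) := by
    rw [ht.lintegral_eq _ (by fun_prop), ENNReal.ofReal_mul hρ.le]
    refine mul_le_mul' le_rfl ?_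
    have := hl.exp_le (-δ) (by rwa [abs_neg, abs_of_nonneg hδ])
    rw [neg_sq] at this
    refine le_trans (le_of_eq (lintegral_congr fun u => ?_)) this
    rw [← ENNReal.ofReal_mul (by positivity), ← Real.exp_add]
    congr 2
    ring
  refine (killed_iterate_mono lam D n h1 x).trans ?_
  rw [killed_iterate_const_mul lam hD _ (by fun_prop)]
  refine (mul_le_mul' le_rfl (killed_iterate_exp_le lam hD _ n x)).trans ?_
  refine (mul_le_mul' le_rfl (mul_le_mul' (pow_le_pow_left' h2 n) le_rfl)).trans (le_of_eq ?_)
  rw [← ENNReal.ofReal_pow (by positivity), ← ENNReal.ofReal_mul (by positivity),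
    ← ENNReal.ofReal_mul (by positivity)]
  congr 1
  rw [mul_left_comm, ← Real.exp_add]
  congr 2
  ring

/-- A lower bound for the tilted killed walk gives one for the survival probability. -/
theorem ExpTilt.le_killed_iterate_one {lam lam' : Measure ℝ} [IsProbabilityMeasure lam]
    [IsProbabilityMeasure lam'] {θ ρ : ℝ} (ht : ExpTilt lam lam' θ ρ) {D : Set ℝ}
    (hD : MeasurableSet D) {n : ℕ} {c x v : ℝ}
    (h : ENNReal.ofReal v ≤ (killed lam' D)^[n] ((Set.Iic c).indicator 1) x) :
    ENNReal.ofReal (ρ ^ n * Real.exp (θ * (x - c)) * v) ≤ (killed lam D)^[n] 1 x := by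
  have hρ := ht.ρ_pos
  rw [ht.killed_iterate hD measurable_one]
  have h1 : ∀ y, ENNReal.ofReal (Real.exp (-θ * c)) * (Set.Iic c).indicator (1 : ℝ → ℝ≥0∞) y ≤
      ENNReal.ofReal (Real.exp (-θ * y)) * (1 : ℝ → ℝ≥0∞) y := by
    intro y
    by_cases hy : y ∈ Set.Iic c
    · rw [Set.indicator_of_mem hy]
      have : y ≤ c := hy
      refine mul_le_mul' (ENNReal.ofReal_le_ofReal (Real.exp_le_exp.2 ?_)) le_rfl
      nlinarith [ht.θ_pos]
    · simp [Set.indicator_of_notMem hy]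
  refine le_trans ?_ (mul_le_mul' le_rfl (killed_iterate_mono lam' D n h1 x))
  rw [killed_iterate_const_mul lam' hD _ (measurable_one.indicator measurableSet_Iic)]
  refine le_trans (le_of_eq ?_) (mul_le_mul' le_rfl (mul_le_mul' le_rfl h))
  rw [← ENNReal.ofReal_mul (by positivity), ← ENNReal.ofReal_mul (by positivity)]
  congr 1
  rw [show θ * (x - c) = θ * x + -θ * c by ring, Real.exp_add]
  ring

/-- The time scale on which the walk is compared with its tilting. -/
noncomputable def tiltTime (K : ℝ) (z : ℕ) : ℕ := ⌈(z : ℝ) ^ 2 / (K * Real.log z)⌉₊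

theorem eventually_tiltTime {K : ℝ} (hK : 1 ≤ K) : ∀ᶠ z : ℕ in atTop,
    (z : ℝ) ^ 2 ≤ tiltTime K z * (K * Real.log z) ∧
      tiltTime K z * (K * Real.log z) ≤ 2 * (z : ℝ) ^ 2 ∧ 1 ≤ tiltTime K z := by
  filter_upwards [eventually_le_log 1, eventually_mul_log_pow_le K 1, eventually_ge_atTop 1] with
    z hlog hz hz1
  have hzR : (1 : ℝ) ≤ z := by exact_mod_cast hz1
  have hKl : 0 < K * Real.log z := mul_pos (by linarith) (by linarith)
  have h1 := Nat.le_ceil ((z : ℝ) ^ 2 / (K * Real.log z))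
  have h2 := Nat.ceil_lt_add_one (a := (z : ℝ) ^ 2 / (K * Real.log z)) (by positivity)
  refine ⟨(div_le_iff₀ hKl).1 h1, ?_, Nat.one_le_ceil_iff.2 (by positivity)⟩
  have h3 := (mul_le_mul_of_nonneg_right h2.le hKl.le)
  rw [add_mul, div_mul_cancel₀ _ hKl.ne', one_mul] at h3
  unfold tiltTime
  rw [pow_one] at hz
  nlinarith

theorem tsum_exp_half_le {z : ℕ} (hz : 1 ≤ z) {x : ℝ} (hx : 1 / (z : ℝ) ≤ x) :
    ∑' i : ℕ, ENNReal.ofReal (Real.exp (-x * i)) ≤ ENNReal.ofReal (2 * z) := by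
  have hzR : (1 : ℝ) ≤ z := by exact_mod_cast hz
  have hx0 : 0 < x := lt_of_lt_of_le (by positivity) hx
  have h1 : ∀ i : ℕ, ENNReal.ofReal (Real.exp (-x * i)) = ENNReal.ofReal (Real.exp (-x)) ^ i := by
    intro i
    rw [← ENNReal.ofReal_pow (Real.exp_pos _).le, ← Real.exp_nat_mul]
    congr 2
    ring
  simp_rw [h1]
  rw [ENNReal.tsum_geometric, ENNReal.inv_le_iff_inv_le, ← ENNReal.ofReal_inv_of_pos (by positivity),
    ← ENNReal.ofReal_one, ← ENNReal.ofReal_sub _ (Real.exp_pos _).le]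
  refine ENNReal.ofReal_le_ofReal ?_
  have h2 : Real.exp (-x) ≤ Real.exp (-(1 / z)) := Real.exp_le_exp.2 (by linarith)
  have h3 : Real.exp (-(1 / (z : ℝ))) ≤ 1 / (1 + 1 / z) := by
    rw [Real.exp_neg, ← one_div]
    gcongr
    linarith [Real.add_one_le_exp (1 / (z : ℝ))]
  have h4 : 1 / (1 + 1 / (z : ℝ)) + (2 * (z : ℝ))⁻¹ ≤ 1 := by
    have : 1 / (1 + 1 / (z : ℝ)) = z / (z + 1) := by field_simp
    rw [this, ← one_div, div_add_div _ _ (by positivity) (by positivity), div_le_one (by positivity)]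
    nlinarith
  linarith

set_option maxHeartbeats 2000000 in
/-- Tightness of the killed walk conditioned to survive: exponential tails. -/
theorem ExpTilt.exists_tail_le {lam lam' : Measure ℝ} [IsProbabilityMeasure lam]
    [IsProbabilityMeasure lam'] {θ ρ C s₀ : ℝ} (ht : ExpTilt lam lam' θ ρ)
    (hl : CenteredLaw lam' C s₀) :
    ∃ (z₀ κ : ℕ) (B : ℝ), 0 ≤ B ∧ ∀ (A : ℝ) (n z : ℕ), z₀ ≤ z →
      (killed lam (Set.Ioo 0 A))^[n] ((Set.Ici (z : ℝ)).indicator 1) 0 ≤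
        ENNReal.ofReal (B * z ^ κ * Real.exp (-θ * z)) * (killed lam (Set.Ioo 0 A))^[n] 1 0 := by
  obtain ⟨b₁, Q, K₁, hb₁, hK₁, hhold⟩ := hl.exists_hold lam'
  obtain ⟨b₂, K₂, hb₂, hK₂, hdesc⟩ := hl.exists_descend lam'
  have hC := hl.C_nonneg
  have hθ := ht.θ_pos
  have hρ := ht.ρ_pos
  -- With `δ = K₃ * log z / z`, the loss of `δ` in the exponent over a height `z` is a factor `z ^
  -- (-(Q + 4))`. It pays for `z ^ Q` in the ratio of survival probabilities, for `z` from the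
  -- exponential moments over `k` steps and for `2 * z` from the sum over layers; two powers of `z`
  -- remain.
  set K₃ : ℝ := Q + 4 with hK₃
  set K : ℝ := max (max K₁ K₂) (2 * C * K₃ ^ 2) with hK
  have hK1 : 1 ≤ K := hK₁.trans ((le_max_left _ _).trans (le_max_left _ _))
  obtain ⟨p, hdesc⟩ := hdesc K ((le_max_right _ _).trans (le_max_left _ _))
  have hhold := hhold K ((le_max_left _ _).trans (le_max_left _ _))
  set b := max b₁ b₂ with hb
  set κ := max p Q with hκ
  obtain ⟨z₀, hz₀⟩ := eventually_atTop.1 (hhold.and (hdesc.and ((eventually_tiltTime hK1).and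
    ((eventually_le_log (1 + κ)).and ((eventually_mul_log_pow_le (K₃ / s₀) 1).and
    ((eventually_mul_log_pow_le (K₃ / θ) 1).and ((eventually_ge_atTop 1).and
    (eventually_ge_atTop ⌈4 * 2 ^ κ * Real.exp (θ + θ * b)⌉₊))))))))
  refine ⟨z₀, κ, 2 * Real.exp (θ * b), by positivity, fun A n => ?_⟩
  set B := 2 * Real.exp (θ * b) with hB
  induction n using Nat.strong_induction_on with
  | _ n ih =>
  intro z hz
  obtain ⟨hhold, hdesc, ⟨hk1, hk2, hk⟩, hlog, hs₀, hsθ, hz1, hzbig⟩ := hz₀ z hz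
  have hzR : (1 : ℝ) ≤ z := by exact_mod_cast hz1
  have hz0 : (0 : ℝ) < z := by linarith
  have hl1 : 1 ≤ Real.log z := by linarith [Nat.cast_nonneg (α := ℝ) κ]
  have hD : MeasurableSet (Set.Ioo 0 A) := measurableSet_Ioo
  have hmI : Measurable ((Set.Ici (z : ℝ)).indicator (1 : ℝ → ℝ≥0∞)) :=
    measurable_one.indicator measurableSet_Ici
  rcases Nat.eq_zero_or_pos n with rfl | hn
  · have : (0 : ℝ) ∉ Set.Ici (z : ℝ) := by
      simp; omega
    simp [Set.indicator_of_notMem this]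
  rcases le_or_gt A z with hAz | hAz
  · have h0 : (killed lam (Set.Ioo 0 A))^[n] ((Set.Ici (z : ℝ)).indicator 1) 0 ≤
        (killed lam (Set.Ioo 0 A))^[n] (fun _ => 0 * 0) 0 := by
      refine killed_iterate_mono_of_pos lam _ hn.ne' (fun y hy => ?_) 0
      rw [Set.indicator_of_notMem]
      · simp
      · intro h
        have : (z : ℝ) ≤ y := h
        linarith [hy.2]
    rw [killed_iterate_const_mul lam hD 0 (f := fun _ => 0) measurable_const] at h0
    simp only [zero_mul, nonpos_iff_eq_zero] at h0
    rw [h0]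
    exact zero_le
  have hA0 : 0 < A := hz0.trans hAz
  have hU0 := fun (j : ℕ) (x : ℝ) => ht.killed_iterate_ge_le hl hD (δ := 0) le_rfl hl.s₀_pos.le
    hθ.le j (z : ℝ) x
  simp only [ne_eq, OfNat.ofNat_ne_zero, not_false_eq_true, zero_pow, mul_zero, Real.exp_zero,
    mul_one, sub_zero] at hU0
  have hw1 : 1 / (z : ℝ) ≤ 1 := by rw [div_le_one] <;> linarith
  -- If the tilted walk ends below `c` with polynomial probability, ending above `z` is compared
  -- with surviving by ending below `c`: the exponential weights differ by `exp (-θ * (z - c))`,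
  -- whatever the starting point.
  have cmp : ∀ (e : ℕ), e ≤ κ → ∀ (j : ℕ) (x c : ℝ), c ≤ b →
      ENNReal.ofReal ((1 / (z : ℝ)) ^ e) ≤ (killed lam' (Set.Ioo 0 A))^[j] ((Set.Iic c).indicator 1) x →
      (killed lam (Set.Ioo 0 A))^[j] ((Set.Ici (z : ℝ)).indicator 1) x ≤
        ENNReal.ofReal (Real.exp (θ * b) * z ^ κ * Real.exp (-θ * z)) *
          (killed lam (Set.Ioo 0 A))^[j] 1 x := by
    intro e he j x c hc h
    refine (hU0 j x).trans (le_trans ?_ (mul_le_mul' le_rfl (ht.le_killed_iterate_one hD h)))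
    rw [← ENNReal.ofReal_mul (by positivity)]
    refine ENNReal.ofReal_le_ofReal ?_
    have h1 : 1 ≤ (z : ℝ) ^ κ * (1 / z) ^ e := by
      rw [one_div_pow, ← div_eq_mul_one_div, one_le_div (by positivity)]
      exact pow_le_pow_right₀ hzR he
    have h2 : Real.exp (θ * (x - z)) ≤
        Real.exp (θ * b) * Real.exp (-θ * z) * Real.exp (θ * (x - c)) := by
      rw [← Real.exp_add, ← Real.exp_add]
      refine Real.exp_le_exp.2 ?_
      nlinarith
    calc ρ ^ j * Real.exp (θ * (x - z))
        ≤ ρ ^ j * (Real.exp (θ * b) * Real.exp (-θ * z) * Real.exp (θ * (x - c))) * 1 := by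
          rw [mul_one]; gcongr
      _ ≤ ρ ^ j * (Real.exp (θ * b) * Real.exp (-θ * z) * Real.exp (θ * (x - c))) *
            ((z : ℝ) ^ κ * (1 / z) ^ e) := by gcongr
      _ = _ := by ring
  set k := tiltTime K z with hkdef
  have hKl : 0 ≤ K * Real.log z := mul_nonneg (by linarith) (by linarith)
  -- Up to time `k` the comparison is made directly from the starting point `0`, with holding in
  -- place of descent.
  rcases le_or_gt n k with hnk | hnk
  · have h1 := hhold A hAz n hn ((mul_le_mul_of_nonneg_right (by exact_mod_cast hnk) hKl).trans hk2)
      0 le_rfl hA0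
    rw [zero_add] at h1
    refine (cmp Q (le_max_right _ _) n 0 b₁ (le_max_left _ _) h1).trans ?_
    refine mul_le_mul' (ENNReal.ofReal_le_ofReal ?_) le_rfl
    rw [hB]
    gcongr
    linarith [Real.exp_pos (θ * b)]
  -- the main case
  obtain ⟨n', rfl⟩ : ∃ n', n = n' + k := ⟨n - k, by omega⟩
  have hmg := measurable_killed_iterate lam hD hmI k
  have hm1 := measurable_killed_iterate lam hD (measurable_one (α := ℝ≥0∞) (β := ℝ)) k
  set a' := (killed lam (Set.Ioo 0 A))^[n'] 1 0 with ha'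
  set a := (killed lam (Set.Ioo 0 A))^[n' + k] 1 0 with ha
  -- Surviving `k` further steps costs at most `ρ ^ k` and a power of `z`, up to a constant,
  -- uniformly over the position at time `n'`.
  have haa' : ENNReal.ofReal (ρ ^ k * Real.exp (-θ * b) * (1 / z) ^ Q) * a' ≤ a := by
    rw [ha, Function.iterate_add_apply, ha',
      ← congrFun (killed_iterate_const_mul lam hD _ measurable_one n') 0]
    refine killed_iterate_mono_Ico lam n' (fun y hy hyA => ?_) le_rfl hA0
    have h1 := ht.le_killed_iterate_one hD (hhold A hAz k hk hk2 y hy hyA)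
    rw [Pi.one_apply, mul_one]
    refine le_trans (ENNReal.ofReal_le_ofReal ?_) h1
    have h2 : Real.exp (-θ * b) ≤ Real.exp (θ * (y - (y + b₁))) := Real.exp_le_exp.2 (by
      nlinarith [le_max_left b₁ b₂])
    exact mul_le_mul_of_nonneg_right (mul_le_mul_of_nonneg_left h2 (by positivity)) (by positivity)
  set δ := K₃ * Real.log z / z with hδ
  have hK₃4 : 4 ≤ K₃ := by rw [hK₃]; linarith [Nat.cast_nonneg (α := ℝ) Q]
  have hδ0 : 0 ≤ δ := by
    have : 0 ≤ K₃ * Real.log z := mul_nonneg (by linarith) (by linarith)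
    positivity
  have hδs : δ ≤ s₀ := by
    rw [hδ, div_le_iff₀ hz0]
    rw [pow_one, div_mul_eq_mul_div, div_le_iff₀ hl.s₀_pos] at hs₀
    linarith
  have hδθ : δ ≤ θ := by
    rw [hδ, div_le_iff₀ hz0]
    rw [pow_one, div_mul_eq_mul_div, div_le_iff₀ hθ] at hsθ
    linarith
  have hCδ : Real.exp (C * δ ^ 2) ^ k ≤ z := by
    rw [← Real.exp_nat_mul, ← Real.le_log_iff_exp_le hz0]
    have h1 : (k : ℝ) * (C * δ ^ 2) = C * K₃ ^ 2 * Real.log z * (Real.log z * k) / z ^ 2 := by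
      rw [hδ]; field_simp
    rw [h1, div_le_iff₀ (by positivity)]
    have h3 : 2 * (C * K₃ ^ 2) * (Real.log z * k) ≤ 2 * (z : ℝ) ^ 2 := by
      refine le_trans ?_ hk2
      rw [show (k : ℝ) * (K * Real.log z) = K * (Real.log z * k) by ring]
      have : 2 * (C * K₃ ^ 2) ≤ K := by
        rw [hK, ← mul_assoc]; exact le_max_right _ _
      gcongr
    calc C * K₃ ^ 2 * Real.log z * (Real.log z * k)
        = Real.log z * (C * K₃ ^ 2 * (Real.log z * k)) := by ring
      _ ≤ Real.log z * z ^ 2 := by gcongr; linarith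
  set ci : ℕ → ℝ := fun i => ρ ^ k * z * Real.exp ((θ - δ) * (z + i + 1)) with hci
  -- Split on the position `k` steps before the end. From height at most `2 * z` descent gives the
  -- claim with half the constant; higher positions are sorted into unit layers, to which the
  -- induction hypothesis at time `n'` applies.
  have hpoint : ∀ y, 0 ≤ y → y < A → (killed lam (Set.Ioo 0 A))^[k] ((Set.Ici (z : ℝ)).indicator 1) y ≤
      ENNReal.ofReal (Real.exp (θ * b) * z ^ κ * Real.exp (-θ * z)) *
          (killed lam (Set.Ioo 0 A))^[k] 1 y +
        ∑' i : ℕ, ENNReal.ofReal (ci i) * (Set.Ici ((2 * z + i : ℕ) : ℝ)).indicator 1 y := by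
    intro y hy hyA
    rcases le_or_gt y (2 * z) with hy2 | hy2
    · exact (cmp p (le_max_left _ _) k y b₂ (le_max_right _ _) (hdesc A hAz k hk1 hk2 y hy hy2 hyA)).trans
        le_self_add
    · refine le_trans ?_ le_add_self
      set i := ⌊y - 2 * z⌋₊ with hi
      have hi1 : (i : ℝ) ≤ y - 2 * z := Nat.floor_le (by linarith)
      have hi2 : y - 2 * z < i + 1 := Nat.lt_floor_add_one _
      refine le_trans ?_ (ENNReal.le_tsum i)
      have hmem : y ∈ Set.Ici ((2 * z + i : ℕ) : ℝ) := by
        push_cast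
        change 2 * (z : ℝ) + i ≤ y
        linarith
      rw [Set.indicator_of_mem hmem, Pi.one_apply, mul_one]
      refine (ht.killed_iterate_ge_le hl hD hδ0 hδs hδθ k z y).trans (ENNReal.ofReal_le_ofReal ?_)
      have h3 : (θ - δ) * (y - z) ≤ (θ - δ) * (z + i + 1) :=
        mul_le_mul_of_nonneg_left (by linarith) (by linarith)
      rw [mul_pow]
      exact mul_le_mul (mul_le_mul_of_nonneg_left hCδ (by positivity)) (Real.exp_le_exp.2 h3)
        (Real.exp_pos _).le (by positivity)
  rw [Function.iterate_add_apply]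
  refine (killed_iterate_mono_Ico lam n' hpoint le_rfl hA0).trans ?_
  have hmi : ∀ i : ℕ, Measurable ((Set.Ici ((2 * z + i : ℕ) : ℝ)).indicator (1 : ℝ → ℝ≥0∞)) :=
    fun i => measurable_one.indicator measurableSet_Ici
  rw [killed_iterate_add lam hD (hm1.const_mul _), killed_iterate_const_mul lam hD _ hm1,
    killed_iterate_tsum lam hD (fun i => (hmi i).const_mul _)]
  simp_rw [fun i => killed_iterate_const_mul lam hD (ENNReal.ofReal (ci i)) (hmi i) n']
  rw [← Function.iterate_add_apply, ← ha]
  have hterm : ∀ i : ℕ, ENNReal.ofReal (ci i) *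
      (killed lam (Set.Ioo 0 A))^[n'] ((Set.Ici ((2 * z + i : ℕ) : ℝ)).indicator 1) 0 ≤
      ENNReal.ofReal (ρ ^ k * z * B * (2 * z) ^ κ * Real.exp θ * Real.exp (-θ * z) * (1 / z) ^ (Q + 4)) *
        a' * ENNReal.ofReal (Real.exp (-(δ / 2) * i)) := by
    intro i
    refine (mul_le_mul' le_rfl (ih n' (by omega) (2 * z + i) (by omega))).trans ?_
    rw [← mul_assoc, mul_right_comm _ a', ← ENNReal.ofReal_mul (by positivity),
      ← ENNReal.ofReal_mul (by positivity)]
    refine mul_le_mul' (ENNReal.ofReal_le_ofReal ?_) le_rfl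
    rw [hci]
    push_cast
    -- Half of the decay `exp (-δ * i)` pays for the growth of the polynomial factor; the other half
    -- makes the sum over layers converge.
    have hpow : (2 * z + i : ℝ) ^ κ ≤ (2 * z) ^ κ * Real.exp (δ / 2 * i) := by
      have h1 : (2 * z + i : ℝ) ≤ 2 * z * Real.exp (i / (2 * z)) := by
        have := Real.add_one_le_exp ((i : ℝ) / (2 * z))
        calc (2 * z + i : ℝ) = 2 * z * (i / (2 * z) + 1) := by field_simp; ring
          _ ≤ _ := by gcongr
      calc (2 * z + i : ℝ) ^ κ ≤ (2 * z * Real.exp (i / (2 * z))) ^ κ := by gcongr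
        _ = (2 * z) ^ κ * Real.exp (κ * (i / (2 * z))) := by rw [mul_pow, Real.exp_nat_mul]
        _ ≤ (2 * z) ^ κ * Real.exp (δ / 2 * i) := by
            have h2 : (κ : ℝ) ≤ K₃ * Real.log z := by nlinarith
            have h3 : (κ : ℝ) * (i / (2 * z)) ≤ K₃ * Real.log z * (i / (2 * z)) := by gcongr
            have h4 : K₃ * Real.log z * (i / (2 * z)) = δ / 2 * i := by rw [hδ]; field_simp
            exact mul_le_mul_of_nonneg_left (Real.exp_le_exp.2 (h3.trans h4.le)) (by positivity)
    have hexp : Real.exp ((θ - δ) * (z + i + 1)) * Real.exp (-θ * (2 * z + i)) * Real.exp (δ / 2 * i) ≤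
        Real.exp θ * Real.exp (-θ * z) * (1 / z) ^ (Q + 4) * Real.exp (-(δ / 2) * i) := by
      rw [← exp_neg_mul_log hz1, ← Real.exp_add, ← Real.exp_add, ← Real.exp_add, ← Real.exp_add,
        ← Real.exp_add]
      refine Real.exp_le_exp.2 ?_
      have h1 : δ * z = (Q + 4) * Real.log z := by rw [hδ, hK₃]; field_simp
      push_cast
      nlinarith
    calc ρ ^ k * z * Real.exp ((θ - δ) * (z + i + 1)) *
          (B * (2 * z + i) ^ κ * Real.exp (-θ * (2 * z + i)))
        ≤ ρ ^ k * z * Real.exp ((θ - δ) * (z + i + 1)) *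
          (B * ((2 * z) ^ κ * Real.exp (δ / 2 * i)) * Real.exp (-θ * (2 * z + i))) := by gcongr
      _ = ρ ^ k * z * B * (2 * z) ^ κ * (Real.exp ((θ - δ) * (z + i + 1)) *
            Real.exp (-θ * (2 * z + i)) * Real.exp (δ / 2 * i)) := by ring
      _ ≤ ρ ^ k * z * B * (2 * z) ^ κ * (Real.exp θ * Real.exp (-θ * z) * (1 / z) ^ (Q + 4) *
            Real.exp (-(δ / 2) * i)) := by gcongr
      _ = _ := by ring
  have hsum : ∑' i : ℕ, ENNReal.ofReal (ci i) *
      (killed lam (Set.Ioo 0 A))^[n'] ((Set.Ici ((2 * z + i : ℕ) : ℝ)).indicator 1) 0 ≤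
      ENNReal.ofReal (B / 2 * z ^ κ * Real.exp (-θ * z)) * a := by
    refine (ENNReal.tsum_le_tsum hterm).trans ?_
    rw [ENNReal.tsum_mul_left]
    refine (mul_le_mul' le_rfl (tsum_exp_half_le hz1 (x := δ / 2) ?_)).trans ?_
    · have h2 : 2 ≤ K₃ * Real.log z := by nlinarith
      rw [hδ, div_div, div_le_div_iff₀ hz0 (by positivity)]
      nlinarith
    rw [mul_right_comm, ← ENNReal.ofReal_mul (by positivity)]
    refine le_trans ?_ (mul_le_mul' le_rfl haa')
    rw [← mul_assoc (ENNReal.ofReal _) (ENNReal.ofReal _), ← ENNReal.ofReal_mul (by positivity)]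
    refine mul_le_mul' (ENNReal.ofReal_le_ofReal ?_) le_rfl
    have hbig : 4 * 2 ^ κ * Real.exp (θ + θ * b) ≤ z := (Nat.le_ceil _).trans (by exact_mod_cast hzbig)
    have e1 : Real.exp (-θ * b) * Real.exp (θ * b) = 1 := by
      rw [← Real.exp_add]; simp
    have e3 : z * (1 / (z : ℝ)) = 1 := by field_simp
    have h5 : 4 * 2 ^ κ * Real.exp θ * (1 / z) ^ 2 ≤ Real.exp (-θ * b) := by
      rw [Real.exp_add, ← mul_assoc] at hbig
      calc 4 * 2 ^ κ * Real.exp θ * (1 / z) ^ 2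
          = (4 * 2 ^ κ * Real.exp θ * Real.exp (θ * b)) * Real.exp (-θ * b) * (1 / z) ^ 2 := by
            linear_combination (-4 * 2 ^ κ * Real.exp θ * (1 / z) ^ 2) * e1
        _ ≤ z * Real.exp (-θ * b) * (1 / z) ^ 2 := by gcongr
        _ = Real.exp (-θ * b) * (1 / z) := by field_simp
        _ ≤ Real.exp (-θ * b) * 1 := by gcongr
        _ = _ := mul_one _
    calc ρ ^ k * z * B * (2 * z) ^ κ * Real.exp θ * Real.exp (-θ * z) * (1 / z) ^ (Q + 4) * (2 * z)
        = ρ ^ k * B / 2 * z ^ κ * Real.exp (-θ * z) * (1 / z) ^ Q *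
          (4 * 2 ^ κ * Real.exp θ * (1 / z) ^ 2) * (z * (1 / z)) ^ 2 := by
          rw [mul_pow 2 (z : ℝ) κ, pow_add]; ring
      _ ≤ ρ ^ k * B / 2 * z ^ κ * Real.exp (-θ * z) * (1 / z) ^ Q *
          Real.exp (-θ * b) * (z * (1 / z)) ^ 2 := by gcongr
      _ = _ := by rw [e3]; ring
  refine (add_le_add le_rfl hsum).trans ?_
  rw [← add_mul, ← ENNReal.ofReal_add (by positivity) (by positivity)]
  refine mul_le_mul' (ENNReal.ofReal_le_ofReal (le_of_eq ?_)) le_rfl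
  rw [hB]
  ring

/-- Tightness of the killed walk conditioned to survive: its mean is bounded, uniformly over the
number of steps and the level of the upper barrier. -/
theorem ExpTilt.exists_mean_le {lam lam' : Measure ℝ} [IsProbabilityMeasure lam]
    [IsProbabilityMeasure lam'] {θ ρ C s₀ : ℝ} (ht : ExpTilt lam lam' θ ρ)
    (hl : CenteredLaw lam' C s₀) :
    ∃ M : ℝ, 0 ≤ M ∧ ∀ (A : ℝ) (n : ℕ), 0 < A →
      (killed lam (Set.Ioo 0 A))^[n] (fun y => ENNReal.ofReal y) 0 ≤
        ENNReal.ofReal M * (killed lam (Set.Ioo 0 A))^[n] 1 0 := by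
  obtain ⟨z₀, κ, B, hB, hT⟩ := ht.exists_tail_le hl
  have hθ := ht.θ_pos
  set r : ℕ → ℝ := fun i => B * i ^ κ * Real.exp (-θ * i) with hr
  have hr0 : ∀ i, 0 ≤ r i := fun i => by positivity
  have hsum : Summable r := by
    have h1 := (Real.summable_pow_mul_exp_neg_nat_mul κ hθ).mul_left B
    refine h1.congr fun i => ?_
    rw [hr]
    ring
  have hsum' : Summable fun i => r (z₀ + i) := by
    have := (summable_nat_add_iff z₀).2 hsum
    simpa [add_comm] using this
  refine ⟨z₀ + ∑' i, r (z₀ + i), add_nonneg (by positivity) (tsum_nonneg fun i => hr0 _),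
    fun A n hA => ?_⟩
  have hD : MeasurableSet (Set.Ioo 0 A) := measurableSet_Ioo
  have hmi : ∀ i : ℕ, Measurable ((Set.Ici ((z₀ + i : ℕ) : ℝ)).indicator (1 : ℝ → ℝ≥0∞)) :=
    fun i => measurable_one.indicator measurableSet_Ici
  -- Layer-cake bound: above `z₀` the integer levels below `y` are counted.
  have hpt : ∀ y, ENNReal.ofReal y ≤ ENNReal.ofReal z₀ * (1 : ℝ → ℝ≥0∞) y +
      ∑' i : ℕ, (Set.Ici ((z₀ + i : ℕ) : ℝ)).indicator (1 : ℝ → ℝ≥0∞) y := by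
    intro y
    rcases le_or_gt y z₀ with hy | hy
    · exact le_trans (by simpa using ENNReal.ofReal_le_ofReal hy) le_self_add
    · set j := ⌊y - z₀⌋₊ with hj
      have hj1 : (j : ℝ) ≤ y - z₀ := Nat.floor_le (by linarith)
      have hj2 : y - z₀ < j + 1 := Nat.lt_floor_add_one _
      have h1 : ((j + 1 : ℕ) : ℝ≥0∞) ≤
          ∑' i : ℕ, (Set.Ici ((z₀ + i : ℕ) : ℝ)).indicator (1 : ℝ → ℝ≥0∞) y := by
        refine le_trans ?_ (ENNReal.sum_le_tsum (Finset.range (j + 1)))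
        rw [Finset.sum_congr rfl (g := fun _ => (1 : ℝ≥0∞))]
        · simp
        · intro i hi
          have hi' : i ≤ j := by
            have := Finset.mem_range.1 hi
            omega
          have hiR : (i : ℝ) ≤ j := by exact_mod_cast hi'
          have hmem : y ∈ Set.Ici ((z₀ + i : ℕ) : ℝ) := by
            push_cast
            change (z₀ : ℝ) + i ≤ y
            linarith
          rw [Set.indicator_of_mem hmem, Pi.one_apply]
      refine le_trans ?_ (add_le_add le_rfl h1)
      rw [Pi.one_apply, mul_one, ← ENNReal.ofReal_natCast (j + 1),
        ← ENNReal.ofReal_add (by positivity) (by positivity)]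
      refine ENNReal.ofReal_le_ofReal ?_
      push_cast
      linarith
  refine (killed_iterate_mono lam _ n hpt 0).trans ?_
  rw [killed_iterate_add lam hD (measurable_one.const_mul _),
    killed_iterate_const_mul lam hD _ measurable_one, killed_iterate_tsum lam hD hmi,
    ENNReal.ofReal_add (by positivity) (tsum_nonneg fun i => hr0 _), add_mul,
    ENNReal.ofReal_tsum_of_nonneg (fun i => hr0 _) hsum', ← ENNReal.tsum_mul_right]
  exact add_le_add le_rfl (ENNReal.tsum_le_tsum fun i => hT A n (z₀ + i) (by omega))

theorem AnalyticAt.exists_le_add_mul_sq {f : ℝ → ℝ} {a : ℝ} (hf : AnalyticAt ℝ f a)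
    (h0 : deriv f a = 0) :
    ∃ C s₀ : ℝ, 0 ≤ C ∧ 0 < s₀ ∧ ∀ s, |s| ≤ s₀ → f (a + s) ≤ f a + C * s ^ 2 := by
  have h1 := hf.deriv.differentiableAt.isBigO_sub
  obtain ⟨C, hC, hb⟩ := h1.exists_nonneg
  have h2 := hb.bound
  have h3 : ∀ᶠ x in 𝓝 a, DifferentiableAt ℝ f x :=
    hf.eventually_analyticAt.mono fun x hx => hx.differentiableAt
  obtain ⟨ε, hε, hball⟩ := Metric.eventually_nhds_iff_ball.1 (h2.and h3)
  refine ⟨C, ε / 2, hC, by positivity, fun s hs => ?_⟩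
  have hsub : ∀ x ∈ Metric.closedBall a |s|, x ∈ Metric.ball a ε := fun x hx =>
    Metric.closedBall_subset_ball (by linarith) hx
  have h4 := Convex.norm_image_sub_le_of_norm_deriv_le (f := f) (s := Metric.closedBall a |s|)
    (C := C * |s|) (x := a) (y := a + s) (fun x hx => (hball x (hsub x hx)).2) (fun x hx => ?_)
    (convex_closedBall _ _) (by simp) (by simp [Real.dist_eq])
  · rw [Real.norm_eq_abs, Real.norm_eq_abs, add_sub_cancel_left] at h4
    have := (abs_le.1 h4).2
    rw [mul_assoc, abs_mul_abs_self] at this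
    nlinarith
  · have h5 := (hball x (hsub x hx)).1
    rw [h0, sub_zero] at h5
    refine h5.trans ?_
    gcongr
    rwa [Metric.mem_closedBall, Real.dist_eq] at hx

/-- A law with negative mean and `∫ exp = 1` has an exponential tilting that is centered. -/
theorem exists_expTilt (lam : Measure ℝ) [IsProbabilityMeasure lam]
    (hint : Integrable id lam) (hmean : ∫ u, u ∂lam < 0)
    (hexp : ∫⁻ u, ENNReal.ofReal (Real.exp u) ∂lam = 1) :
    ∃ (lam' : Measure ℝ) (θ ρ C s₀ : ℝ), IsProbabilityMeasure lam' ∧ ExpTilt lam lam' θ ρ ∧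
      CenteredLaw lam' C s₀ := by
  have hi1 : Integrable (fun u : ℝ => Real.exp u) lam := by
    refine ⟨by fun_prop, ?_⟩
    rw [hasFiniteIntegral_iff_ofReal (ae_of_all _ fun u => (Real.exp_pos u).le), hexp]
    exact ENNReal.one_lt_top
  have hI1 : ∫ u, Real.exp u ∂lam = 1 := by
    rw [integral_eq_lintegral_of_nonneg_ae (ae_of_all _ fun u => (Real.exp_pos u).le)
      (by fun_prop), hexp]
    rfl
  have hcont : ContinuousOn (mgf id lam) (Set.Icc 0 1) := by
    unfold mgf
    refine continuousOn_of_dominated (bound := fun u => 1 + Real.exp u) (fun t _ => by fun_prop)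
      (fun t ht => ae_of_all _ fun u => ?_) ((integrable_const 1).add hi1)
      (ae_of_all _ fun u => by fun_prop)
    rw [Real.norm_eq_abs, Real.abs_exp, id]
    rcases le_total 0 u with hu | hu
    · have : Real.exp (t * u) ≤ Real.exp u := Real.exp_le_exp.2 (by nlinarith [ht.2])
      linarith
    · have : Real.exp (t * u) ≤ 1 := Real.exp_le_one_iff.2 (by nlinarith [ht.1])
      linarith [Real.exp_pos u]
  -- Rolle's theorem applies between `0` and `1`; tilting at the critical point makes the mean
  -- vanish.
  have h01 : mgf id lam 0 = mgf id lam 1 := by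
    rw [mgf_zero]
    simp [mgf, hI1]
  obtain ⟨θ, hθ, hd⟩ := exists_deriv_eq_zero (by norm_num) hcont h01
  have hsub : Set.Icc (0 : ℝ) 1 ⊆ integrableExpSet id lam := by
    have h0 : (0 : ℝ) ∈ integrableExpSet id lam := by
      simp [integrableExpSet]
    have h1 : (1 : ℝ) ∈ integrableExpSet id lam := by
      simpa [integrableExpSet] using hi1
    exact fun t ht => convex_integrableExpSet.ordConnected.out h0 h1 ht
  have hint' : θ ∈ interior (integrableExpSet id lam) :=
    interior_mono hsub (by rwa [interior_Icc])
  have hIθ : Integrable (fun u : ℝ => Real.exp (θ * u)) lam := hsub ⟨hθ.1.le, hθ.2.le⟩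
  have hρ : 0 < mgf id lam θ := mgf_pos hIθ
  set ρ := mgf id lam θ with hρdef
  set lam' := lam.tilted (θ * id ·) with hlam'
  have hprob : IsProbabilityMeasure lam' := isProbabilityMeasure_tilted hIθ
  have hlint : ∀ g : ℝ → ℝ≥0∞, ∫⁻ u, g u ∂lam' =
      ∫⁻ u, ENNReal.ofReal (Real.exp (θ * u) / ρ) * g u ∂lam := fun g => by
    rw [hlam', lintegral_tilted]
    rfl
  have hmean' : ∫ u, u ∂lam' = 0 := by
    have h1 := integral_tilted_mul_self hint'
    have h2 : deriv (cgf id lam) θ = 0 := by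
      rw [deriv_cgf hint', ← deriv_mgf hint', hd, zero_div]
    rw [h2] at h1
    exact h1
  obtain ⟨C, s₁, hC, hs₁, hquad⟩ := (analyticAt_mgf hint').exists_le_add_mul_sq hd
  obtain ⟨s₂, hs₂, hball⟩ := Metric.mem_nhds_iff.1 (mem_interior_iff_mem_nhds.1 hint')
  refine ⟨lam', θ, ρ, C / ρ, min s₁ (s₂ / 2), hprob, ⟨hθ.1, hρ, fun g hg => ?_⟩, ?_, hmean', ?_,
    by positivity, by positivity, fun s hs => ?_⟩
  · rw [hlint, ← lintegral_const_mul _ (by fun_prop)]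
    refine lintegral_congr fun u => ?_
    rw [← mul_assoc, ← mul_assoc, ← ENNReal.ofReal_mul hρ.le, ← ENNReal.ofReal_mul (by positivity)]
    have : ρ * (Real.exp (θ * u) / ρ) * Real.exp (-θ * u) = 1 := by
      rw [mul_div_cancel₀ _ hρ.ne', ← Real.exp_add]
      simp
    rw [this]
    simp
  · exact_mod_cast memLp_tilted_mul hint' 2
  · have hL2 : MemLp id 2 lam' := by exact_mod_cast memLp_tilted_mul hint' 2
    -- A degenerate tilted law would sit at its mean `0`, and so would `lam`, against its negative
    -- mean.
    refine lt_of_le_of_ne (variance_nonneg _ _) fun h => ?_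
    have h1 := (ProbabilityTheory.evariance_eq_zero_iff (X := id) (μ := lam')
      (by fun_prop)).1 (by rw [← hL2.ofReal_variance_eq, ← h]; simp)
    have h2 : (id : ℝ → ℝ) =ᵐ[lam] fun _ => 0 := by
      refine (absolutelyContinuous_tilted (μ := lam) (f := fun u => θ * id u) hIθ).ae_le ?_
      filter_upwards [h1] with u hu
      rw [hu]
      exact hmean'
    have h3 : ∫ u, u ∂lam = 0 := by
      exact (integral_congr_ae (f := fun u => u) (g := fun _ => (0 : ℝ)) h2).trans (by simp)
    linarith
  · have hmem : θ + s ∈ integrableExpSet id lam := by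
      refine hball ?_
      rw [Metric.mem_ball, Real.dist_eq, add_sub_cancel_left]
      have := hs.trans (min_le_right _ _)
      linarith
    have hIs : Integrable (fun u : ℝ => Real.exp ((θ + s) * u)) lam := hmem
    have h1 : ∫⁻ u, ENNReal.ofReal (Real.exp (s * u)) ∂lam' =
        ENNReal.ofReal (mgf id lam (θ + s) / ρ) := by
      rw [hlint, mgf, ← integral_div]
      simp only [id]
      rw [ofReal_integral_eq_lintegral_ofReal (hIs.div_const ρ)
        (ae_of_all _ fun u => by positivity)]
      refine lintegral_congr fun u => ?_
      rw [← ENNReal.ofReal_mul (by positivity)]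
      congr 1
      rw [div_mul_eq_mul_div, ← Real.exp_add]
      congr 2
      ring
    rw [h1]
    refine ENNReal.ofReal_le_ofReal ?_
    have h2 := hquad s (hs.trans (min_le_left _ _))
    calc mgf id lam (θ + s) / ρ ≤ (ρ + C * s ^ 2) / ρ := by gcongr
      _ = C / ρ * s ^ 2 + 1 := by field_simp; ring
      _ ≤ Real.exp (C / ρ * s ^ 2) := Real.add_one_le_exp _

/-- Tightness of the killed walk with negative drift, conditioned to survive. -/
theorem exists_killed_mean_le (lam : Measure ℝ) [IsProbabilityMeasure lam]
    (hint : Integrable id lam) (hmean : ∫ u, u ∂lam < 0)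
    (hexp : ∫⁻ u, ENNReal.ofReal (Real.exp u) ∂lam = 1) :
    ∃ M : ℝ, 0 ≤ M ∧ ∀ (A : ℝ) (n : ℕ), 0 < A →
      (killed lam (Set.Ioo 0 A))^[n] (fun y => ENNReal.ofReal y) 0 ≤
        ENNReal.ofReal M * (killed lam (Set.Ioo 0 A))^[n] 1 0 := by
  obtain ⟨lam', θ, ρ, C, s₀, hp, ht, hl⟩ := exists_expTilt lam hint hmean hexp
  exact ht.exists_mean_le hl

/-! ### One-step potentials for a single unit -/

/-- Integrated form of a pointwise domination, for nonnegative functions. -/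
theorem lintegral_ofReal_le_of_le {lam : Measure ℝ} {k : ℝ → ℝ≥0∞} {g : ℝ → ℝ} {c : ℝ}
    (hk : ∀ u, k u ≤ ENNReal.ofReal (g u)) (hg0 : ∀ u, 0 ≤ g u) (hg : Integrable g lam)
    (hc : ∫ u, g u ∂lam ≤ c - 1) :
    ∫⁻ u, k u ∂lam + 1 ≤ ENNReal.ofReal c := by
  have h1 : ∫⁻ u, k u ∂lam ≤ ENNReal.ofReal (∫ u, g u ∂lam) := by
    rw [ofReal_integral_eq_lintegral_ofReal hg (ae_of_all _ hg0)]
    exact lintegral_mono hk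
  have h2 : 0 ≤ ∫ u, g u ∂lam := integral_nonneg hg0
  calc ∫⁻ u, k u ∂lam + 1 ≤ ENNReal.ofReal (∫ u, g u ∂lam) + ENNReal.ofReal 1 := by
        rw [ENNReal.ofReal_one]; exact add_le_add h1 le_rfl
    _ = ENNReal.ofReal (∫ u, g u ∂lam + 1) := (ENNReal.ofReal_add h2 zero_le_one).symm
    _ ≤ ENNReal.ofReal c := ENNReal.ofReal_le_ofReal (by linarith)

/-- A linear potential for a walk with negative drift. -/
theorem exists_unaffected_step (lam : Measure ℝ) [IsProbabilityMeasure lam]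
    (hint : Integrable id lam) (hmean : ∫ u, u ∂lam < 0) :
    ∃ κ s : ℝ, 0 ≤ κ ∧ 0 ≤ s ∧ ∀ A v y : ℝ, 0 ≤ v → 0 ≤ y →
      ∫⁻ u, (if A ≤ y + u then 0 else
        ENNReal.ofReal (if y + u ≤ 0 then v else v + κ * (y + u + s))) ∂lam + 1 ≤
      ENNReal.ofReal (v + κ * (y + s)) := by
  set J : ℝ := -∫ u, u ∂lam with hJ
  have hJ0 : 0 < J := by linarith
  -- The shift `s` makes the positive part of `-(u + s)` contribute at most half the drift, so the
  -- slope `2 / J` still gives a decrease by one.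
  have hlim : Tendsto (fun s : ℕ => ∫ u, max (-(u + s)) 0 ∂lam) atTop (𝓝 (∫ _, (0 : ℝ) ∂lam)) := by
    refine tendsto_integral_of_dominated_convergence (fun u => |u|) (fun s => by fun_prop)
      hint.abs (fun s => ae_of_all _ fun u => ?_) (ae_of_all _ fun u => ?_)
    · rw [Real.norm_eq_abs, abs_of_nonneg (le_max_right _ _)]
      refine max_le ?_ (abs_nonneg _)
      linarith [neg_abs_le u, Nat.cast_nonneg (α := ℝ) s]
    · refine tendsto_const_nhds.congr' ?_
      filter_upwards [eventually_ge_atTop ⌈-u⌉₊] with s hs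
      have : -u ≤ s := (Nat.le_ceil _).trans (by exact_mod_cast hs)
      rw [max_eq_right]
      linarith
  rw [integral_zero] at hlim
  obtain ⟨s, hs⟩ := (hlim.eventually_lt_const (show 0 < J / 2 by linarith)).exists
  refine ⟨2 / J, s, by positivity, by positivity, fun A v y hv hy => ?_⟩
  have hintm : Integrable (fun u : ℝ => max (-(u + s)) 0) lam :=
    ((hint.add (integrable_const (s : ℝ))).neg).pos_part
  have hint' : Integrable (fun u : ℝ => u) lam := hint
  have i1 : Integrable (fun u : ℝ => y + u) lam := (integrable_const y).add hint'
  have i2 : Integrable (fun u : ℝ => y + u + s) lam := i1.add (integrable_const _)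
  refine lintegral_ofReal_le_of_le (g := fun u => v + 2 / J * (y + u + s + max (-(u + s)) 0))
    (fun u => ?_) (fun u => ?_) ?_ ?_
  · have h1 : 0 ≤ y + u + s + max (-(u + s)) 0 := by linarith [le_max_left (-(u + s : ℝ)) 0]
    split_ifs with h2 h3
    · exact zero_le
    · refine ENNReal.ofReal_le_ofReal ?_
      have : 0 ≤ 2 / J * (y + u + s + max (-(u + s)) 0) := by positivity
      linarith
    · refine ENNReal.ofReal_le_ofReal ?_
      have h4 := le_max_right (-(u + s : ℝ)) 0
      exact add_le_add le_rfl (mul_le_mul_of_nonneg_left (by linarith) (by positivity))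
  · have h1 : 0 ≤ y + u + s + max (-(u + s)) 0 := by linarith [le_max_left (-(u + s : ℝ)) 0]
    positivity
  · exact (integrable_const v).add (Integrable.const_mul (i2.add hintm) _)
  · have e1 : ∫ u, (y + u + s + max (-(u + s)) 0) ∂lam = y + (-J) + s + ∫ u, max (-(u + s)) 0 ∂lam := by
      rw [integral_add i2 hintm, integral_add i1 (integrable_const _),
        integral_add (integrable_const y) hint']
      simp [hJ]
    have i3 : Integrable (fun u : ℝ => 2 / J * (y + u + s + max (-(u + s)) 0)) lam :=
      (i2.add hintm).const_mul _
    rw [integral_add (integrable_const v) i3, integral_const_mul, e1]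
    simp only [integral_const, probReal_univ, smul_eq_mul, one_mul]
    have : 2 / J * (y + -J + s + ∫ u, max (-(u + (s : ℝ))) 0 ∂lam) ≤
        2 / J * (y + s - J / 2) := by
      gcongr
      linarith
    have e2 : 2 / J * (y + s - J / 2) = 2 / J * (y + s) - 1 := by field_simp
    linarith

/-- A potential for the passage time of a level by a walk with positive drift and finite second
moment. -/
theorem exists_passage_potential (lam : Measure ℝ) [IsProbabilityMeasure lam]
    (hL2 : MemLp id 2 lam) {J : ℝ} (hJ : 0 < J) (hmean : ∫ u, u ∂lam = J) :
    ∃ (C : ℝ) (f : ℝ → ℝ), 0 ≤ C ∧ Measurable f ∧ (∀ b, 0 ≤ b → b / J ≤ f b ∧ f b ≤ b / J + C) ∧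
      ∀ b, 0 < b → Integrable (fun u => if u < b then f (b - u) else 0) lam ∧
        ∫ u, (if u < b then f (b - u) else 0) ∂lam ≤ f b - 1 := by
  have hint : Integrable id lam := hL2.integrable (by norm_num)
  have hsq : Integrable (fun u : ℝ => u ^ 2) lam := hL2.integrable_sq
  set m2 : ℝ := ∫ u, u ^ 2 ∂lam with hm2
  have hm2pos : 0 ≤ m2 := integral_nonneg fun u => sq_nonneg u
  have hm2J : J ^ 2 ≤ m2 := by
    have h1 : 0 ≤ ∫ u, (u - J) ^ 2 ∂lam := integral_nonneg fun u => sq_nonneg _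
    have h2 : ∫ u, (u - J) ^ 2 ∂lam = m2 - 2 * J * J + J ^ 2 := by
      have : ∀ u : ℝ, (u - J) ^ 2 = u ^ 2 - 2 * J * u + J ^ 2 := fun u => by ring
      simp_rw [this]
      have i1 : Integrable (fun u : ℝ => 2 * J * u) lam := hint.const_mul _
      have i2 : Integrable (fun u : ℝ => u ^ 2 - 2 * J * u) lam := hsq.sub i1
      rw [integral_add i2 (integrable_const _), integral_sub hsq i1, integral_const_mul, hmean]
      simp [hm2]
    nlinarith
  -- For `s ≥ u0` the curvature error `c * ψ s * (m2 / s)` is at most `ψ s / J`.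
  set u0 : ℝ := 2 * m2 / J with hu0
  have hu0pos : 0 < u0 := by
    have : 0 < m2 := lt_of_lt_of_le (by positivity) hm2J
    positivity
  -- the positive part of the excess, and its primitive
  have hpint : ∀ s : ℝ, Integrable (fun u : ℝ => max (u - s) 0) lam := fun s =>
    (hint.sub (integrable_const s)).pos_part
  have hqint : ∀ s : ℝ, Integrable (fun u : ℝ => max (u - s) 0 ^ 2) lam := fun s => by
    refine Integrable.mono' ((hsq.const_mul 2).add (integrable_const (2 * s ^ 2))) (by fun_prop)
      (ae_of_all _ fun u => ?_)
    rw [Real.norm_eq_abs, abs_of_nonneg (by positivity)]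
    have h1 : max (u - s) 0 ^ 2 ≤ (u - s) ^ 2 := by
      rcases max_cases (u - s) 0 with h | h <;> rw [h.1]
      nlinarith [sq_nonneg (u - s)]
    simp only [Pi.add_apply]
    nlinarith [sq_nonneg (u + s)]
  set ψ : ℝ → ℝ := fun s => ∫ u, max (u - s) 0 ∂lam with hψ
  set q : ℝ → ℝ := fun s => ∫ u, max (u - s) 0 ^ 2 ∂lam with hq
  -- The linear function `s / J` loses one per step on average, except for an overshoot term `ψ s /
  -- J`. The concave correction `h` has slope `c * ψ`, so the drift gains `c * ψ s * J = 2 * ψ s /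
  -- J` from it, which pays for the overshoot and for the curvature error. Finiteness of the second
  -- moment makes `h` bounded.
  set c : ℝ := 2 / J ^ 2 with hc
  have hcpos : 0 < c := by positivity
  set h : ℝ → ℝ := fun s => c / 2 * (q 0 - q s) with hh
  have hψ0 : ∀ s, 0 ≤ ψ s := fun s => integral_nonneg fun u => le_max_right _ _
  have hq0 : ∀ s, 0 ≤ q s := fun s => integral_nonneg fun u => sq_nonneg _
  have hqanti : ∀ s s', s ≤ s' → q s' ≤ q s := fun s s' hs => by
    refine integral_mono (hqint s') (hqint s) fun u => ?_
    have : max (u - s') 0 ≤ max (u - s) 0 := max_le_max (by linarith) le_rfl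
    exact pow_le_pow_left₀ (le_max_right _ _) this 2
  have hconc : ∀ s s', h s' ≤ h s + c * ψ s * (s' - s) := fun s s' => by
    have h1 : q s - 2 * (s' - s) * ψ s ≤ q s' := by
      rw [hq, hψ]
      simp only
      rw [← integral_const_mul, ← integral_sub (hqint s) ((hpint s).const_mul _)]
      refine integral_mono ((hqint s).sub ((hpint s).const_mul _)) (hqint s') fun u => ?_
      simp only
      have h2 := le_max_left (u - s') 0
      have h3 := le_max_right (u - s') 0
      rcases max_cases (u - s) 0 with h | h <;> rw [h.1]
      · nlinarith [sq_nonneg (max (u - s') 0 - (u - s))]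
      · nlinarith
    rw [hh]
    simp only
    have := mul_le_mul_of_nonneg_left h1 (show 0 ≤ c / 2 by positivity)
    nlinarith
  have hhmono : ∀ s s', s ≤ s' → h s ≤ h s' := fun s s' hs => by
    have := hqanti s s' hs
    rw [hh]
    simp only
    gcongr
  have hh0 : ∀ s, 0 ≤ s → 0 ≤ h s := fun s hs => by
    have := hhmono 0 s hs
    have h0 : h 0 = 0 := by rw [hh]; simp
    linarith
  have hhbd : ∀ s, h s ≤ c / 2 * q 0 := fun s => by
    rw [hh]
    simp only
    have := hq0 s
    gcongr
    linarith
  have hhmeas : Measurable h := by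
    have : Monotone h := fun s s' hs => hhmono s s' hs
    exact this.measurable
  refine ⟨u0 / J + c / 2 * q 0, fun b => (b + u0) / J + h (b + u0), by have := hq0 0; positivity,
    by fun_prop, fun b hb => ⟨?_, ?_⟩, fun b hb => ?_⟩
  · have h1 := hh0 (b + u0) (by linarith)
    have : b / J ≤ (b + u0) / J := by gcongr; linarith
    simp only
    linarith
  · have := hhbd (b + u0)
    simp only
    rw [add_div]
    linarith
  set s := b + u0 with hs
  -- the dominating function
  set g : ℝ → ℝ := fun u => (s - u) / J + 1 / J * max (u - s) 0 + (h s + c * ψ s * (-u)) +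
    c * ψ s * (u ^ 2 / s) with hg
  have hs0 : 0 < s := by linarith
  have hgint : Integrable g lam := by
    refine ((Integrable.add ?_ ((hpint s).const_mul _)).add ?_).add ((hsq.div_const s).const_mul _)
    · exact ((integrable_const s).sub hint).div_const J
    · exact (integrable_const _).add (hint.neg.const_mul _)
  have hle : ∀ u, (if u < b then (b - u + u0) / J + h (b - u + u0) else 0) ≤ g u := by
    intro u
    have e1 : b - u + u0 = s - u := by rw [hs]; ring
    have hkey : 0 ≤ (s - u) / J + 1 / J * max (u - s) 0 := by
      rw [one_div_mul_eq_div, ← add_div]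
      have := le_max_left (u - s) 0
      apply div_nonneg _ hJ.le
      linarith
    have hψs := hψ0 s
    have hkey2 : 0 ≤ h s + c * ψ s * (-u) + c * ψ s * (u ^ 2 / s) := by
      rcases le_or_gt u s with hus | hus
      · have h1 := hconc s (s - u)
        have h2 := hh0 (s - u) (by linarith)
        have h3 : 0 ≤ c * ψ s * (u ^ 2 / s) := by positivity
        have e : s - u - s = -u := by ring
        rw [e] at h1
        linarith
      · have h1 : u ≤ u ^ 2 / s := by rw [le_div_iff₀ hs0]; nlinarith
        have h2 := hh0 s hs0.le
        have h3 := mul_le_mul_of_nonneg_left h1 (show 0 ≤ c * ψ s by positivity)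
        linarith
    split_ifs with hub
    · rw [e1, hg]
      simp only
      have h1 := hconc s (s - u)
      have e : s - u - s = -u := by ring
      rw [e] at h1
      have h3 : 0 ≤ c * ψ s * (u ^ 2 / s) := by positivity
      have h4 : 0 ≤ 1 / J * max (u - s) 0 := mul_nonneg (by positivity) (le_max_right _ _)
      linarith
    · rw [hg]
      simp only
      linarith
  have hnn : ∀ u, 0 ≤ (if u < b then (b - u + u0) / J + h (b - u + u0) else 0) := by
    intro u
    split_ifs with hub
    · have := hh0 (b - u + u0) (by linarith)
      have h2 : 0 ≤ (b - u + u0) / J := div_nonneg (by linarith) hJ.le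
      linarith
    · exact le_rfl
  have hfint : Integrable (fun u => if u < b then (b - u + u0) / J + h (b - u + u0) else 0) lam := by
    refine Integrable.mono' hgint ?_ (ae_of_all _ fun u => ?_)
    · refine Measurable.aestronglyMeasurable ?_
      refine Measurable.ite measurableSet_Iio ?_ measurable_const
      fun_prop
    · rw [Real.norm_eq_abs, abs_of_nonneg (hnn u)]
      exact hle u
  refine ⟨hfint, (integral_mono hfint hgint hle).trans ?_⟩
  have e2 : ∫ u, g u ∂lam = (s - J) / J + 1 / J * ψ s + (h s + c * ψ s * (-J)) +
      c * ψ s * (m2 / s) := by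
    rw [hg]
    have i1 : Integrable (fun u : ℝ => (s - u) / J) lam :=
      ((integrable_const s).sub hint).div_const J
    have i2 : Integrable (fun u : ℝ => 1 / J * max (u - s) 0) lam := (hpint s).const_mul _
    have i3 : Integrable (fun u : ℝ => c * ψ s * (-u)) lam := hint.neg.const_mul _
    have i4 : Integrable (fun u : ℝ => c * ψ s * (u ^ 2 / s)) lam := (hsq.div_const s).const_mul _
    have i12 : Integrable (fun u : ℝ => (s - u) / J + 1 / J * max (u - s) 0) lam := i1.add i2
    have i03 : Integrable (fun u : ℝ => h s + c * ψ s * (-u)) lam := (integrable_const _).add i3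
    have i5 : Integrable (fun u : ℝ => (s - u) / J + 1 / J * max (u - s) 0 +
      (h s + c * ψ s * (-u))) lam := i12.add i03
    have hint' : Integrable (fun u : ℝ => u) lam := hint
    rw [integral_add i5 i4, integral_add i12 i03, integral_add i1 i2,
      integral_add (integrable_const _) i3, integral_const_mul (1 / J),
      integral_const_mul (c * ψ s) (fun u => -u), integral_const_mul (c * ψ s) (fun u => u ^ 2 / s),
      integral_div J, integral_div s, integral_sub (integrable_const _) hint',
      integral_neg, hmean]
    simp [hm2, hψ]
  rw [e2]
  have h5 : m2 / s ≤ J / 2 := by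
    rw [div_le_iff₀ hs0]
    have : J / 2 * u0 = m2 := by rw [hu0]; field_simp
    nlinarith
  have h6 : c * ψ s * (m2 / s) ≤ c * ψ s * (J / 2) := by
    have := hψ0 s
    gcongr
  have h7 : c * ψ s * (J / 2) = 1 / J * ψ s := by rw [hc]; field_simp
  have h8 : (s - J) / J = s / J - 1 := by field_simp
  have h9 : c * ψ s * (-J) = -2 * (1 / J * ψ s) := by rw [hc]; field_simp
  rw [h8, h9]
  linarith

/-- Upper bound for the probability of leaving `(0, A)` from below, started at `y`. -/
noncomputable def exitUpper (t p y : ℝ) : ℝ := if y ≤ 0 then p else Real.exp (-t * y)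

/-- Lower bound for the probability of leaving `(0, A)` from below, started at `y`. -/
noncomputable def exitLower (A t ω π y : ℝ) : ℝ :=
  if y ≤ 0 then max π ((1 - Real.exp (-t * A)) / ω)
  else (Real.exp (-t * y) - Real.exp (-t * A)) / ω

theorem measurable_exitUpper (t p : ℝ) : Measurable (exitUpper t p) :=
  Measurable.ite measurableSet_Iic measurable_const (by fun_prop)

theorem measurable_exitLower (A t ω π : ℝ) : Measurable (exitLower A t ω π) :=
  Measurable.ite measurableSet_Iic measurable_const (by fun_prop)

/-- Convexity of the exponential. It places the subtracted exit term below the linear part of the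
passage potential, which keeps the corrected potential nonnegative. -/
theorem exp_sub_exp_le {A t w : ℝ} (hA : 0 < A) (hw : 0 ≤ w) (hwA : w ≤ A) :
    Real.exp (-t * w) - Real.exp (-t * A) ≤ (A - w) / A := by
  have h := convexOn_exp.2 (Set.mem_univ 0) (Set.mem_univ (-t * A))
    (show 0 ≤ 1 - w / A by rw [sub_nonneg, div_le_one hA]; exact hwA)
    (show 0 ≤ w / A by positivity) (by ring)
  simp only [smul_eq_mul, mul_zero, zero_add, Real.exp_zero, mul_one] at h
  have e : w / A * (-t * A) = -t * w := by field_simp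
  rw [e] at h
  have h2 : (A - w) / A = 1 - w / A := by field_simp
  have h3 : w / A ≤ 1 := by rwa [div_le_one hA]
  rw [h2]
  nlinarith [Real.exp_pos (-t * A)]

/-- The one-step inequality for the potential of a unit whose walk has positive drift: the passage
potential is corrected by bounds for the probability of leaving from below. -/
theorem affected_step (lam : Measure ℝ) [IsProbabilityMeasure lam] {A J t ω α β c v : ℝ}
    {f : ℝ → ℝ} (hJ : 0 < J) (ht : 0 < t) (hA : 0 < A)
    (hf : ∀ b, 0 ≤ b → b / J ≤ f b)
    (hfi : ∀ b, 0 < b → Integrable (fun u => if u < b then f (b - u) else 0) lam ∧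
        ∫ u, (if u < b then f (b - u) else 0) ∂lam ≤ f b - 1)
    (hroot : ∫⁻ u, ENNReal.ofReal (Real.exp (-t * u)) ∂lam = 1) (hω : 1 ≤ ω)
    (hωr : ∀ r, 0 ≤ r → r < A →
      ∫ u in {u | u ≤ -r}, Real.exp (-t * (u + r)) ∂lam ≤ ω * lam.real {u | u ≤ -r})
    (hα : 0 ≤ α) (hβ : 0 ≤ β) (hβA : β ≤ A / J) (hc : 0 ≤ c) (hv : 0 ≤ v)
    (hvle : v ≤ A / J + α - β + c) {y : ℝ} (hy : 0 ≤ y) (hyA : y < A) :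
    ∫⁻ u, (if A ≤ y + u then 0 else ENNReal.ofReal (if y + u ≤ 0 then v else
        f (A - (y + u)) + (α + c) * exitUpper t (∫ u, min 1 (Real.exp (-t * u)) ∂lam) (y + u)
          - β * exitLower A t ω (lam.real (Set.Iic 0)) (y + u))) ∂lam + 1 ≤
      ENNReal.ofReal (f (A - y) + (α + c) * exitUpper t (∫ u, min 1 (Real.exp (-t * u)) ∂lam) y
          - β * exitLower A t ω (lam.real (Set.Iic 0)) y) := by
  have hω0 : 0 < ω := by linarith
  have hei : Integrable (fun u : ℝ => Real.exp (-t * u)) lam := by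
    refine ⟨by fun_prop, ?_⟩
    rw [hasFiniteIntegral_iff_ofReal (ae_of_all _ fun u => (Real.exp_pos _).le), hroot]
    exact ENNReal.one_lt_top
  have heI : ∫ u, Real.exp (-t * u) ∂lam = 1 := by
    rw [integral_eq_lintegral_of_nonneg_ae (ae_of_all _ fun u => (Real.exp_pos _).le)
      (by fun_prop), hroot]
    rfl
  have hshift : ∀ y u : ℝ, Real.exp (-t * (y + u)) = Real.exp (-t * y) * Real.exp (-t * u) :=
    fun y u => by rw [← Real.exp_add]; congr 1; ring
  have hei' : Integrable (fun u : ℝ => Real.exp (-t * (y + u))) lam := by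
    simp_rw [hshift]
    exact hei.const_mul _
  have heI' : ∫ u, Real.exp (-t * (y + u)) ∂lam = Real.exp (-t * y) := by
    simp_rw [hshift]
    rw [integral_const_mul, heI, mul_one]
  have heA1 : Real.exp (-t * A) ≤ 1 := Real.exp_le_one_iff.2 (by nlinarith)
  obtain ⟨hFi, hFI⟩ := hfi (A - y) (by linarith)
  set F : ℝ → ℝ := fun u => if u < A - y then f (A - y - u) else 0 with hF
  -- `U` and `V` are the two exit bounds after one step, set to one once the walk has left from
  -- below. The first decreases on average by Wald's identity; the second increases, because `ω`
  -- bounds the conditional mean of the exponential of the overshoot.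
  set U : ℝ → ℝ := fun u => min 1 (Real.exp (-t * (y + u))) with hU
  set V : ℝ → ℝ := fun u => if y + u ≤ 0 then 1 else if y + u < A then
    (Real.exp (-t * (y + u)) - Real.exp (-t * A)) / ω else 0 with hV
  have hU0 : ∀ u, 0 ≤ U u := fun u => le_min zero_le_one (Real.exp_pos _).le
  have hV0 : ∀ u, 0 ≤ V u := by
    intro u
    rw [hV]
    simp only
    split_ifs with h1 h2
    · exact zero_le_one
    · refine div_nonneg (sub_nonneg.2 (Real.exp_le_exp.2 ?_)) hω0.le
      nlinarith
    · exact le_rfl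
  have hV1 : ∀ u, V u ≤ 1 := by
    intro u
    rw [hV]
    simp only
    split_ifs with h1 h2
    · exact le_rfl
    · rw [div_le_one hω0]
      have : Real.exp (-t * (y + u)) ≤ 1 := Real.exp_le_one_iff.2 (by nlinarith)
      linarith [Real.exp_pos (-t * A)]
    · exact zero_le_one
  have hUi : Integrable U lam := by
    refine Integrable.mono' (integrable_const (1 : ℝ)) (by fun_prop) (ae_of_all _ fun u => ?_)
    rw [Real.norm_eq_abs, abs_of_nonneg (hU0 u)]
    exact min_le_left _ _
  have hVm : Measurable V := by
    refine Measurable.ite (measurableSet_le (by fun_prop) measurable_const) measurable_const ?_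
    exact Measurable.ite (measurableSet_lt (by fun_prop) measurable_const) (by fun_prop)
      measurable_const
  have hVi : Integrable V lam := by
    refine Integrable.mono' (integrable_const (1 : ℝ)) hVm.aestronglyMeasurable
      (ae_of_all _ fun u => ?_)
    rw [Real.norm_eq_abs, abs_of_nonneg (hV0 u)]
    exact hV1 u
  have hUint : ∫ u, U u ∂lam ≤ exitUpper t (∫ u, min 1 (Real.exp (-t * u)) ∂lam) y := by
    unfold exitUpper
    split_ifs with h
    · have : y = 0 := le_antisymm h hy
      subst this
      simp [hU]
    · rw [← heI']
      exact integral_mono hUi hei' fun u => min_le_right _ _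
  have hVgen : (Real.exp (-t * y) - Real.exp (-t * A)) / ω ≤ ∫ u, V u ∂lam := by
    have hs : MeasurableSet {u : ℝ | u ≤ -y} := measurableSet_Iic
    have i1 : Integrable (fun u : ℝ => (Real.exp (-t * (y + u)) - Real.exp (-t * A)) / ω) lam :=
      (hei'.sub (integrable_const _)).div_const ω
    have i2 : Integrable (fun u : ℝ => Real.exp (-t * (y + u)) / ω - 1) lam :=
      (hei'.div_const ω).sub (integrable_const _)
    have i2' := i2.indicator hs
    have h1 : ∫ u, ((Real.exp (-t * (y + u)) - Real.exp (-t * A)) / ω -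
        {u : ℝ | u ≤ -y}.indicator (fun u : ℝ => Real.exp (-t * (y + u)) / ω - 1) u) ∂lam ≤
        ∫ u, V u ∂lam := by
      refine integral_mono (i1.sub i2') hVi fun u => ?_
      simp only
      rw [hV]
      by_cases h : y + u ≤ 0
      · have hmem : u ∈ {u : ℝ | u ≤ -y} := by
          change u ≤ -y
          linarith
        rw [Set.indicator_of_mem hmem]
        simp only [h, if_true]
        rw [sub_div]
        have : 0 ≤ Real.exp (-t * A) / ω := by positivity
        linarith
      · have hmem : u ∉ {u : ℝ | u ≤ -y} := by
          intro h'
          have : u ≤ -y := h'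
          exact h (by linarith)
        rw [Set.indicator_of_notMem hmem]
        simp only [h, if_false, sub_zero]
        split_ifs with h2
        · exact le_rfl
        · refine div_nonpos_of_nonpos_of_nonneg (sub_nonpos.2 (Real.exp_le_exp.2 ?_)) hω0.le
          push Not at h2
          nlinarith
    refine le_trans ?_ h1
    rw [integral_sub i1 i2', integral_div, integral_sub hei' (integrable_const _), heI',
      integral_indicator hs, integral_sub (hei'.div_const ω).integrableOn
      (integrable_const _).integrableOn, integral_div]
    have h3 := hωr y hy hyA
    have h4 : ∫ u in {u : ℝ | u ≤ -y}, Real.exp (-t * (y + u)) ∂lam ≤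
        ω * lam.real {u : ℝ | u ≤ -y} := by
      simpa only [add_comm y] using h3
    have h5 : (∫ u in {u : ℝ | u ≤ -y}, Real.exp (-t * (y + u)) ∂lam) / ω ≤
        lam.real {u : ℝ | u ≤ -y} := by
      rw [div_le_iff₀ hω0]
      linarith
    simp only [integral_const, probReal_univ, smul_eq_mul, mul_one, one_mul,
      measureReal_restrict_apply_univ]
    linarith
  have hVint : exitLower A t ω (lam.real (Set.Iic 0)) y ≤ ∫ u, V u ∂lam := by
    unfold exitLower
    split_ifs with h
    · have : y = 0 := le_antisymm h hy
      subst this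
      refine max_le ?_ (by simpa using hVgen)
      rw [← integral_indicator_one measurableSet_Iic]
      refine integral_mono ((integrable_const (1 : ℝ)).indicator measurableSet_Iic) hVi fun u => ?_
      by_cases hu : u ∈ Set.Iic (0 : ℝ)
      · have : u ≤ 0 := hu
        rw [Set.indicator_of_mem hu, hV]
        simp [this]
      · rw [Set.indicator_of_notMem hu]
        exact hV0 u
    · exact hVgen
  have hgi : Integrable (fun u => F u + (α + c) * U u - β * V u) lam :=
    (hFi.add (hUi.const_mul _)).sub (hVi.const_mul _)
  have hαc : 0 ≤ α + c := by linarith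
  -- pointwise comparison
  have hpt : ∀ u, (A ≤ y + u → 0 ≤ F u + (α + c) * U u - β * V u) ∧
      (y + u ≤ 0 → v ≤ F u + (α + c) * U u - β * V u) ∧
      (0 < y + u → y + u < A → 0 ≤ F u + (α + c) * U u - β * V u ∧
        f (A - (y + u)) + (α + c) * exitUpper t (∫ u, min 1 (Real.exp (-t * u)) ∂lam) (y + u)
          - β * exitLower A t ω (lam.real (Set.Iic 0)) (y + u) = F u + (α + c) * U u - β * V u) := by
    intro u
    refine ⟨fun h => ?_, fun h => ?_, fun h1 h2 => ?_⟩
    · have e1 : F u = 0 := by rw [hF]; simp only; rw [if_neg]; linarith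
      have e2 : V u = 0 := by
        rw [hV]; simp only; rw [if_neg (by linarith), if_neg (by linarith)]
      rw [e1, e2]
      have := mul_nonneg hαc (hU0 u)
      linarith
    · have e1 : F u = f (A - y - u) := by rw [hF]; simp only; rw [if_pos]; linarith
      have e2 : V u = 1 := by rw [hV]; simp only; rw [if_pos h]
      have e3 : U u = 1 := by
        rw [hU]
        simp only
        rw [min_eq_left]
        exact Real.one_le_exp (by nlinarith)
      rw [e1, e2, e3]
      -- The passage potential ignores the lower barrier and is at least `A / J` beyond it; the
      -- weights `α + c` and `β` make up the difference to `v`.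
      have h2 := hf (A - y - u) (by linarith)
      have h3 : A / J ≤ (A - y - u) / J := by gcongr; linarith
      linarith
    · have e1 : F u = f (A - (y + u)) := by
        rw [hF]; simp only; rw [if_pos (by linarith)]; congr 1; ring
      have e2 : V u = (Real.exp (-t * (y + u)) - Real.exp (-t * A)) / ω := by
        rw [hV]; simp only; rw [if_neg (by linarith), if_pos h2]
      have e3 : U u = Real.exp (-t * (y + u)) := by
        rw [hU]
        simp only
        rw [min_eq_right]
        exact Real.exp_le_one_iff.2 (by nlinarith)
      constructor
      · have h3 := hf (A - (y + u)) (by linarith)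
        have h4 := exp_sub_exp_le (t := t) hA h1.le h2.le
        have h5 : 0 ≤ Real.exp (-t * (y + u)) - Real.exp (-t * A) :=
          sub_nonneg.2 (Real.exp_le_exp.2 (by nlinarith))
        have h6 : V u ≤ (A - (y + u)) / A := by
          rw [e2]
          exact (div_le_self h5 hω).trans h4
        have h7 : β * V u ≤ A / J * ((A - (y + u)) / A) :=
          mul_le_mul hβA h6 (hV0 u) (by positivity)
        have h8 : A / J * ((A - (y + u)) / A) = (A - (y + u)) / J := by field_simp
        have := mul_nonneg hαc (hU0 u)
        rw [e1]
        linarith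
      · rw [e1, e2, e3, exitUpper, exitLower, if_neg (by linarith), if_neg (by linarith)]
  refine lintegral_ofReal_le_of_le (g := fun u => F u + (α + c) * U u - β * V u) (fun u => ?_)
    (fun u => ?_) hgi ?_
  · split_ifs with h1 h2
    · exact zero_le
    · exact ENNReal.ofReal_le_ofReal ((hpt u).2.1 h2)
    · push Not at h1 h2
      rw [((hpt u).2.2 h2 h1).2]
  · rcases le_or_gt A (y + u) with h1 | h1
    · exact (hpt u).1 h1
    · rcases le_or_gt (y + u) 0 with h2 | h2
      · exact hv.trans ((hpt u).2.1 h2)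
      · exact ((hpt u).2.2 h2 h1).1
  · have i1 : Integrable (fun u => F u + (α + c) * U u) lam := hFi.add (hUi.const_mul _)
    rw [integral_sub i1 (hVi.const_mul _), integral_add hFi (hUi.const_mul _), integral_const_mul, integral_const_mul]
    have h1 := mul_le_mul_of_nonneg_left hUint hαc
    have h2 := mul_le_mul_of_nonneg_left hVint hβ
    linarith

/-- The two bounds for the probability of leaving from below at `0` are nontrivial. -/
theorem exit_zero_bounds (lam : Measure ℝ) [IsProbabilityMeasure lam] {t : ℝ} (ht : 0 < t)
    (hint : Integrable id lam) (hmean : 0 < ∫ u, u ∂lam)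
    (hroot : ∫⁻ u, ENNReal.ofReal (Real.exp (-t * u)) ∂lam = 1) :
    0 < lam.real (Set.Iic 0) ∧ ∫ u, min 1 (Real.exp (-t * u)) ∂lam < 1 ∧
      lam.real (Set.Iic 0) ≤ ∫ u, min 1 (Real.exp (-t * u)) ∂lam := by
  have hei : Integrable (fun u : ℝ => Real.exp (-t * u)) lam := by
    refine ⟨by fun_prop, ?_⟩
    rw [hasFiniteIntegral_iff_ofReal (ae_of_all _ fun u => (Real.exp_pos _).le), hroot]
    exact ENNReal.one_lt_top
  have heI : ∫ u, Real.exp (-t * u) ∂lam = 1 := by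
    rw [integral_eq_lintegral_of_nonneg_ae (ae_of_all _ fun u => (Real.exp_pos _).le)
      (by fun_prop), hroot]
    rfl
  have hmi : Integrable (fun u : ℝ => min 1 (Real.exp (-t * u))) lam := by
    refine Integrable.mono' (integrable_const (1 : ℝ)) (by fun_prop) (ae_of_all _ fun u => ?_)
    rw [Real.norm_eq_abs, abs_of_nonneg (le_min zero_le_one (Real.exp_pos _).le)]
    exact min_le_left _ _
  have hle : ∫ u, min 1 (Real.exp (-t * u)) ∂lam ≤ 1 := by
    refine (integral_mono hmi (integrable_const (1 : ℝ)) fun u => min_le_left _ _).trans (by simp)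
  have hlow : lam.real (Set.Iic 0) ≤ ∫ u, min 1 (Real.exp (-t * u)) ∂lam := by
    rw [← integral_indicator_one measurableSet_Iic]
    refine integral_mono ((integrable_const (1 : ℝ)).indicator measurableSet_Iic) hmi fun u => ?_
    by_cases hu : u ∈ Set.Iic (0 : ℝ)
    · have : u ≤ 0 := hu
      rw [Set.indicator_of_mem hu]
      simp only [Pi.one_apply]
      rw [min_eq_left (Real.one_le_exp (by nlinarith))]
    · rw [Set.indicator_of_notMem hu]
      exact le_min zero_le_one (Real.exp_pos _).le
  refine ⟨?_, lt_of_le_of_ne hle fun h => ?_, hlow⟩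
  · refine lt_of_le_of_ne measureReal_nonneg fun h => ?_
    have h0 : lam (Set.Iic 0) = 0 := by
      rwa [eq_comm, measureReal_eq_zero_iff] at h
    -- If the increments were positive almost surely, `exp (-t * u)` would have mean below one.
    have hae : ∀ᵐ u ∂lam, 0 < u := by
      rw [ae_iff]
      convert h0 using 2
      ext u
      simp
    have h1 : ∫ u, (1 - Real.exp (-t * u)) ∂lam = 0 := by
      rw [integral_sub (integrable_const _) hei, heI]
      simp
    have h2 : 0 ≤ᵐ[lam] fun u => 1 - Real.exp (-t * u) := by
      filter_upwards [hae] with u hu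
      exact sub_nonneg.2 (Real.exp_le_one_iff.2 (by nlinarith))
    have h3 := (integral_eq_zero_iff_of_nonneg_ae h2 ((integrable_const _).sub hei)).1 h1
    have h4 : ∀ᵐ u ∂lam, False := by
      filter_upwards [h3, hae] with u h3 hu
      have : Real.exp (-t * u) < 1 := Real.exp_lt_one_iff.2 (by nlinarith)
      have h5 : 1 - Real.exp (-t * u) = 0 := h3
      linarith
    simp only [eventually_false_iff_eq_bot, ae_eq_bot] at h4
    exact IsProbabilityMeasure.ne_zero lam h4
  · have h1 : ∫ u, (1 - min 1 (Real.exp (-t * u))) ∂lam = 0 := by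
      rw [integral_sub (integrable_const _) hmi, h]
      simp
    have h2 : 0 ≤ fun u => 1 - min 1 (Real.exp (-t * u)) := fun u =>
      sub_nonneg.2 (min_le_left _ _)
    have h3 := (integral_eq_zero_iff_of_nonneg h2 ((integrable_const _).sub hmi)).1 h1
    have h4 : ∀ᵐ u ∂lam, u ≤ 0 := by
      filter_upwards [h3] with u h3
      have h5 : 1 - min 1 (Real.exp (-t * u)) = 0 := h3
      by_contra hu
      push Not at hu
      have : Real.exp (-t * u) < 1 := Real.exp_lt_one_iff.2 (by nlinarith)
      rw [min_eq_right this.le] at h5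
      linarith
    have := integral_nonpos_of_ae (μ := lam) (f := fun u => u) h4
    linarith

/-! ### The policy as a Markov chain, and the drift criterion for its alarm time -/

section Chain

variable {K : ℕ} {𝓧 : Fin K → Type*} [∀ k, MeasurableSpace (𝓧 k)]
  {N : ℕ} [NeZero N]

/-- The law of the log-likelihood ratio of `E` when the observations have law `μ`. -/
noncomputable def xiLaw (𝒢 : Set (Measure (∀ k, 𝓧 k))) (F : Measure (∀ k, 𝓧 k))
    (μ : Measure (∀ k, 𝓧 k)) (E : Finset (Fin K)) : Measure ℝ :=
  (localLaw μ E).map (xi 𝒢 F E)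

theorem measurable_xi (𝒢 : Set (Measure (∀ k, 𝓧 k))) (F : Measure (∀ k, 𝓧 k))
    (E : Finset (Fin K)) : Measurable (xi 𝒢 F E) :=
  measurable_llr _ _

instance isProbabilityMeasure_localLaw (μ : Measure (∀ k, 𝓧 k)) [IsProbabilityMeasure μ]
    (E : Finset (Fin K)) : IsProbabilityMeasure (localLaw μ E) :=
  Measure.isProbabilityMeasure_map (Finset.measurable_restrict E).aemeasurable

instance isProbabilityMeasure_xiLaw (𝒢 : Set (Measure (∀ k, 𝓧 k))) (F : Measure (∀ k, 𝓧 k))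
    (μ : Measure (∀ k, 𝓧 k)) [IsProbabilityMeasure μ] (E : Finset (Fin K)) :
    IsProbabilityMeasure (xiLaw 𝒢 F μ E) :=
  Measure.isProbabilityMeasure_map (measurable_xi 𝒢 F E).aemeasurable

/-- The transition of the policy on observing the log-likelihood ratio `u`. -/
noncomputable def rrNext (s : Fin N × ℝ) (u : ℝ) : Fin N × ℝ :=
  (if max s.2 0 + u ≤ 0 then s.1 + 1 else s.1, max s.2 0 + u)

theorem measurable_rrNext : Measurable fun p : (Fin N × ℝ) × ℝ => rrNext p.1 p.2 := by
  have h : Measurable fun p : (Fin N × ℝ) × ℝ => max p.1.2 0 + p.2 := by fun_prop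
  refine Measurable.prodMk (Measurable.ite (measurableSet_le h measurable_const) ?_ ?_) h
  · exact (measurable_of_finite fun d : Fin N => d + 1).comp (measurable_fst.comp measurable_fst)
  · exact measurable_fst.comp measurable_fst

variable (𝒢 : Set (Measure (∀ k, 𝓧 k))) (F : Measure (∀ k, 𝓧 k)) (U : Fin N → Finset (Fin K))

theorem rrState_succ (ω : ℕ → ∀ k, 𝓧 k) (n : ℕ) :
    rrState 𝒢 F U ω (n + 1) = rrNext (rrState 𝒢 F U ω n)
      (xi 𝒢 F (U (rrState 𝒢 F U ω n).1) ((U (rrState 𝒢 F U ω n).1).restrict (ω n))) := rfl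

theorem measurable_xi_unit :
    Measurable fun p : Fin N × (∀ k, 𝓧 k) => xi 𝒢 F (U p.1) ((U p.1).restrict p.2) :=
  measurable_from_prod_countable_right fun d =>
    (measurable_xi 𝒢 F (U d)).comp (Finset.measurable_restrict (U d))

theorem measurable_rrState (n : ℕ) : Measurable fun ω => rrState 𝒢 F U ω n := by
  induction n with
  | zero => exact measurable_const
  | succ n ih =>
    simp_rw [rrState_succ]
    exact measurable_rrNext.comp (ih.prodMk ((measurable_xi_unit 𝒢 F U).comp
      ((measurable_fst.comp ih).prodMk (measurable_pi_apply n))))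

theorem rrState_update (ω : ℕ → ∀ k, 𝓧 k) {n i : ℕ} (h : n ≤ i) (x : ∀ k, 𝓧 k) :
    rrState 𝒢 F U (Function.update ω i x) n = rrState 𝒢 F U ω n := by
  induction n with
  | zero => rfl
  | succ n ih =>
    rw [rrState_succ, rrState_succ, ih (by omega), Function.update_of_ne (by omega)]

/-- A set of trajectories that is determined by the first `n` observations. -/
def DependsBefore (n : ℕ) (Γ : Set (ℕ → ∀ k, 𝓧 k)) : Prop :=
  ∀ ω i x, n ≤ i → (Function.update ω i x ∈ Γ ↔ ω ∈ Γ)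

theorem DependsBefore.inter {n : ℕ} {Γ Γ' : Set (ℕ → ∀ k, 𝓧 k)} (h : DependsBefore n Γ)
    (h' : DependsBefore n Γ') : DependsBefore n (Γ ∩ Γ') := fun ω i x hi =>
  and_congr (h ω i x hi) (h' ω i x hi)

theorem DependsBefore.mono {n n' : ℕ} {Γ : Set (ℕ → ∀ k, 𝓧 k)} (h : DependsBefore n Γ)
    (hn : n ≤ n') : DependsBefore n' Γ := fun ω i x hi => h ω i x (hn.trans hi)

theorem dependsBefore_rrState (n : ℕ) (S : Set (Fin N × ℝ)) :
    DependsBefore n {ω : ℕ → ∀ k, 𝓧 k | rrState 𝒢 F U ω n ∈ S} := fun ω i x hi => by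
  change rrState 𝒢 F U (Function.update ω i x) n ∈ S ↔ rrState 𝒢 F U ω n ∈ S
  rw [rrState_update 𝒢 F U ω hi]

/-- Integrating out the observation made at time `n + 1`. -/
theorem setLIntegral_rrState_succ (μ : ℕ → Measure (∀ k, 𝓧 k)) [∀ i, IsProbabilityMeasure (μ i)]
    (n : ℕ) {Γ : Set (ℕ → ∀ k, 𝓧 k)} (hΓ : MeasurableSet Γ) (hd : DependsBefore n Γ)
    {φ : Fin N × ℝ → ℝ≥0∞} (hφ : Measurable φ) :
    ∫⁻ ω in Γ, φ (rrState 𝒢 F U ω (n + 1)) ∂Measure.infinitePi μ =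
      ∫⁻ ω in Γ, (∫⁻ u, φ (rrNext (rrState 𝒢 F U ω n) u)
        ∂xiLaw 𝒢 F (μ n) (U (rrState 𝒢 F U ω n).1)) ∂Measure.infinitePi μ := by
  have hm : Measurable (Γ.indicator fun ω => φ (rrState 𝒢 F U ω (n + 1))) :=
    (hφ.comp (measurable_rrState 𝒢 F U (n + 1))).indicator hΓ
  rw [← lintegral_indicator hΓ, ← lintegral_indicator hΓ, lintegral_infinitePi_update μ n hm]
  refine lintegral_congr fun ω => ?_
  by_cases hω : ω ∈ Γ
  · rw [Set.indicator_of_mem hω]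
    have h1 : ∀ x, Γ.indicator (fun ω => φ (rrState 𝒢 F U ω (n + 1))) (Function.update ω n x) =
        φ (rrNext (rrState 𝒢 F U ω n) (xi 𝒢 F (U (rrState 𝒢 F U ω n).1)
          ((U (rrState 𝒢 F U ω n).1).restrict x))) := fun x => by
      rw [Set.indicator_of_mem ((hd ω n x le_rfl).2 hω), rrState_succ,
        rrState_update 𝒢 F U ω le_rfl, Function.update_self]
    simp_rw [h1]
    have hm : Measurable fun u => φ (rrNext (rrState 𝒢 F U ω n) u) :=
      hφ.comp (measurable_rrNext.comp (measurable_const.prodMk measurable_id))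
    rw [xiLaw, lintegral_map hm (measurable_xi _ _ _), localLaw]
    exact (lintegral_map (hm.comp (measurable_xi _ _ _)) (Finset.measurable_restrict _)).symm
  · rw [Set.indicator_of_notMem hω]
    have h1 : ∀ x, Γ.indicator (fun ω => φ (rrState 𝒢 F U ω (n + 1))) (Function.update ω n x) = 0 :=
      fun x => Set.indicator_of_notMem (fun h => hω ((hd ω n x le_rfl).1 h)) _
    simp_rw [h1]
    simp

/-- No alarm up to time `n`. -/
def rrAlive (A : ℝ) (n : ℕ) : Set (ℕ → ∀ k, 𝓧 k) :=
  {ω | ∀ k, 1 ≤ k → k ≤ n → (rrState 𝒢 F U ω k).2 < A}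

theorem measurableSet_rrAlive (A : ℝ) (n : ℕ) : MeasurableSet (rrAlive 𝒢 F U A n) := by
  have : rrAlive 𝒢 F U A n = ⋂ k ∈ Set.Icc 1 n, {ω | (rrState 𝒢 F U ω k).2 < A} := by
    ext ω
    simp [rrAlive]
  rw [this]
  exact MeasurableSet.biInter (Set.to_countable _) fun k _ =>
    measurableSet_lt (measurable_snd.comp (measurable_rrState 𝒢 F U k)) measurable_const

theorem dependsBefore_rrAlive (A : ℝ) (n : ℕ) : DependsBefore n (rrAlive 𝒢 F U A n) := by
  intro ω i x hi
  refine forall_congr' fun k => forall_congr' fun _ => forall_congr' fun hk => ?_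
  rw [rrState_update 𝒢 F U ω (hk.trans hi)]

theorem rrAlive_succ (A : ℝ) (n : ℕ) :
    rrAlive 𝒢 F U A (n + 1) = rrAlive 𝒢 F U A n ∩ {ω | (rrState 𝒢 F U ω (n + 1)).2 < A} := by
  ext ω
  constructor
  · exact fun h => ⟨fun k h1 h2 => h k h1 (by omega), h (n + 1) (by omega) le_rfl⟩
  · rintro ⟨h1, h2⟩ k hk1 hk2
    rcases hk2.lt_or_eq with h | rfl
    · exact h1 k hk1 (by omega)
    · exact h2

theorem lt_rrStop_iff (A : ℝ) (n : ℕ) (ω : ℕ → ∀ k, 𝓧 k) :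
    (n : ℕ∞) < rrStop 𝒢 F U A ω ↔ ω ∈ rrAlive 𝒢 F U A n := by
  rw [← ENat.add_one_le_iff (ENat.natCast_ne_top n), rrStop, le_sInf_iff]
  constructor
  · intro h k h1 h2
    by_contra hk
    push Not at hk
    have := h k ⟨k, rfl, h1, hk⟩
    have h3 : n + 1 ≤ k := by exact_mod_cast this
    omega
  · rintro h t ⟨k, rfl, h1, hk⟩
    have : ¬ k ≤ n := fun h2 => absurd (h k h1 h2) (not_lt.2 hk)
    exact_mod_cast Nat.lt_of_not_le this

/-- A potential dominates the expected remaining time until the alarm. -/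
theorem sum_measure_alive_le (μ : ℕ → Measure (∀ k, 𝓧 k)) [∀ i, IsProbabilityMeasure (μ i)]
    (A : ℝ) (ν : ℕ) (Ψ : Fin N → ℝ → ℝ≥0∞) (hΨ : ∀ d, Measurable (Ψ d))
    (hA : 0 < A)
    (hstep : ∀ d y n, ν ≤ n → 0 ≤ y → y < A →
      ∫⁻ u, (if A ≤ y + u then 0 else if y + u ≤ 0 then Ψ (d + 1) 0 else Ψ d (y + u))
        ∂xiLaw 𝒢 F (μ n) (U d) + 1 ≤ Ψ d y)
    {B : Set (ℕ → ∀ k, 𝓧 k)} (hB : MeasurableSet B) (hBd : DependsBefore ν B) :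
    ∑' m, Measure.infinitePi μ (B ∩ rrAlive 𝒢 F U A (ν + m)) ≤
      ∫⁻ ω in B ∩ rrAlive 𝒢 F U A ν, Ψ (rrState 𝒢 F U ω ν).1 (max (rrState 𝒢 F U ω ν).2 0)
        ∂Measure.infinitePi μ := by
  set pot : Fin N × ℝ → ℝ≥0∞ := fun s => Ψ s.1 (max s.2 0) with hpot
  have hpotm : Measurable pot := by
    have : Measurable fun p : Fin N × ℝ => Ψ p.1 p.2 := measurable_from_prod_countable_right hΨ
    exact this.comp (measurable_fst.prodMk (measurable_snd.max measurable_const))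
  set φ : Fin N × ℝ → ℝ≥0∞ := fun s => if A ≤ s.2 then 0 else pot s with hφ
  have hφm : Measurable φ :=
    Measurable.ite (measurableSet_le measurable_const measurable_snd) measurable_const hpotm
  have hmeas : ∀ n, MeasurableSet (B ∩ rrAlive 𝒢 F U A n) := fun n =>
    hB.inter (measurableSet_rrAlive 𝒢 F U A n)
  -- One term of the telescoping sum: in each step the potential on survival drops by at least the
  -- probability of survival.
  have key : ∀ m, ∫⁻ ω in B ∩ rrAlive 𝒢 F U A (ν + (m + 1)), pot (rrState 𝒢 F U ω (ν + (m + 1)))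
      ∂Measure.infinitePi μ + Measure.infinitePi μ (B ∩ rrAlive 𝒢 F U A (ν + m)) ≤
      ∫⁻ ω in B ∩ rrAlive 𝒢 F U A (ν + m), pot (rrState 𝒢 F U ω (ν + m)) ∂Measure.infinitePi μ := by
    intro m
    have hdep : DependsBefore (ν + m) (B ∩ rrAlive 𝒢 F U A (ν + m)) :=
      (hBd.mono (by omega)).inter (dependsBefore_rrAlive 𝒢 F U A _)
    have h1 : ∫⁻ ω in B ∩ rrAlive 𝒢 F U A (ν + (m + 1)), pot (rrState 𝒢 F U ω (ν + (m + 1)))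
        ∂Measure.infinitePi μ ≤ ∫⁻ ω in B ∩ rrAlive 𝒢 F U A (ν + m),
          φ (rrState 𝒢 F U ω (ν + m + 1)) ∂Measure.infinitePi μ := by
      rw [← lintegral_indicator (hmeas _), ← lintegral_indicator (hmeas _)]
      refine lintegral_mono fun ω => ?_
      by_cases hω : ω ∈ B ∩ rrAlive 𝒢 F U A (ν + (m + 1))
      · rw [Set.indicator_of_mem hω]
        rw [← add_assoc, rrAlive_succ] at hω
        rw [Set.indicator_of_mem (show ω ∈ B ∩ rrAlive 𝒢 F U A (ν + m) from ⟨hω.1, hω.2.1⟩), hφ]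
        simp only
        have h2 : (rrState 𝒢 F U ω (ν + m + 1)).2 < A := hω.2.2
        rw [if_neg (not_le.2 h2)]
        exact le_rfl
      · rw [Set.indicator_of_notMem hω]
        exact zero_le
    refine (add_le_add h1 le_rfl).trans ?_
    rw [setLIntegral_rrState_succ 𝒢 F U μ (ν + m) (hmeas _) hdep hφm, ← setLIntegral_one,
      ← lintegral_add_right _ measurable_const]
    refine setLIntegral_mono (hpotm.comp (measurable_rrState 𝒢 F U _)) fun ω hω => ?_
    set s := rrState 𝒢 F U ω (ν + m) with hs
    have hsA : max s.2 0 < A := by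
      refine max_lt ?_ hA
      rcases Nat.eq_zero_or_pos (ν + m) with h0 | h0
      · rw [hs, h0]; exact hA
      · exact hω.2 _ h0 le_rfl
    refine le_trans (le_of_eq ?_) (hstep s.1 (max s.2 0) (ν + m) (by omega) (le_max_right _ _) hsA)
    congr 1
    refine lintegral_congr fun u => ?_
    simp only [hφ, hpot, rrNext]
    split_ifs with h1 h2
    · rfl
    · rw [max_eq_right h2]
    · rw [max_eq_left (by linarith)]
  have hsum : ∀ M, ∑ m ∈ Finset.range M, Measure.infinitePi μ (B ∩ rrAlive 𝒢 F U A (ν + m)) +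
      ∫⁻ ω in B ∩ rrAlive 𝒢 F U A (ν + M), pot (rrState 𝒢 F U ω (ν + M)) ∂Measure.infinitePi μ ≤
      ∫⁻ ω in B ∩ rrAlive 𝒢 F U A ν, pot (rrState 𝒢 F U ω ν) ∂Measure.infinitePi μ := by
    intro M
    induction M with
    | zero => simp
    | succ M ih =>
      rw [Finset.sum_range_succ, add_assoc, add_comm (Measure.infinitePi μ _)]
      exact (add_le_add le_rfl (key M)).trans ih
  rw [ENNReal.tsum_eq_iSup_nat]
  exact iSup_le fun M => le_self_add.trans (hsum M)

theorem enat_sub_eq_tsum (T : ℕ∞) (ν : ℕ) :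
    ((T : ℕ∞) : ℝ≥0∞) - (ν : ℝ≥0∞) = ∑' m : ℕ, if ((ν + m : ℕ) : ℕ∞) < T then 1 else 0 := by
  induction T using ENat.recTopCoe with
  | top =>
    simp only [ENat.natCast_lt_top, if_true]
    rw [ENNReal.tsum_const_eq_top_of_ne_zero one_ne_zero]
    simp
  | coe k =>
    have h : ∀ m : ℕ, (if ((ν + m : ℕ) : ℕ∞) < (k : ℕ∞) then (1 : ℝ≥0∞) else 0) =
        if m ∈ Finset.range (k - ν) then 1 else 0 := by
      intro m
      congr 1
      rw [Finset.mem_range, Nat.cast_lt]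
      exact propext (by omega)
    simp_rw [h]
    rw [tsum_eq_sum (s := Finset.range (k - ν)) (fun m hm => if_neg hm),
      Finset.sum_congr rfl (fun m hm => if_pos hm)]
    simp

/-- The expected remaining time as a sum of survival probabilities. -/
theorem setLIntegral_rrStop_sub (P : Measure (ℕ → ∀ k, 𝓧 k)) (A : ℝ) (ν : ℕ)
    {B : Set (ℕ → ∀ k, 𝓧 k)} :
    ∫⁻ ω in B, (((rrStop 𝒢 F U A ω : ℕ∞) : ℝ≥0∞) - (ν : ℝ≥0∞)) ∂P =
      ∑' m, P (B ∩ rrAlive 𝒢 F U A (ν + m)) := by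
  simp_rw [enat_sub_eq_tsum]
  have h : ∀ m : ℕ, (fun ω => if ((ν + m : ℕ) : ℕ∞) < rrStop 𝒢 F U A ω then (1 : ℝ≥0∞) else 0) =
      (rrAlive 𝒢 F U A (ν + m)).indicator 1 := by
    intro m
    ext ω
    by_cases hω : ω ∈ rrAlive 𝒢 F U A (ν + m)
    · rw [Set.indicator_of_mem hω, if_pos ((lt_rrStop_iff 𝒢 F U A _ ω).2 hω)]
      rfl
    · rw [Set.indicator_of_notMem hω, if_neg fun h => hω ((lt_rrStop_iff 𝒢 F U A _ ω).1 h)]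
  rw [lintegral_tsum fun m => by
    rw [h m]
    exact (measurable_one.indicator (measurableSet_rrAlive 𝒢 F U A _)).aemeasurable]
  refine tsum_congr fun m => ?_
  rw [h m, lintegral_indicator_one (measurableSet_rrAlive 𝒢 F U A _),
    Measure.restrict_apply (measurableSet_rrAlive 𝒢 F U A _), Set.inter_comm]

end Chain

/-- A bound for a conditional expectation can be tested by integrals over the sets of the smaller
σ-algebra, so no regular conditional law is needed. -/
theorem essSup_condLExp_le {Ω : Type*} {m m0 : MeasurableSpace Ω} (hm : m ≤ m0)
    (P : Measure[m0] Ω) [IsFiniteMeasure P] (X : Ω → ℝ≥0∞) (R : ℝ≥0∞)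
    (h : ∀ s, MeasurableSet[m] s → ∫⁻ ω in s, X ω ∂P ≤ R * P s) :
    essSup (condLExp m P X) P ≤ R := by
  refine essSup_le_of_ae_le R (ae_of_ae_trim hm ?_)
  refine ae_le_of_forall_setLIntegral_le_of_sigmaFinite (measurable_condLExp m P X)
    fun s hs _ => ?_
  rw [setLIntegral_condLExp_trim hm P X hs, setLIntegral_const, trim_measurableSet_eq hm hs]
  exact h s hs

/-! ### Conditioning on the history of the affected units -/

section History

variable {K : ℕ} {𝓧 : Fin K → Type*} [∀ k, MeasurableSpace (𝓧 k)]
  {N : ℕ} [NeZero N]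
variable (𝒢 : Set (Measure (∀ k, 𝓧 k))) (F G : Measure (∀ k, 𝓧 k)) (m : ℕ)
  (U : Fin N → Finset (Fin K))

/-- Dependence on the first `ν` observations alone allows the later ones to be integrated out on any
event of the history. -/
theorem affectedHistory_properties {ν : ℕ} {B : Set (ℕ → ∀ k, 𝓧 k)}
    (hB : MeasurableSet[affectedHistory F G m (rrSample 𝒢 F U) ν] B) :
    MeasurableSet B ∧ DependsBefore ν B := by
  induction B, hB using MeasurableSpace.generateFrom_induction with
  | hC t ht _ =>
    obtain ⟨i, hi, E, hE, B, hB, rfl⟩ := ht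
    constructor
    · refine MeasurableSet.inter (s₁ := {ω | rrSample 𝒢 F U i ω = E})
        (s₂ := {ω | E.restrict (ω i) ∈ B}) ?_ ?_
      · have h1 : MeasurableSet {s : Fin N × ℝ | U s.1 = E} :=
          measurable_fst (MeasurableSet.of_discrete (s := {d : Fin N | U d = E}))
        exact measurable_rrState 𝒢 F U i h1
      · exact ((Finset.measurable_restrict E).comp (measurable_pi_apply i)) hB
    · intro ω j x hj
      change (U (rrState 𝒢 F U (Function.update ω j x) i).1 = E ∧
        E.restrict (Function.update ω j x i) ∈ B) ↔
        (U (rrState 𝒢 F U ω i).1 = E ∧ E.restrict (ω i) ∈ B)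
      rw [rrState_update 𝒢 F U ω (by omega), Function.update_of_ne (by omega)]
  | empty => exact ⟨MeasurableSet.empty, fun ω i x _ => Iff.rfl⟩
  | compl t _ ih => exact ⟨ih.1.compl, fun ω i x hi => not_congr (ih.2 ω i x hi)⟩
  | iUnion s _ ih =>
    refine ⟨MeasurableSet.iUnion fun n => (ih n).1, fun ω i x hi => ?_⟩
    simp only [Set.mem_iUnion]
    exact exists_congr fun n => (ih n).2 ω i x hi

theorem affectedHistory_le (ν : ℕ) :
    affectedHistory F G m (rrSample 𝒢 F U) ν ≤ MeasurableSpace.pi := fun _ hB =>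
  (affectedHistory_properties 𝒢 F G m U hB).1

/-- While an unaffected unit is sampled, nothing is added to the history. -/
theorem affectedHistory_localize {ν r : ℕ} (d : Fin N) (hd : U d ∉ affected F G m)
    {B : Set (ℕ → ∀ k, 𝓧 k)}
    (hB : MeasurableSet[affectedHistory F G m (rrSample 𝒢 F U) ν] B) :
    ∃ B' : Set (ℕ → ∀ k, 𝓧 k), MeasurableSet B' ∧ DependsBefore r B' ∧
      ∀ ω, (∀ i, r ≤ i → i < ν → (rrState 𝒢 F U ω i).1 = d) → (ω ∈ B ↔ ω ∈ B') := by
  induction B, hB using MeasurableSpace.generateFrom_induction with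
  | hC t ht _ =>
    obtain ⟨i, hi, E, hE, B, hB, rfl⟩ := ht
    rcases lt_or_ge i r with hir | hir
    · have h1 : MeasurableSet[affectedHistory F G m (rrSample 𝒢 F U) r]
          {ω | rrSample 𝒢 F U i ω = E ∧ E.restrict (ω i) ∈ B} :=
        MeasurableSpace.measurableSet_generateFrom ⟨i, hir, E, hE, B, hB, rfl⟩
      have h2 := affectedHistory_properties 𝒢 F G m U h1
      exact ⟨_, h2.1, h2.2, fun _ _ => Iff.rfl⟩
    -- A generator at a time `i ≥ r` asks for an affected unit, which the run at `d` excludes; there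
    -- it agrees with the empty set.
    · refine ⟨∅, MeasurableSet.empty, fun _ _ _ _ => Iff.rfl, fun ω hω => ?_⟩
      refine ⟨fun h => hd ?_, fun h => h.elim⟩
      have h1 : U (rrState 𝒢 F U ω i).1 = E := h.1
      rw [hω i hir hi] at h1
      rwa [h1]
  | empty => exact ⟨∅, MeasurableSet.empty, fun _ _ _ _ => Iff.rfl, fun _ _ => Iff.rfl⟩
  | compl t _ ih =>
    obtain ⟨B', h1, h2, h3⟩ := ih
    exact ⟨B'ᶜ, h1.compl, fun ω i x hi => not_congr (h2 ω i x hi),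
      fun ω hω => not_congr (h3 ω hω)⟩
  | iUnion s _ ih =>
    choose B' h1 h2 h3 using ih
    refine ⟨⋃ n, B' n, MeasurableSet.iUnion h1, fun ω i x hi => ?_, fun ω hω => ?_⟩
    · simp only [Set.mem_iUnion]
      exact exists_congr fun n => h2 n ω i x hi
    · simp only [Set.mem_iUnion]
      exact exists_congr fun n => h3 n ω hω

/-- The statistic stays in `(0, A)` at the times in `(r, n]`. -/
def rrRun (A : ℝ) (r n : ℕ) : Set (ℕ → ∀ k, 𝓧 k) :=
  {ω | ∀ k, r < k → k ≤ n → (rrState 𝒢 F U ω k).2 ∈ Set.Ioo 0 A}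

theorem measurableSet_rrRun (A : ℝ) (r n : ℕ) : MeasurableSet (rrRun 𝒢 F U A r n) := by
  have : rrRun 𝒢 F U A r n = ⋂ k ∈ Set.Ioc r n, {ω | (rrState 𝒢 F U ω k).2 ∈ Set.Ioo 0 A} := by
    ext ω
    simp [rrRun]
  rw [this]
  exact MeasurableSet.biInter (Set.to_countable _) fun k _ =>
    (measurable_snd.comp (measurable_rrState 𝒢 F U k)) measurableSet_Ioo

theorem dependsBefore_rrRun (A : ℝ) (r n : ℕ) : DependsBefore n (rrRun 𝒢 F U A r n) := by
  intro ω i x hi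
  refine forall_congr' fun k => forall_congr' fun _ => forall_congr' fun hk => ?_
  rw [rrState_update 𝒢 F U ω (hk.trans hi)]

theorem rrRun_succ (A : ℝ) {r n : ℕ} (h : r ≤ n) : rrRun 𝒢 F U A r (n + 1) =
    rrRun 𝒢 F U A r n ∩ {ω | (rrState 𝒢 F U ω (n + 1)).2 ∈ Set.Ioo 0 A} := by
  ext ω
  constructor
  · exact fun h' => ⟨fun k h1 h2 => h' k h1 (by omega), h' (n + 1) (by omega) le_rfl⟩
  · rintro ⟨h1, h2⟩ k hk1 hk2
    rcases hk2.lt_or_eq with h' | rfl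
    · exact h1 k hk1 (by omega)
    · exact h2

theorem rrState_fst_eq_of_pos (ω : ℕ → ∀ k, 𝓧 k) {r n : ℕ} (hrn : r ≤ n)
    (h : ∀ k, r < k → k ≤ n → 0 < (rrState 𝒢 F U ω k).2) :
    (rrState 𝒢 F U ω n).1 = (rrState 𝒢 F U ω r).1 := by
  induction n, hrn using Nat.le_induction with
  | base => rfl
  | succ n hn ih =>
    rw [← ih fun k h1 h2 => h k h1 (by omega)]
    have h1 := h (n + 1) (by omega) le_rfl
    rw [rrState_succ] at h1 ⊢
    simp only [rrNext] at h1 ⊢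
    rw [if_neg (not_le.2 h1)]

/-- During a run at a unit, the statistic is a killed random walk. -/
theorem setLIntegral_rrRun (μ : ℕ → Measure (∀ k, 𝓧 k)) [∀ i, IsProbabilityMeasure (μ i)]
    (A : ℝ) (r n : ℕ) (d : Fin N) (lam : Measure ℝ) [IsProbabilityMeasure lam]
    (hlam : ∀ i < r + n, xiLaw 𝒢 F (μ i) (U d) = lam) {C : Set (ℕ → ∀ k, 𝓧 k)}
    (hC : MeasurableSet C) (hCd : DependsBefore r C)
    (hCs : ∀ ω ∈ C, (rrState 𝒢 F U ω r).1 = d ∧ (rrState 𝒢 F U ω r).2 ≤ 0)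
    {g : ℝ → ℝ≥0∞} (hg : Measurable g) :
    ∫⁻ ω in C ∩ rrRun 𝒢 F U A r (r + n), g (max (rrState 𝒢 F U ω (r + n)).2 0)
      ∂Measure.infinitePi μ = Measure.infinitePi μ C * (killed lam (Set.Ioo 0 A))^[n] g 0 := by
  induction n generalizing g with
  | zero =>
    have h1 : C ∩ rrRun 𝒢 F U A r (r + 0) = C := by
      refine Set.inter_eq_left.2 fun ω _ k h1 h2 => ?_
      omega
    rw [h1, setLIntegral_congr_fun (g := fun _ => g 0) hC (fun ω hω => by
      simp only [add_zero]
      rw [max_eq_right (hCs ω hω).2]), setLIntegral_const, mul_comm]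
    rfl
  | succ n ih =>
    rw [Function.iterate_succ_apply, ← ih (fun i hi => hlam i (by omega))
      (measurable_killed lam measurableSet_Ioo hg)]
    have hm1 : MeasurableSet (C ∩ rrRun 𝒢 F U A r (r + n)) :=
      hC.inter (measurableSet_rrRun 𝒢 F U A r _)
    have hm2 : MeasurableSet (C ∩ rrRun 𝒢 F U A r (r + (n + 1))) :=
      hC.inter (measurableSet_rrRun 𝒢 F U A r _)
    set φ : Fin N × ℝ → ℝ≥0∞ := fun s => (Set.Ioo 0 A).indicator g s.2 with hφ
    have hφm : Measurable φ := (hg.indicator measurableSet_Ioo).comp measurable_snd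
    have h1 : ∫⁻ ω in C ∩ rrRun 𝒢 F U A r (r + (n + 1)),
        g (max (rrState 𝒢 F U ω (r + (n + 1))).2 0) ∂Measure.infinitePi μ =
        ∫⁻ ω in C ∩ rrRun 𝒢 F U A r (r + n), φ (rrState 𝒢 F U ω (r + n + 1))
          ∂Measure.infinitePi μ := by
      rw [← lintegral_indicator hm1, ← lintegral_indicator hm2]
      refine lintegral_congr fun ω => ?_
      rw [← add_assoc, rrRun_succ 𝒢 F U A (by omega), ← Set.inter_assoc]
      by_cases hω : ω ∈ C ∩ rrRun 𝒢 F U A r (r + n)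
      · rw [Set.indicator_of_mem hω]
        by_cases hω2 : (rrState 𝒢 F U ω (r + n + 1)).2 ∈ Set.Ioo 0 A
        · rw [Set.indicator_of_mem (show ω ∈ C ∩ rrRun 𝒢 F U A r (r + n) ∩
            {ω | (rrState 𝒢 F U ω (r + n + 1)).2 ∈ Set.Ioo 0 A} from ⟨hω, hω2⟩), hφ]
          simp only
          rw [Set.indicator_of_mem hω2, max_eq_left hω2.1.le]
        · rw [Set.indicator_of_notMem (fun h => hω2 h.2), hφ]
          simp only
          rw [Set.indicator_of_notMem hω2]
      · rw [Set.indicator_of_notMem hω, Set.indicator_of_notMem (fun h => hω h.1)]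
    rw [h1, setLIntegral_rrState_succ 𝒢 F U μ (r + n) hm1
      ((hCd.mono (by omega)).inter (dependsBefore_rrRun 𝒢 F U A r _)) hφm]
    refine setLIntegral_congr_fun hm1 fun ω hω => ?_
    have hfst : (rrState 𝒢 F U ω (r + n)).1 = d := by
      rw [rrState_fst_eq_of_pos 𝒢 F U ω (by omega : r ≤ r + n) fun k h1 h2 => (hω.2 k h1 h2).1]
      exact (hCs ω hω.1).1
    rw [hfst, hlam (r + n) (by omega)]
    rfl

/-- At the change-point, given that an unaffected unit is sampled, the statistic has bounded
conditional expectation given the history of the affected units. -/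
theorem setLIntegral_unaffected_le (μ : ℕ → Measure (∀ k, 𝓧 k)) [∀ i, IsProbabilityMeasure (μ i)]
    {A : ℝ} (ν : ℕ) (d : Fin N) (hd : U d ∉ affected F G m) (lam : Measure ℝ)
    [IsProbabilityMeasure lam] (hlam : ∀ i < ν, xiLaw 𝒢 F (μ i) (U d) = lam) {M : ℝ≥0∞}
    (hM : ∀ n, (killed lam (Set.Ioo 0 A))^[n] (fun y => ENNReal.ofReal y) 0 ≤
      M * (killed lam (Set.Ioo 0 A))^[n] 1 0)
    {B : Set (ℕ → ∀ k, 𝓧 k)}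
    (hB : MeasurableSet[affectedHistory F G m (rrSample 𝒢 F U) ν] B) :
    ∫⁻ ω in B ∩ rrAlive 𝒢 F U A ν ∩ {ω | (rrState 𝒢 F U ω ν).1 = d},
      ENNReal.ofReal (max (rrState 𝒢 F U ω ν).2 0) ∂Measure.infinitePi μ ≤
      M * Measure.infinitePi μ (B ∩ rrAlive 𝒢 F U A ν ∩ {ω | (rrState 𝒢 F U ω ν).1 = d}) := by
  set W : ℕ → Set (ℕ → ∀ k, 𝓧 k) := fun r =>
    rrAlive 𝒢 F U A r ∩ {ω | rrState 𝒢 F U ω r ∈ {s | s.1 = d ∧ s.2 ≤ 0}} with hW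
  set piece : ℕ → Set (ℕ → ∀ k, 𝓧 k) := fun r => B ∩ (W r ∩ rrRun 𝒢 F U A r ν) with hpiece
  have hBm := affectedHistory_properties 𝒢 F G m U hB
  have hS : MeasurableSet {s : Fin N × ℝ | s.1 = d ∧ s.2 ≤ 0} :=
    MeasurableSet.inter (s₁ := {s : Fin N × ℝ | s.1 = d}) (s₂ := {s : Fin N × ℝ | s.2 ≤ 0})
      (measurable_fst (measurableSet_singleton d)) (measurable_snd measurableSet_Iic)
  have hWm : ∀ r, MeasurableSet (W r) := fun r =>
    (measurableSet_rrAlive 𝒢 F U A r).inter (measurable_rrState 𝒢 F U r hS)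
  have hWd : ∀ r, DependsBefore r (W r) := fun r =>
    (dependsBefore_rrAlive 𝒢 F U A r).inter (dependsBefore_rrState 𝒢 F U r _)
  have hpm : ∀ r, MeasurableSet (piece r) := fun r =>
    hBm.1.inter ((hWm r).inter (measurableSet_rrRun 𝒢 F U A r ν))
  have hunion : B ∩ rrAlive 𝒢 F U A ν ∩ {ω | (rrState 𝒢 F U ω ν).1 = d} =
      ⋃ r ∈ Finset.range (ν + 1), piece r := by
    ext ω
    simp only [Set.mem_iUnion, Finset.mem_range, exists_prop]
    constructor
    · rintro ⟨⟨hωB, hωA⟩, hωd⟩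
      classical
      -- `r` is the start of the current run, the last time up to `ν` with statistic at most `0`;
      -- time `0` qualifies because the statistic starts at `0`.
      set r := Nat.findGreatest (fun k => (rrState 𝒢 F U ω k).2 ≤ 0) ν with hr
      have hr0 : (rrState 𝒢 F U ω r).2 ≤ 0 :=
        Nat.findGreatest_spec (P := fun k => (rrState 𝒢 F U ω k).2 ≤ 0) (Nat.zero_le ν) le_rfl
      have hrν : r ≤ ν := Nat.findGreatest_le ν
      have hpos : ∀ k, r < k → k ≤ ν → 0 < (rrState 𝒢 F U ω k).2 := fun k h1 h2 =>
        not_le.1 (Nat.findGreatest_is_greatest h1 h2)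
      have hfst := rrState_fst_eq_of_pos 𝒢 F U ω hrν hpos
      refine ⟨r, by omega, hωB, ⟨fun k h1 h2 => hωA k h1 (h2.trans hrν), ?_, hr0⟩,
        fun k h1 h2 => ⟨hpos k h1 h2, hωA k (by omega) h2⟩⟩
      rw [← hfst]
      exact hωd
    · rintro ⟨r, hr, hωB, ⟨hωA, hωd, hω0⟩, hrun⟩
      refine ⟨⟨hωB, fun k h1 h2 => ?_⟩, ?_⟩
      · rcases le_or_gt k r with h | h
        · exact hωA k h1 h
        · exact (hrun k h h2).2
      · change (rrState 𝒢 F U ω ν).1 = d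
        rw [rrState_fst_eq_of_pos 𝒢 F U ω (by omega : r ≤ ν) fun k h1 h2 => (hrun k h1 h2).1]
        exact hωd
  have hdisj : Set.PairwiseDisjoint (↑(Finset.range (ν + 1))) piece := by
    have aux : ∀ r r', r < r' → r' ≤ ν → ∀ ω, ω ∈ piece r → ω ∉ piece r' := by
      intro r r' h h' ω h1 h2
      have h3 := (h1.2.2 r' h h').1
      have h4 : (rrState 𝒢 F U ω r').2 ≤ 0 := h2.2.1.2.2
      linarith
    intro r hr r' hr' hne
    rw [Finset.coe_range, Set.mem_Iio] at hr hr'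
    rw [Function.onFun, Set.disjoint_left]
    intro ω h1 h2
    rcases lt_or_gt_of_ne hne with h | h
    · exact aux r r' h (by omega) ω h1 h2
    · exact aux r' r h (by omega) ω h2 h1
  rw [hunion, lintegral_biUnion_finset hdisj (fun r _ => hpm r),
    measure_biUnion_finset hdisj (fun r _ => hpm r), Finset.mul_sum]
  refine Finset.sum_le_sum fun r hr => ?_
  obtain ⟨n, rfl⟩ : ∃ n, ν = r + n := ⟨ν - r, by have := Finset.mem_range.1 hr; omega⟩
  -- On this piece the event of the history is decided before the run, so its mass factors out and a
  -- killed walk started at `0` remains.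
  obtain ⟨B', hB'm, hB'd, hB'⟩ := affectedHistory_localize 𝒢 F G m U (r := r) d hd hB
  have hp : piece r = (B' ∩ W r) ∩ rrRun 𝒢 F U A r (r + n) := by
    rw [hpiece, Set.inter_assoc B']
    ext ω
    refine and_congr_left fun hω => hB' ω fun i h1 h2 => ?_
    rw [rrState_fst_eq_of_pos 𝒢 F U ω h1 fun k h3 h4 => (hω.2 k h3 (by omega)).1]
    exact hω.1.2.1
  have hCm : MeasurableSet (B' ∩ W r) := hB'm.inter (hWm r)
  have hCd : DependsBefore r (B' ∩ W r) := hB'd.inter (hWd r)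
  have hrun := fun {g : ℝ → ℝ≥0∞} (hg : Measurable g) =>
    setLIntegral_rrRun 𝒢 F U μ A r n d lam hlam hCm hCd (fun ω hω => hω.2.2) hg
  have h1 := hrun (g := 1) measurable_one
  simp only [Pi.one_apply, setLIntegral_one] at h1
  rw [hp, hrun (g := fun y => ENNReal.ofReal y) (by fun_prop), h1, mul_left_comm]
  exact mul_le_mul' le_rfl (hM n)

/-- The bound for the worst-case delay that a potential provides. -/
theorem worstDelay_le [IsProbabilityMeasure F] [IsProbabilityMeasure G] {A : ℝ} (hA : 0 < A)
    (Ψ : Fin N → ℝ → ℝ≥0∞) (hΨ : ∀ d, Measurable (Ψ d))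
    (hstep : ∀ d y, 0 ≤ y → y < A →
      ∫⁻ u, (if A ≤ y + u then 0 else if y + u ≤ 0 then Ψ (d + 1) 0 else Ψ d (y + u))
        ∂xiLaw 𝒢 F G (U d) + 1 ≤ Ψ d y)
    {R : ℝ≥0∞} (haff : ∀ d, U d ∈ affected F G m → ∀ y, 0 ≤ y → y < A → Ψ d y ≤ R)
    (hunaff : ∀ d, U d ∉ affected F G m → ∃ v κ M : ℝ≥0∞,
      (∀ y, 0 ≤ y → y < A → Ψ d y ≤ v + κ * ENNReal.ofReal y) ∧
      (∀ n, (killed (xiLaw 𝒢 F F (U d)) (Set.Ioo 0 A))^[n] (fun y => ENNReal.ofReal y) 0 ≤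
        M * (killed (xiLaw 𝒢 F F (U d)) (Set.Ioo 0 A))^[n] 1 0) ∧ v + κ * M ≤ R) :
    worstDelay F G m (rrSample 𝒢 F U) (rrStop 𝒢 F U A) ≤ R := by
  refine iSup_le fun ν => ?_
  set μ : ℕ → Measure (∀ k, 𝓧 k) := fun i => if i < ν then F else G with hμ
  have hμp : ∀ i, IsProbabilityMeasure (μ i) := fun i => by
    simp only [hμ]
    split_ifs <;> infer_instance
  have hP : changeLaw F G ν = Measure.infinitePi μ := rfl
  have hset : {ω | (ν : ℕ∞) < rrStop 𝒢 F U A ω} = rrAlive 𝒢 F U A ν := by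
    ext ω
    exact lt_rrStop_iff 𝒢 F U A ν ω
  rw [hP, hset]
  have hAm := measurableSet_rrAlive 𝒢 F U A ν
  refine essSup_condLExp_le (affectedHistory_le 𝒢 F G m U ν) _ _ R fun B hB => ?_
  obtain ⟨hBm, hBd⟩ := affectedHistory_properties 𝒢 F G m U hB
  rw [cond_apply hAm, ProbabilityTheory.cond, Measure.restrict_smul, lintegral_smul_measure,
    Measure.restrict_restrict hBm, setLIntegral_rrStop_sub, smul_eq_mul, mul_left_comm]
  refine mul_le_mul' le_rfl ?_
  rw [Set.inter_comm (rrAlive 𝒢 F U A ν) B]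
  have h1 : ∀ m, B ∩ rrAlive 𝒢 F U A ν ∩ rrAlive 𝒢 F U A (ν + m) =
      B ∩ rrAlive 𝒢 F U A (ν + m) := by
    intro m
    rw [Set.inter_assoc]
    congr 1
    exact Set.inter_eq_right.2 fun ω hω k h1 h2 => hω k h1 (by omega)
  simp_rw [h1]
  refine (sum_measure_alive_le 𝒢 F U μ A ν Ψ hΨ hA (fun d y n hn hy hyA => ?_) hBm hBd).trans ?_
  · have : μ n = G := by simp only [hμ]; rw [if_neg (by omega)]
    rw [this]
    exact hstep d y hy hyA
  -- split according to the sampled unit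
  set D : Fin N → Set (ℕ → ∀ k, 𝓧 k) := fun d => {ω | (rrState 𝒢 F U ω ν).1 = d} with hD
  have hDm : ∀ d, MeasurableSet (D d) := fun d =>
    (measurable_fst.comp (measurable_rrState 𝒢 F U ν)) (measurableSet_singleton d)
  have hunion : B ∩ rrAlive 𝒢 F U A ν =
      ⋃ d ∈ (Finset.univ : Finset (Fin N)), B ∩ rrAlive 𝒢 F U A ν ∩ D d := by
    ext ω
    simp [hD]
  have hdisj : Set.PairwiseDisjoint (↑(Finset.univ : Finset (Fin N)))
      (fun d => B ∩ rrAlive 𝒢 F U A ν ∩ D d) := by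
    intro d _ d' _ hne
    rw [Function.onFun, Set.disjoint_left]
    intro ω h1 h2
    exact hne ((show (rrState 𝒢 F U ω ν).1 = d from h1.2).symm.trans h2.2)
  have hpm : ∀ d, MeasurableSet (B ∩ rrAlive 𝒢 F U A ν ∩ D d) := fun d =>
    (hBm.inter hAm).inter (hDm d)
  rw [hunion, lintegral_biUnion_finset hdisj (fun d _ => hpm d),
    measure_biUnion_finset hdisj (fun d _ => hpm d), Finset.mul_sum]
  have hrange : ∀ ω ∈ rrAlive 𝒢 F U A ν, max (rrState 𝒢 F U ω ν).2 0 < A := by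
    intro ω hω
    refine max_lt ?_ hA
    rcases Nat.eq_zero_or_pos ν with h0 | h0
    · rw [h0]; exact hA
    · exact hω _ h0 le_rfl
  refine Finset.sum_le_sum fun d _ => ?_
  by_cases hd : U d ∈ affected F G m
  · refine (setLIntegral_mono measurable_const fun ω hω => ?_).trans
      (setLIntegral_const _ R).le
    have h2 : (rrState 𝒢 F U ω ν).1 = d := hω.2
    rw [h2]
    exact haff d hd _ (le_max_right _ _) (hrange ω hω.1.2)
  · obtain ⟨v, κ, M, hle, hM, hR⟩ := hunaff d hd
    have hYm : Measurable fun ω : ℕ → ∀ k, 𝓧 k => ENNReal.ofReal (max (rrState 𝒢 F U ω ν).2 0) :=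
      ((measurable_snd.comp (measurable_rrState 𝒢 F U ν)).max measurable_const).ennreal_ofReal
    have h3 : ∫⁻ ω in B ∩ rrAlive 𝒢 F U A ν ∩ D d,
        Ψ (rrState 𝒢 F U ω ν).1 (max (rrState 𝒢 F U ω ν).2 0) ∂Measure.infinitePi μ ≤
        ∫⁻ ω in B ∩ rrAlive 𝒢 F U A ν ∩ D d,
          (v + κ * ENNReal.ofReal (max (rrState 𝒢 F U ω ν).2 0)) ∂Measure.infinitePi μ := by
      refine setLIntegral_mono (measurable_const.add (hYm.const_mul κ)) fun ω hω => ?_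
      have h2 : (rrState 𝒢 F U ω ν).1 = d := hω.2
      rw [h2]
      exact hle _ (le_max_right _ _) (hrange ω hω.1.2)
    have h4 := setLIntegral_unaffected_le 𝒢 F G m U μ ν d hd (xiLaw 𝒢 F F (U d))
      (fun i hi => by simp only [hμ]; rw [if_pos hi]) hM hB
    refine h3.trans ?_
    rw [lintegral_add_left measurable_const, lintegral_const_mul κ hYm, setLIntegral_const]
    calc v * Measure.infinitePi μ (B ∩ rrAlive 𝒢 F U A ν ∩ D d) +
          κ * ∫⁻ ω in B ∩ rrAlive 𝒢 F U A ν ∩ D d,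
            ENNReal.ofReal (max (rrState 𝒢 F U ω ν).2 0) ∂Measure.infinitePi μ
        ≤ v * Measure.infinitePi μ (B ∩ rrAlive 𝒢 F U A ν ∩ D d) +
          κ * (M * Measure.infinitePi μ (B ∩ rrAlive 𝒢 F U A ν ∩ D d)) :=
          add_le_add le_rfl (mul_le_mul' le_rfl h4)
      _ = (v + κ * M) * Measure.infinitePi μ (B ∩ rrAlive 𝒢 F U A ν ∩ D d) := by ring
      _ ≤ _ := mul_le_mul' hR le_rfl

end History

/-! ### Likelihood ratios, mixtures and the overshoot constant -/

section LogLikelihood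

variable {α : Type*} [MeasurableSpace α]

theorem rnDeriv_ae_eq_ofReal_exp_llr (H F : Measure α) [SigmaFinite H] [SigmaFinite F]
    (hFH : F ≪ H) :
    (fun x => H.rnDeriv F x) =ᵐ[F] fun x => ENNReal.ofReal (Real.exp (llr H F x)) := by
  filter_upwards [exp_llr_of_ac' H F hFH, H.rnDeriv_lt_top F] with x hx hx2
  rw [hx, ENNReal.ofReal_toReal hx2.ne]

/-- This exponential moment is what makes a centering tilt possible for the walk of an unaffected
unit. -/
theorem lintegral_exp_llr (H F : Measure α) [IsProbabilityMeasure H] [IsProbabilityMeasure F]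
    (hHF : H ≪ F) (hFH : F ≪ H) : ∫⁻ x, ENNReal.ofReal (Real.exp (llr H F x)) ∂F = 1 := by
  rw [← lintegral_congr_ae (rnDeriv_ae_eq_ofReal_exp_llr H F hFH),
    Measure.lintegral_rnDeriv hHF, measure_univ]

theorem lintegral_exp_neg_mul_llr (H F G : Measure α) [SigmaFinite H] [SigmaFinite F]
    (hFH : F ≪ H) (hGF : G ≪ F) (t : ℝ) :
    ∫⁻ x, ENNReal.ofReal (Real.exp (-t * llr H F x)) ∂G =
      ∫⁻ x, (H.rnDeriv F x) ^ (-t) ∂G := by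
  refine lintegral_congr_ae ?_
  filter_upwards [hGF.ae_le (rnDeriv_ae_eq_ofReal_exp_llr H F hFH)] with x hx
  rw [hx, ENNReal.ofReal_rpow_of_pos (Real.exp_pos _), ← Real.exp_mul, mul_comm]

end LogLikelihood

section Units

variable {K : ℕ} {𝓧 : Fin K → Type*} [∀ k, MeasurableSpace (𝓧 k)]
  {𝒢 : Set (Measure (∀ k, 𝓧 k))} {F G : Measure (∀ k, 𝓧 k)} {m : ℕ} {E : Finset (Fin K)}

theorem mixture_properties [IsProbabilityMeasure F] (h𝒢 : ∀ P ∈ 𝒢, IsProbabilityMeasure P)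
    (h_ac : ∀ P ∈ 𝒢, ∀ E ∈ affected F P m,
      localLaw P E ≪ localLaw F E ∧ localLaw F E ≪ localLaw P E)
    (hE : E.card = m) (hne : (localFamily 𝒢 F E).Nonempty) (hfin : (localFamily 𝒢 F E).Finite) :
    IsProbabilityMeasure (mixture 𝒢 F E) ∧ mixture 𝒢 F E ≪ localLaw F E ∧
      localLaw F E ≪ mixture 𝒢 F E := by
  have hfam : ∀ P ∈ localFamily 𝒢 F E, IsProbabilityMeasure P ∧ P ≪ localLaw F E ∧
      localLaw F E ≪ P := by
    rintro P ⟨G', hG', rfl, hG'2⟩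
    have := h𝒢 G' hG'
    exact ⟨inferInstance, h_ac G' hG' E ⟨hE, hG'2⟩⟩
  have hcard : ((localFamily 𝒢 F E).ncard : ℝ≥0∞) ≠ 0 := by
    rw [Nat.cast_ne_zero]
    exact (Set.ncard_pos hfin).2 hne |>.ne'
  refine ⟨⟨?_⟩, ?_, ?_⟩
  · have : Fintype (localFamily 𝒢 F E) := hfin.fintype
    rw [mixture, Measure.smul_apply, Measure.sum_apply _ MeasurableSet.univ, tsum_fintype]
    have h1 : ∀ P : localFamily 𝒢 F E, (P : Measure (∀ k : E, 𝓧 k)) Set.univ = 1 := fun P => by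
      have := (hfam P P.2).1
      exact measure_univ
    simp only [h1, Finset.sum_const, Finset.card_univ, nsmul_eq_mul, mul_one, smul_eq_mul]
    rw [← Nat.card_eq_fintype_card, Nat.card_coe_set_eq]
    exact ENNReal.inv_mul_cancel hcard (ENNReal.natCast_ne_top _)
  · refine Measure.smul_absolutelyContinuous.trans ?_
    exact Measure.absolutelyContinuous_sum_left fun P => (hfam P P.2).2.1
  · obtain ⟨P, hP⟩ := hne
    have h1 : P ≪ Measure.sum fun P : localFamily 𝒢 F E => (P : Measure (∀ k : E, 𝓧 k)) :=
      Measure.absolutelyContinuous_sum_right (⟨P, hP⟩ : localFamily 𝒢 F E)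
        (show P ≪ P from Measure.AbsolutelyContinuous.rfl)
    refine ((hfam P hP).2.2.trans h1).trans ?_
    exact Measure.absolutelyContinuous_smul (ENNReal.inv_ne_zero.2 (ENNReal.natCast_ne_top _))

theorem xiLaw_eq_of_unaffected (hE : E.card = m) (h : E ∉ affected F G m) :
    xiLaw 𝒢 F G E = xiLaw 𝒢 F F E := by
  have : localLaw G E = localLaw F E := by
    by_contra hne
    exact h ⟨hE, hne⟩
  rw [xiLaw, xiLaw, this]

/-- Supplies the hypotheses of `exists_killed_mean_le`; the sign changes because `Jinf` uses the
inverse likelihood ratio. -/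
theorem xiLaw_preChange [IsProbabilityMeasure F] [IsProbabilityMeasure (mixture 𝒢 F E)]
    (hHF : mixture 𝒢 F E ≪ localLaw F E) (hFH : localLaw F E ≪ mixture 𝒢 F E)
    (hint : Integrable (llr (localLaw F E) (mixture 𝒢 F E)) (localLaw F E))
    (hJ : 0 < Jinf 𝒢 F E) :
    Integrable id (xiLaw 𝒢 F F E) ∧ ∫ u, u ∂xiLaw 𝒢 F F E < 0 ∧
      ∫⁻ u, ENNReal.ofReal (Real.exp u) ∂xiLaw 𝒢 F F E = 1 := by
  have hm := measurable_xi 𝒢 F E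
  have hneg : (fun x => -llr (localLaw F E) (mixture 𝒢 F E) x) =ᵐ[localLaw F E] xi 𝒢 F E :=
    neg_llr hFH
  refine ⟨?_, ?_, ?_⟩
  · rw [xiLaw, integrable_map_measure measurable_id.aestronglyMeasurable hm.aemeasurable]
    exact hint.neg.congr hneg
  · rw [xiLaw, integral_map hm.aemeasurable (by fun_prop),
      ← integral_congr_ae hneg, integral_neg]
    exact neg_lt_zero.2 hJ
  · rw [xiLaw, lintegral_map (by fun_prop) hm]
    exact lintegral_exp_llr _ _ hHF hFH

theorem xiLaw_postChange [IsProbabilityMeasure G]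
    (hvar : Integrable (fun x => (xi 𝒢 F E x - J0 𝒢 F G E) ^ 2) (localLaw G E)) :
    MemLp id 2 (xiLaw 𝒢 F G E) ∧ ∫ u, u ∂xiLaw 𝒢 F G E = J0 𝒢 F G E := by
  have hm := measurable_xi 𝒢 F E
  constructor
  · rw [xiLaw, memLp_map_measure_iff measurable_id.aestronglyMeasurable hm.aemeasurable]
    have h1 : MemLp (fun x => xi 𝒢 F E x - J0 𝒢 F G E) 2 (localLaw G E) :=
      (memLp_two_iff_integrable_sq (by fun_prop)).2 hvar
    have h2 := h1.add (memLp_const (J0 𝒢 F G E))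
    refine h2.congr_norm hm.aestronglyMeasurable (ae_of_all _ fun x => ?_)
    simp
  · rw [xiLaw, integral_map hm.aemeasurable (by fun_prop)]
    rfl

theorem isRoot_root (h : ∃! t : ℝ, IsRoot 𝒢 F G E t) : IsRoot 𝒢 F G E (root 𝒢 F G E) := by
  obtain ⟨t, ht, hu⟩ := h
  have : {t : ℝ | IsRoot 𝒢 F G E t} = {t} := by
    ext s
    exact ⟨fun hs => hu s hs, fun hs => by rw [Set.mem_singleton_iff.1 hs]; exact ht⟩
  rw [root, this, csInf_singleton]
  exact ht

theorem lintegral_exp_root [IsProbabilityMeasure F] [IsProbabilityMeasure (mixture 𝒢 F E)]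
    (hFH : localLaw F E ≪ mixture 𝒢 F E) (hGF : localLaw G E ≪ localLaw F E)
    (h : ∃! t : ℝ, IsRoot 𝒢 F G E t) :
    ∫⁻ u, ENNReal.ofReal (Real.exp (-root 𝒢 F G E * u)) ∂xiLaw 𝒢 F G E = 1 := by
  rw [xiLaw, lintegral_map (by fun_prop) (measurable_xi 𝒢 F E)]
  exact (lintegral_exp_neg_mul_llr _ _ _ hFH hGF _).trans (isRoot_root h).2

end Units

/-- The conditional expectations that define the overshoot constant are bounded. -/
theorem exists_condExp_exp_le (lam : Measure ℝ) [IsProbabilityMeasure lam] {t : ℝ} (ht : 0 < t)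
    (hroot : ∫⁻ u, ENNReal.ofReal (Real.exp (-t * u)) ∂lam = 1) (A : ℝ) :
    ∃ B : ℝ, 0 ≤ B ∧ ∀ r, 0 ≤ r → r < A →
      ∫ u in {u | u ≤ -r}, Real.exp (-t * (u + r)) ∂lam ≤ B * lam.real {u | u ≤ -r} := by
  have hintexp : Integrable (fun u => Real.exp (-t * u)) lam := by
    refine ⟨by fun_prop, ?_⟩
    rw [hasFiniteIntegral_iff_ofReal (ae_of_all _ fun u => (Real.exp_pos _).le), hroot]
    exact ENNReal.one_lt_top
  have hval : ∫ u, Real.exp (-t * u) ∂lam = 1 := by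
    rw [integral_eq_lintegral_of_nonneg_ae (ae_of_all _ fun u => (Real.exp_pos _).le)
      (by fun_prop), hroot, ENNReal.toReal_one]
  have hfac : ∀ r u : ℝ, Real.exp (-t * (u + r)) = Real.exp (-t * r) * Real.exp (-t * u) :=
    fun r u => by rw [← Real.exp_add]; ring_nf
  have hintr : ∀ r, Integrable (fun u => Real.exp (-t * (u + r))) lam := fun r => by
    simp_rw [hfac]
    exact hintexp.const_mul _
  -- If `u ≤ -A` has positive probability, dividing the unit exponential moment by it bounds all
  -- levels at once. Otherwise `u > -A` almost surely and the exponential itself is at most `exp (t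
  -- * A)`.
  rcases (measureReal_nonneg (μ := lam) (s := {u : ℝ | u ≤ -A})).lt_or_eq with hpos | hzero
  · refine ⟨(lam.real {u : ℝ | u ≤ -A})⁻¹, by positivity, fun r hr hrA => ?_⟩
    have h1 : ∫ u in {u | u ≤ -r}, Real.exp (-t * (u + r)) ∂lam ≤ 1 := by
      calc ∫ u in {u | u ≤ -r}, Real.exp (-t * (u + r)) ∂lam
          ≤ ∫ u, Real.exp (-t * (u + r)) ∂lam :=
            setIntegral_le_integral (hintr r) (ae_of_all _ fun u => (Real.exp_pos _).le)
        _ = Real.exp (-t * r) := by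
            simp_rw [hfac]
            rw [integral_const_mul, hval, mul_one]
        _ ≤ 1 := Real.exp_le_one_iff.2 (by nlinarith)
    refine h1.trans ?_
    rw [← inv_mul_cancel₀ hpos.ne']
    refine mul_le_mul_of_nonneg_left ?_ (by positivity)
    exact measureReal_mono fun u (hu : u ≤ -A) => (by linarith : u ≤ -r)
  · refine ⟨Real.exp (t * A), (Real.exp_pos _).le, fun r hr hrA => ?_⟩
    have hae : ∀ᵐ u ∂lam, -A < u := by
      have : lam {u : ℝ | u ≤ -A} = 0 := (measureReal_eq_zero_iff).1 hzero.symm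
      rw [ae_iff]
      simpa only [not_lt] using this
    calc ∫ u in {u | u ≤ -r}, Real.exp (-t * (u + r)) ∂lam
        ≤ ∫ u in {u | u ≤ -r}, Real.exp (t * A) ∂lam := by
          refine integral_mono_ae (hintr r).integrableOn (integrable_const _) ?_
          filter_upwards [ae_restrict_of_ae hae] with u hu
          refine Real.exp_le_exp.2 ?_
          nlinarith
      _ = Real.exp (t * A) * lam.real {u | u ≤ -r} := by
          rw [setIntegral_const, smul_eq_mul, mul_comm]

section Overshoot

variable {K : ℕ} {𝓧 : Fin K → Type*} [∀ k, MeasurableSpace (𝓧 k)]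
  {𝒢 : Set (Measure (∀ k, 𝓧 k))} {F G : Measure (∀ k, 𝓧 k)} {E : Finset (Fin K)}

/-- The real supremum dominates its terms only if they are bounded above, which
`exists_condExp_exp_le` ensures. Conditions of probability zero contribute `0`, and the level `r =
0` already gives at least `1`. -/
theorem overshoot_properties [IsProbabilityMeasure F] [IsProbabilityMeasure G]
    (ht : 0 < root 𝒢 F G E)
    (hroot : ∫⁻ u, ENNReal.ofReal (Real.exp (-root 𝒢 F G E * u)) ∂xiLaw 𝒢 F G E = 1)
    (hπ : 0 < (xiLaw 𝒢 F G E).real (Set.Iic 0)) {A : ℝ} (hA : 0 < A) :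
    1 ≤ overshoot 𝒢 F G E A ∧ ∀ r, 0 ≤ r → r < A →
      ∫ u in {u | u ≤ -r}, Real.exp (-root 𝒢 F G E * (u + r)) ∂xiLaw 𝒢 F G E ≤
        overshoot 𝒢 F G E A * (xiLaw 𝒢 F G E).real {u | u ≤ -r} := by
  set t := root 𝒢 F G E with htdef
  set lam := xiLaw 𝒢 F G E with hlam
  have hm := measurable_xi 𝒢 F E
  have hs : ∀ r : ℝ, MeasurableSet {u : ℝ | u ≤ -r} := fun r => measurableSet_Iic
  have hterm : ∀ r, ∫ x, Real.exp (-t * (xi 𝒢 F E x + r))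
      ∂(cond (localLaw G E) {x | xi 𝒢 F E x ≤ -r}) =
      (lam.real {u | u ≤ -r})⁻¹ * ∫ u in {u | u ≤ -r}, Real.exp (-t * (u + r)) ∂lam := fun r => by
    rw [ProbabilityTheory.cond, integral_smul_measure, hlam, xiLaw,
      setIntegral_map (hs r) (by fun_prop) hm.aemeasurable, smul_eq_mul, ENNReal.toReal_inv,
      measureReal_def, Measure.map_apply hm (hs r)]
    rfl
  have hzero : ∀ r, lam.real {u | u ≤ -r} = 0 →
      ∫ u in {u | u ≤ -r}, Real.exp (-t * (u + r)) ∂lam = 0 := fun r hr => by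
    rw [Measure.restrict_eq_zero.2 ((measureReal_eq_zero_iff).1 hr), integral_zero_measure]
  obtain ⟨B, hB0, hB⟩ := exists_condExp_exp_le lam ht hroot A
  have hbdd : BddAbove (Set.range fun r : Set.Ico (0 : ℝ) A =>
      ∫ x, Real.exp (-t * (xi 𝒢 F E x + r))
        ∂(cond (localLaw G E) {x | xi 𝒢 F E x ≤ -(r : ℝ)})) := by
    refine ⟨B, ?_⟩
    rintro _ ⟨r, rfl⟩
    simp only
    rw [hterm]
    rcases (measureReal_nonneg (μ := lam) (s := {u : ℝ | u ≤ -(r : ℝ)})).lt_or_eq with hp | hp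
    · rw [inv_mul_le_iff₀ hp, mul_comm]
      exact hB r r.2.1 r.2.2
    · rw [← hp, inv_zero, zero_mul]
      exact hB0
  have hle : ∀ r, 0 ≤ r → r < A →
      (lam.real {u | u ≤ -r})⁻¹ * ∫ u in {u | u ≤ -r}, Real.exp (-t * (u + r)) ∂lam ≤
        overshoot 𝒢 F G E A := fun r hr hrA => by
    rw [← hterm]
    exact le_ciSup hbdd (⟨r, hr, hrA⟩ : Set.Ico (0 : ℝ) A)
  refine ⟨?_, fun r hr hrA => ?_⟩
  · refine le_trans ?_ (hle 0 le_rfl hA)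
    have hπ' : 0 < lam.real {u : ℝ | u ≤ -0} := by rw [neg_zero]; exact hπ
    rw [le_inv_mul_iff₀ hπ', mul_one]
    have hint : Integrable (fun u => Real.exp (-t * (u + 0))) lam := by
      simp_rw [add_zero]
      refine ⟨by fun_prop, ?_⟩
      rw [hasFiniteIntegral_iff_ofReal (ae_of_all _ fun u => (Real.exp_pos _).le), hroot]
      exact ENNReal.one_lt_top
    calc lam.real {u : ℝ | u ≤ -0} = ∫ u in {u : ℝ | u ≤ -0}, (1 : ℝ) ∂lam := by
          rw [setIntegral_const, smul_eq_mul, mul_one]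
      _ ≤ _ := by
          refine setIntegral_mono_on (integrable_const _) hint.integrableOn (hs 0) ?_
          intro u (hu : u ≤ -0)
          rw [neg_zero] at hu
          exact Real.one_le_exp (by nlinarith)
  · rcases (measureReal_nonneg (μ := lam) (s := {u : ℝ | u ≤ -r})).lt_or_eq with hp | hp
    · have := hle r hr hrA
      rwa [inv_mul_le_iff₀ hp, mul_comm] at this
    · rw [hzero r hp.symm, ← hp, mul_zero]

end Overshoot

/-! ### Closing the potentials around the cycle of units -/

section Levels

/-- The one-step potential of a unit whose walk has positive drift, when the potential at the exit
from below is `A * b + c`. -/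
theorem exists_affected_potential (lam : Measure ℝ) [IsProbabilityMeasure lam]
    (hL2 : MemLp id 2 lam) {J t : ℝ} (hJ : 0 < J) (hmean : ∫ u, u ∂lam = J) (ht : 0 < t)
    (hroot : ∫⁻ u, ENNReal.ofReal (Real.exp (-t * u)) ∂lam = 1) :
    ∃ C π p : ℝ, 0 ≤ C ∧ 0 < π ∧ π ≤ p ∧ p < 1 ∧ ∀ A ω b c : ℝ, 0 < A → 1 ≤ ω →
      (∀ r, 0 ≤ r → r < A →
        ∫ u in {u | u ≤ -r}, Real.exp (-t * (u + r)) ∂lam ≤ ω * lam.real {u | u ≤ -r}) →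
      0 ≤ b → 0 ≤ c → ∃ Ψ : ℝ → ℝ≥0∞, Measurable Ψ ∧
        (∀ y, 0 ≤ y → y < A → ∫⁻ u, (if A ≤ y + u then 0 else
          if y + u ≤ 0 then ENNReal.ofReal (A * b + c) else Ψ (y + u)) ∂lam + 1 ≤ Ψ y) ∧
        Ψ 0 ≤ ENNReal.ofReal
          (A * max ((1 - π) * J⁻¹ + π * b) ((1 - p) * J⁻¹ + p * b) + C + p * c) ∧
        (∀ y, 0 ≤ y → y < A → Ψ y ≤ ENNReal.ofReal (A * max J⁻¹ b + C + c)) ∧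
        (b ≤ J⁻¹ → ∀ y, 0 ≤ y → y < A → Ψ y ≤ ENNReal.ofReal ((A - y) * J⁻¹ -
          A * (J⁻¹ - b) * ((Real.exp (-t * y) - Real.exp (-t * A)) / ω) + C + c)) := by
  obtain ⟨C, f, hC, hfm, hf, hfi⟩ := exists_passage_potential lam hL2 hJ hmean
  obtain ⟨hπ, hp1, hπp⟩ := exit_zero_bounds lam ht (hL2.integrable (by norm_num))
    (by rw [hmean]; exact hJ) hroot
  set π := lam.real (Set.Iic 0) with hπdef
  set p := ∫ u, min 1 (Real.exp (-t * u)) ∂lam with hpdef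
  refine ⟨C, π, p, hC, hπ, hπp, hp1, fun A ω b c hA hω hωr hb hc => ?_⟩
  have hω0 : 0 < ω := by linarith
  have hp0 : 0 < p := hπ.trans_le hπp
  set a := J⁻¹ with ha
  have ha0 : 0 < a := inv_pos.2 hJ
  -- To first order, leaving from below replaces `A * a` by `A * b`. If this is a cost, the exit
  -- probability must be bounded from above; if it is a saving, from below. One of `α` and `β` is
  -- zero.
  set α := A * max (b - a) 0 with hα
  set β := A * max (a - b) 0 with hβ
  have hα0 : 0 ≤ α := by positivity
  have hβ0 : 0 ≤ β := by positivity
  have hαβ : α - β = A * (b - a) := by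
    rcases le_total a b with h | h
    · rw [hα, hβ, max_eq_left (by linarith), max_eq_right (by linarith)]; ring
    · rw [hα, hβ, max_eq_right (by linarith), max_eq_left (by linarith)]; ring
  have hf' : ∀ y, 0 ≤ y → y < A → f (A - y) ≤ (A - y) * a + C := fun y hy hyA => by
    have := (hf (A - y) (by linarith)).2
    rwa [div_eq_mul_inv] at this
  have hup : ∀ y, 0 ≤ y → exitUpper t p y ≤ 1 ∧ 0 ≤ exitUpper t p y := fun y hy => by
    rw [exitUpper]
    split_ifs with h
    · exact ⟨hp1.le, hp0.le⟩
    · exact ⟨Real.exp_le_one_iff.2 (by nlinarith), (Real.exp_pos _).le⟩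
  have hlow : ∀ y, 0 ≤ y → (Real.exp (-t * y) - Real.exp (-t * A)) / ω ≤ exitLower A t ω π y := by
    intro y hy
    rw [exitLower]
    split_ifs with h
    · rw [le_antisymm h hy, mul_zero, Real.exp_zero]
      exact le_max_right _ _
    · exact le_rfl
  have hdiff : ∀ y, 0 ≤ y → y < A →
      0 ≤ (Real.exp (-t * y) - Real.exp (-t * A)) / ω := fun y hy hyA => by
    refine div_nonneg (sub_nonneg.2 (Real.exp_le_exp.2 ?_)) hω0.le
    nlinarith
  refine ⟨fun y => ENNReal.ofReal (f (A - y) + (α + c) * exitUpper t p y -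
    β * exitLower A t ω π y), ?_, ?_, ?_, ?_, ?_⟩
  · have h1 := measurable_exitUpper t p
    have h2 := measurable_exitLower A t ω π
    fun_prop
  · intro y hy hyA
    have hβA : β ≤ A / J := by
      rw [hβ, div_eq_mul_inv]
      exact mul_le_mul_of_nonneg_left (max_le (by linarith) ha0.le) hA.le
    have hvle : A * b + c ≤ A / J + α - β + c := by
      rw [div_eq_mul_inv, ← ha]
      linarith [mul_sub A b a]
    have h := affected_step lam (c := c) (v := A * b + c) hJ ht hA (fun b hb => (hf b hb).1) hfi
      hroot hω hωr hα0 hβ0 hβA hc (by positivity) hvle hy hyA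
    refine le_trans (le_of_eq ?_) h
    congr 1
    refine lintegral_congr fun u => ?_
    split_ifs <;> rfl
  · refine ENNReal.ofReal_le_ofReal ?_
    have hu0 : exitUpper t p 0 = p := if_pos le_rfl
    have hl0 : π ≤ exitLower A t ω π 0 := by
      rw [exitLower, if_pos le_rfl]
      exact le_max_left _ _
    have h1 := hf' 0 le_rfl hA
    rw [hu0]
    have h2 : β * π ≤ β * exitLower A t ω π 0 := mul_le_mul_of_nonneg_left hl0 hβ0
    rcases le_total a b with h | h
    · have hβz : β = 0 := by rw [hβ, max_eq_right (by linarith), mul_zero]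
      have hαz : α = A * (b - a) := by linarith
      have h3 := mul_le_mul_of_nonneg_left
        (le_max_right ((1 - π) * a + π * b) ((1 - p) * a + p * b)) hA.le
      rw [hαz, hβz]
      rw [sub_zero] at h1 ⊢
      nlinarith
    · have hαz : α = 0 := by rw [hα, max_eq_right (by linarith), mul_zero]
      have hβz : β = A * (a - b) := by linarith
      have h3 := mul_le_mul_of_nonneg_left
        (le_max_left ((1 - π) * a + π * b) ((1 - p) * a + p * b)) hA.le
      rw [hαz]
      rw [hβz] at h2 ⊢
      rw [sub_zero] at h1 ⊢
      nlinarith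
  · intro y hy hyA
    refine ENNReal.ofReal_le_ofReal ?_
    have h1 := hf' y hy hyA
    have h2 : (α + c) * exitUpper t p y ≤ (α + c) * 1 :=
      mul_le_mul_of_nonneg_left (hup y hy).1 (by positivity)
    have h3 : 0 ≤ β * exitLower A t ω π y :=
      mul_nonneg hβ0 ((hdiff y hy hyA).trans (hlow y hy))
    have h4 : A * max a b = A * a + α := by
      rw [hα, ← mul_add]
      congr 1
      rcases le_total a b with h | h
      · rw [max_eq_right h, max_eq_left (by linarith)]; ring
      · rw [max_eq_left h, max_eq_right (by linarith)]; ring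
    rw [h4]
    nlinarith
  · intro hba y hy hyA
    refine ENNReal.ofReal_le_ofReal ?_
    have h1 := hf' y hy hyA
    have hαz : α = 0 := by rw [hα, max_eq_right (by linarith), mul_zero]
    have hβz : β = A * (a - b) := by linarith
    have h2 : c * exitUpper t p y ≤ c * 1 := mul_le_mul_of_nonneg_left (hup y hy).1 hc
    have h3 := mul_le_mul_of_nonneg_left (hlow y hy) hβ0
    rw [hαz, zero_add]
    rw [← hβz]
    linarith

/-- `dist` counts the cyclic steps forward to `j`; the levels are indexed by it, with `j` a fastest
affected unit. -/
theorem exists_cyclic_dist {N : ℕ} [NeZero N] (j : Fin N) :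
    ∃ dist : Fin N → ℕ, dist j = 0 ∧ (∀ d, d ≠ j → dist d = dist (d + 1) + 1) ∧
      ∀ d, dist d + 1 ≤ N := by
  refine ⟨fun d => (j - d : Fin N).val, by simp, fun d hd => ?_, fun d => (j - d).isLt⟩
  have h0 : j - d ≠ 0 := sub_ne_zero.2 hd.symm
  have h1 : j - (d + 1) = (j - d) - 1 := by abel
  simp only
  rw [h1, Fin.val_sub_one_of_ne_zero h0]
  have : 0 < (j - d).val := Nat.pos_of_ne_zero fun h => h0 (Fin.ext (by simpa using h))
  omega

/-- Levels that solve the inequalities for the potential around the cycle of units. -/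
theorem exists_cyclic_levels {N : ℕ} [NeZero N] (aff : Fin N → Prop) (hne : ∃ d, aff d)
    (a π p C : Fin N → ℝ) (ha : ∀ d, aff d → 0 < a d) (hπ : ∀ d, aff d → 0 < π d)
    (hπp : ∀ d, aff d → π d ≤ p d) (hp : ∀ d, aff d → p d < 1) (hC : ∀ d, 0 ≤ C d) :
    ∃ (b c : Fin N → ℝ) (i : Fin N) (g : ℝ), aff i ∧ (∀ d, aff d → a d ≤ a i) ∧
      0 ≤ g ∧ g ≤ a i ∧ (g = 0 → ∀ d, aff d → a d = a i) ∧
      (∀ d, aff d → a d ≠ a i → a d ≤ a i - g) ∧ (∀ d, b d ≤ a i - g) ∧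
      (∀ d, 0 ≤ b d) ∧ (∀ d, 0 ≤ c d) ∧
      (∀ d, aff d → max ((1 - π d) * a d + π d * b (d + 1)) ((1 - p d) * a d + p d * b (d + 1)) ≤
        b d ∧ C d + p d * c (d + 1) ≤ c d) ∧
      ∀ d, ¬aff d → b (d + 1) ≤ b d ∧ C d + c (d + 1) ≤ c d := by
  classical
  set S : Finset (Fin N) := Finset.univ.filter aff with hS
  have hmem : ∀ d, d ∈ S ↔ aff d := fun d => by simp [hS]
  have hSne : S.Nonempty := let ⟨d, hd⟩ := hne; ⟨d, (hmem d).2 hd⟩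
  -- Since `a` stands for the reciprocal drift, `i` is a slowest and `j` a fastest affected unit.
  obtain ⟨i, hi, himax⟩ := S.exists_max_image a hSne
  obtain ⟨j, hj, hjmin⟩ := S.exists_min_image a hSne
  obtain ⟨k, hk, hkmin⟩ := S.exists_min_image (fun d => min (π d) (1 - p d)) hSne
  simp only [hmem] at hi himax hj hjmin hk hkmin
  set q := min (π k) (1 - p k) with hq
  have hq0 : 0 < q := lt_min (hπ k hk) (by linarith [hp k hk])
  have hqπ : ∀ d, aff d → q ≤ π d := fun d hd => (hkmin d hd).trans (min_le_left _ _)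
  have hqp : ∀ d, aff d → p d ≤ 1 - q := fun d hd => by
    have := (hkmin d hd).trans (min_le_right (π d) (1 - p d))
    linarith
  have hq1 : q < 1 := by linarith [hqp k hk, hqπ k hk, hπp k hk]
  set gap := a i - a j with hgap
  have hgap0 : 0 ≤ gap := by linarith [himax j hj]
  have hgapi : gap < a i := by linarith [ha j hj]
  obtain ⟨dist, hdj, hdd, hdN⟩ := exists_cyclic_dist j
  obtain ⟨Ĉ, hĈ0, hĈ⟩ : ∃ Ĉ : ℝ, 0 ≤ Ĉ ∧ ∀ d, C d ≤ Ĉ := by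
    refine ⟨∑ d, C d, Finset.sum_nonneg fun d _ => hC d, fun d => ?_⟩
    exact Finset.single_le_sum (fun d _ => hC d) (Finset.mem_univ d)
  have hγ : ∀ n, 0 ≤ q ^ n * gap ∧ q ^ n * gap ≤ gap := fun n =>
    ⟨by positivity, mul_le_of_le_one_left hgap0 (pow_le_one₀ hq0.le hq1.le)⟩
  have hb0 : ∀ n, 0 ≤ a i - q ^ n * gap := fun n => by linarith [(hγ n).2]
  -- the constant `g`
  obtain ⟨g, hg0, hgz, hgs, hgγ⟩ : ∃ g : ℝ, 0 ≤ g ∧ (g = 0 → ∀ d, aff d → a d = a i) ∧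
      (∀ d, aff d → a d ≠ a i → a d ≤ a i - g) ∧ g ≤ q ^ N * gap := by
    by_cases hall : ∀ d, aff d → a d = a i
    · exact ⟨0, le_rfl, fun _ => hall, fun d hd h => absurd (hall d hd) h, (hγ N).1⟩
    · push Not at hall
      obtain ⟨d₀, hd₀, hd₀'⟩ := hall
      -- Besides lying below all the levels, `a i - g` must dominate the largest reciprocal drift `a
      -- l` that differs from `a i`.
      obtain ⟨l, hl, hlmax⟩ := (S.filter fun d => a d ≠ a i).exists_max_image a
        ⟨d₀, by simp [hmem, hd₀, hd₀']⟩
      simp only [Finset.mem_filter, hmem] at hl hlmax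
      have hl1 : a l < a i := lt_of_le_of_ne (himax l hl.1) hl.2
      have hgap1 : 0 < gap := by linarith [hjmin l hl.1]
      have hpos : 0 < min (a i - a l) (q ^ N * gap) := lt_min (by linarith) (by positivity)
      refine ⟨min (a i - a l) (q ^ N * gap), hpos.le, fun h => absurd h hpos.ne',
        fun d hd hne => ?_, min_le_right _ _⟩
      linarith [hlmax d ⟨hd, hne⟩, min_le_left (a i - a l) (q ^ N * gap)]
  have hN0 : (0 : ℝ) ≤ N / q := by positivity
  -- The advantage `gap` of the fastest unit is passed backwards around the cycle, keeping at least
  -- a fraction `q` at each affected unit, as its exit weights are at least `q`. Bounded costs grow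
  -- linearly with `dist`; at `j` the factor `p j ≤ 1 - q` makes the cycle close, which is the
  -- origin of `N / q`.
  refine ⟨fun d => a i - q ^ (dist d + 1) * gap, fun d => Ĉ * (dist d + N / q), i, g, hi, himax,
    hg0, ?_, hgz, hgs, ?_, fun d => hb0 _, fun d => by positivity, ?_, ?_⟩
  · linarith [(hγ N).2]
  · intro d
    have : q ^ N * gap ≤ q ^ (dist d + 1) * gap :=
      mul_le_mul_of_nonneg_right (pow_le_pow_of_le_one hq0.le hq1.le (hdN d)) hgap0
    linarith
  · intro d hd
    have hmix : ∀ w, q ≤ w → w ≤ 1 - q →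
        (1 - w) * a d + w * (a i - q ^ (dist (d + 1) + 1) * gap) ≤
          a i - q ^ (dist d + 1) * gap := by
      intro w hw1 hw2
      have hγ' := hγ (dist (d + 1) + 1)
      by_cases hdj' : d = j
      · subst hdj'
        rw [hdj, zero_add, pow_one]
        have h1 : 0 ≤ (1 - w - q) * gap := mul_nonneg (by linarith) hgap0
        have h2 : 0 ≤ w * (q ^ (dist (d + 1) + 1) * gap) := mul_nonneg (by linarith) hγ'.1
        have h3 : a d = a i - gap := by rw [hgap]; ring
        rw [h3]
        nlinarith
      · rw [hdd d hdj', pow_succ q (dist (d + 1) + 1)]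
        have h1 : 0 ≤ (1 - w) * (a i - a d) := mul_nonneg (by linarith) (by linarith [himax d hd])
        have h2 : 0 ≤ (w - q) * (q ^ (dist (d + 1) + 1) * gap) := mul_nonneg (by linarith) hγ'.1
        nlinarith
    refine ⟨max_le (hmix _ (hqπ d hd) ((hπp d hd).trans (hqp d hd)))
      (hmix _ ((hqπ d hd).trans (hπp d hd)) (hqp d hd)), ?_⟩
    have hc0 : 0 ≤ Ĉ * (dist (d + 1) + N / q : ℝ) := by positivity
    beta_reduce
    by_cases hdj' : d = j
    · subst hdj'
      rw [hdj, Nat.cast_zero, zero_add]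
      have h1 : (dist (d + 1) : ℝ) + 1 ≤ N := by exact_mod_cast hdN (d + 1)
      have h2 : p d * (Ĉ * (dist (d + 1) + N / q)) ≤ (1 - q) * (Ĉ * (N - 1 + N / q)) :=
        mul_le_mul (hqp d hd) (mul_le_mul_of_nonneg_left (by linarith) hĈ0) hc0 (by linarith)
      have h3 : (1 - q) * (N - 1 + N / q : ℝ) = N / q - 1 - q * (N - 1) := by
        field_simp
        ring
      have h4 : (1 - q) * (Ĉ * (N - 1 + N / q)) = Ĉ * (N / q - 1 - q * (N - 1)) := by
        rw [← h3]; ring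
      have h5 : 0 ≤ Ĉ * (q * (N - 1)) := by
        have : (1 : ℝ) ≤ N := by exact_mod_cast NeZero.one_le
        have : (0 : ℝ) ≤ N - 1 := by linarith
        positivity
      nlinarith [hĈ d]
    · rw [hdd d hdj']
      push_cast
      have := mul_le_mul_of_nonneg_right (show p d ≤ 1 from (hp d hd).le) hc0
      nlinarith [hĈ d]
  · intro d hd
    have hdj' : d ≠ j := fun h => hd (h ▸ hj)
    beta_reduce
    constructor
    · rw [hdd d hdj', pow_succ q (dist (d + 1) + 1)]
      have := (hγ (dist (d + 1) + 1)).1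
      nlinarith
    · rw [hdd d hdj']
      push_cast
      nlinarith [hĈ d]

end Levels

/-- The one-step potential of a unit, with the unit affected or not. -/
theorem exists_unit_potential (lam : Measure ℝ) [IsProbabilityMeasure lam] (aff : Prop) {J t : ℝ}
    (haff : aff → MemLp id 2 lam ∧ 0 < J ∧ ∫ u, u ∂lam = J ∧ 0 < t ∧
      ∫⁻ u, ENNReal.ofReal (Real.exp (-t * u)) ∂lam = 1)
    (hun : ¬aff → Integrable id lam ∧ ∫ u, u ∂lam < 0) :
    ∃ C π p κ : ℝ, 0 ≤ C ∧ 0 ≤ κ ∧ (aff → 0 < π ∧ π ≤ p ∧ p < 1) ∧ ∀ A ω b c : ℝ, 0 < A →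
      (aff → 1 ≤ ω ∧ ∀ r, 0 ≤ r → r < A →
        ∫ u in {u | u ≤ -r}, Real.exp (-t * (u + r)) ∂lam ≤ ω * lam.real {u | u ≤ -r}) →
      0 ≤ b → 0 ≤ c → ∃ Ψ : ℝ → ℝ≥0∞, Measurable Ψ ∧
        (∀ y, 0 ≤ y → y < A → ∫⁻ u, (if A ≤ y + u then 0 else
          if y + u ≤ 0 then ENNReal.ofReal (A * b + c) else Ψ (y + u)) ∂lam + 1 ≤ Ψ y) ∧
        (aff → Ψ 0 ≤ ENNReal.ofReal
            (A * max ((1 - π) * J⁻¹ + π * b) ((1 - p) * J⁻¹ + p * b) + C + p * c) ∧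
          (∀ y, 0 ≤ y → y < A → Ψ y ≤ ENNReal.ofReal (A * max J⁻¹ b + C + c)) ∧
          (b ≤ J⁻¹ → ∀ y, 0 ≤ y → y < A → Ψ y ≤ ENNReal.ofReal ((A - y) * J⁻¹ -
            A * (J⁻¹ - b) * ((Real.exp (-t * y) - Real.exp (-t * A)) / ω) + C + c))) ∧
        (¬aff → ∀ y, Ψ y = ENNReal.ofReal (A * b + c + C + κ * y)) := by
  by_cases h : aff
  · obtain ⟨h1, h2, h3, h4, h5⟩ := haff h
    obtain ⟨C, π, p, hC, hπ, hπp, hp, hΨ⟩ := exists_affected_potential lam h1 h2 h3 h4 h5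
    refine ⟨C, π, p, 0, hC, le_rfl, fun _ => ⟨hπ, hπp, hp⟩, fun A ω b c hA hω hb hc => ?_⟩
    obtain ⟨Ψ, hΨm, hΨ1, hΨ2, hΨ3, hΨ4⟩ := hΨ A ω b c hA (hω h).1 (hω h).2 hb hc
    exact ⟨Ψ, hΨm, hΨ1, fun _ => ⟨hΨ2, hΨ3, hΨ4⟩, fun h' => absurd h h'⟩
  · obtain ⟨κ, s, hκ, hs, hstep⟩ := exists_unaffected_step lam (hun h).1 (hun h).2
    refine ⟨κ * s, 0, 0, κ, by positivity, hκ, fun h' => absurd h' h,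
      fun A ω b c hA hω hb hc => ⟨fun y => ENNReal.ofReal (A * b + c + κ * s + κ * y),
        by fun_prop, fun y hy hyA => ?_, fun h' => absurd h' h, fun _ y => rfl⟩⟩
    have e : ∀ y, A * b + c + κ * s + κ * y = A * b + c + κ * (y + s) := fun y => by ring
    refine le_trans (le_of_eq ?_) ((hstep A (A * b + c) y (by positivity) hy).trans_eq ?_)
    · congr 1
      refine lintegral_congr fun u => ?_
      beta_reduce
      rw [e]
      split_ifs <;> rfl
    · beta_reduce
      rw [e]

/-- The potential of the policy, with its bounds up to a constant that does not depend on the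
threshold. -/
theorem exists_potential {N : ℕ} [NeZero N] (lam : Fin N → Measure ℝ)
    [∀ d, IsProbabilityMeasure (lam d)] (aff : Fin N → Prop) (hne : ∃ d, aff d) (J t : Fin N → ℝ)
    (haff : ∀ d, aff d → MemLp id 2 (lam d) ∧ 0 < J d ∧ ∫ u, u ∂lam d = J d ∧ 0 < t d ∧
      ∫⁻ u, ENNReal.ofReal (Real.exp (-t d * u)) ∂lam d = 1)
    (hun : ∀ d, ¬aff d → Integrable id (lam d) ∧ ∫ u, u ∂lam d < 0) :
    ∃ (i : Fin N) (g C : ℝ) (κ : Fin N → ℝ), aff i ∧ (∀ d, aff d → (J d)⁻¹ ≤ (J i)⁻¹) ∧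
      0 ≤ g ∧ g ≤ (J i)⁻¹ ∧ (g = 0 → ∀ d, aff d → J d = J i) ∧ 0 ≤ C ∧ (∀ d, 0 ≤ κ d) ∧
      ∀ (A : ℝ) (ω : Fin N → ℝ), 0 < A →
      (∀ d, aff d → 1 ≤ ω d ∧ ∀ r, 0 ≤ r → r < A →
        ∫ u in {u | u ≤ -r}, Real.exp (-t d * (u + r)) ∂lam d ≤
          ω d * (lam d).real {u | u ≤ -r}) →
      ∃ Ψ : Fin N → ℝ → ℝ≥0∞, (∀ d, Measurable (Ψ d)) ∧
        (∀ d y, 0 ≤ y → y < A →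
          ∫⁻ u, (if A ≤ y + u then 0 else if y + u ≤ 0 then Ψ (d + 1) 0 else Ψ d (y + u))
            ∂lam d + 1 ≤ Ψ d y) ∧
        (∀ d, aff d → J d = J i → ∀ y, 0 ≤ y → y < A → Ψ d y ≤ ENNReal.ofReal ((A - y) * (J i)⁻¹ -
          A * g * ((Real.exp (-t d * y) - Real.exp (-t d * A)) / ω d) + C)) ∧
        (∀ d, aff d → J d ≠ J i → ∀ y, 0 ≤ y → y < A →
          Ψ d y ≤ ENNReal.ofReal (A * ((J i)⁻¹ - g) + C)) ∧
        ∀ d, ¬aff d → ∀ y, Ψ d y ≤ ENNReal.ofReal (A * ((J i)⁻¹ - g) + C + κ d * y) := by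
  choose C π p κ hC hκ hπ hΨ using fun d =>
    exists_unit_potential (lam d) (aff d) (haff d) (hun d)
  obtain ⟨b, c, i, g, hi, himax, hg0, hgi, hgz, hgs, hbg, hb0, hc0, hba, hbu⟩ :=
    exists_cyclic_levels aff hne (fun d => (J d)⁻¹) π p C (fun d hd => inv_pos.2 (haff d hd).2.1)
      (fun d hd => (hπ d hd).1) (fun d hd => (hπ d hd).2.1) (fun d hd => (hπ d hd).2.2) hC
  obtain ⟨B, hB0, hB⟩ : ∃ B : ℝ, 0 ≤ B ∧ ∀ d, C d + c (d + 1) ≤ B := by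
    have h0 : ∀ d, 0 ≤ C d + c (d + 1) := fun d => add_nonneg (hC d) (hc0 _)
    exact ⟨∑ d, (C d + c (d + 1)), Finset.sum_nonneg fun d _ => h0 d,
      fun d => Finset.single_le_sum (fun d _ => h0 d) (Finset.mem_univ d)⟩
  refine ⟨i, g, B, κ, hi, himax, hg0, hgi, fun h d hd => inv_injective (hgz h d hd), hB0, hκ,
    fun A ω hA hω => ?_⟩
  choose Ψ hΨm hΨstep hΨaff hΨun using fun d =>
    hΨ d A (ω d) (b (d + 1)) (c (d + 1)) hA (hω d) (hb0 _) (hc0 _)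
  -- The potential on entering a unit is at most the level that its predecessor assumed for an exit
  -- from below, so the units fit together cyclically.
  have hzero : ∀ d, Ψ d 0 ≤ ENNReal.ofReal (A * b d + c d) := fun d => by
    by_cases hd : aff d
    · refine (hΨaff d hd).1.trans (ENNReal.ofReal_le_ofReal ?_)
      have h1 := mul_le_mul_of_nonneg_left (hba d hd).1 hA.le
      linarith [(hba d hd).2]
    · rw [hΨun d hd]
      refine ENNReal.ofReal_le_ofReal ?_
      have h1 := mul_le_mul_of_nonneg_left (hbu d hd).1 hA.le
      linarith [(hbu d hd).2]
  refine ⟨Ψ, hΨm, fun d y hy hyA => le_trans ?_ (hΨstep d y hy hyA), ?_, ?_, ?_⟩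
  · refine add_le_add_left (lintegral_mono fun u => ?_) 1
    split_ifs
    · exact le_rfl
    · exact hzero (d + 1)
    · exact le_rfl
  · intro d hd hJ y hy hyA
    have hω0 : 0 < ω d := zero_lt_one.trans_le (hω d hd).1
    have h1 := hbg (d + 1)
    refine ((hΨaff d hd).2.2 (by rw [hJ]; linarith) y hy hyA).trans (ENNReal.ofReal_le_ofReal ?_)
    have h2 : 0 ≤ (Real.exp (-t d * y) - Real.exp (-t d * A)) / ω d := by
      refine div_nonneg (sub_nonneg.2 (Real.exp_le_exp.2 ?_)) hω0.le
      nlinarith [(haff d hd).2.2.2.1]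
    have h3 : A * g ≤ A * ((J i)⁻¹ - b (d + 1)) := mul_le_mul_of_nonneg_left (by linarith) hA.le
    have h4 := mul_le_mul_of_nonneg_right h3 h2
    rw [hJ]
    linarith [hB d]
  · intro d hd hJ y hy hyA
    refine ((hΨaff d hd).2.1 y hy hyA).trans (ENNReal.ofReal_le_ofReal ?_)
    have h1 : max (J d)⁻¹ (b (d + 1)) ≤ (J i)⁻¹ - g :=
      max_le (hgs d hd fun h => hJ (inv_injective h)) (hbg _)
    have h2 := mul_le_mul_of_nonneg_left h1 hA.le
    linarith [hB d]
  · intro d hd y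
    rw [hΨun d hd]
    refine ENNReal.ofReal_le_ofReal ?_
    have h2 := mul_le_mul_of_nonneg_left (hbg (d + 1)) hA.le
    linarith [hB d]

/-! ### Maximizing over the value of the statistic at the change-point -/

section Optimization

/-- The left side is the minimum over `x`, attained at `x = log β`; this produces the logarithm in
the correction term. -/
theorem one_add_log_le {x β : ℝ} (hβ : 0 < β) : 1 + Real.log β ≤ x + β * Real.exp (-x) := by
  have h := Real.add_one_le_exp (Real.log β - x)
  rw [Real.exp_sub, Real.exp_log hβ] at h
  rw [Real.exp_neg, ← div_eq_mul_inv]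
  linarith

/-- The maximum over `y` of the bound for the delay of a slow unit. -/
theorem slow_bound_le {A t a g ω y : ℝ} (hA : 0 < A) (ht : 0 < t) (ha : 0 < a) (hg : 0 < g)
    (hω : 1 ≤ ω) (hy : 0 ≤ y) (hyA : y < A) :
    (A - y) * a - A * g * ((Real.exp (-t * y) - Real.exp (-t * A)) / ω) ≤
      (A + min 0 (-(1 / t) * (Real.log (A * t) - Real.log ω + 1))) * a +
        (a / t * |Real.log (g / a)| + g / t) := by
  have hω0 : 0 < ω := by linarith
  have hr1 : 0 ≤ a / t * |Real.log (g / a)| := by positivity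
  have hr2 : 0 ≤ g / t := by positivity
  rcases min_choice 0 (-(1 / t) * (Real.log (A * t) - Real.log ω + 1)) with h | h
  · rw [h]
    have h1 : 0 ≤ (Real.exp (-t * y) - Real.exp (-t * A)) / ω :=
      div_nonneg (sub_nonneg.2 (Real.exp_le_exp.2 (by nlinarith))) hω0.le
    have h2 : 0 ≤ A * g * ((Real.exp (-t * y) - Real.exp (-t * A)) / ω) := by positivity
    nlinarith
  · rw [h]
    -- Up to the factor `a / t`, the quantity to minimize is `x + β * exp (-x)` at `x = t * y` with
    -- this `β`. The ratio `g / a` inside the logarithm only shifts the bound by a constant.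
    have hβ : 0 < A * g * t / (ω * a) := by positivity
    have h1 := one_add_log_le (x := t * y) hβ
    have hlog : Real.log (A * g * t / (ω * a)) =
        Real.log (A * t) - Real.log ω + Real.log (g / a) := by
      rw [← Real.log_div (by positivity) hω0.ne', ← Real.log_mul (by positivity) (by positivity)]
      congr 1
      field_simp
    rw [hlog] at h1
    have h2 := mul_le_mul_of_nonneg_left h1 (show 0 ≤ a / t by positivity)
    have h3 : a / t * (t * y + A * g * t / (ω * a) * Real.exp (-(t * y))) =
        y * a + A * g * (Real.exp (-t * y) / ω) := by
      rw [neg_mul]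
      field_simp
    rw [h3] at h2
    -- The term at `A` stays bounded since `A * exp (-t * A) ≤ 1 / t`.
    have h4 : A * g * (Real.exp (-t * A) / ω) ≤ g / t := by
      have h5 := Real.add_one_le_exp (t * A)
      have h6 : Real.exp (-t * A) / ω ≤ Real.exp (-t * A) := div_le_self (Real.exp_pos _).le hω
      have h7 : A * Real.exp (-t * A) ≤ 1 / t := by
        rw [neg_mul, Real.exp_neg, ← div_eq_mul_inv, div_le_div_iff₀ (Real.exp_pos _) ht]
        linarith
      calc A * g * (Real.exp (-t * A) / ω) ≤ A * g * Real.exp (-t * A) :=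
            mul_le_mul_of_nonneg_left h6 (by positivity)
        _ = g * (A * Real.exp (-t * A)) := by ring
        _ ≤ g * (1 / t) := mul_le_mul_of_nonneg_left h7 hg.le
        _ = g / t := by ring
    have h8 : -(a / t * |Real.log (g / a)|) ≤ a / t * Real.log (g / a) := by
      rw [← mul_neg]
      exact mul_le_mul_of_nonneg_left (neg_abs_le _) (by positivity)
    have h9 : -(1 / t) * (Real.log (A * t) - Real.log ω + 1) * a =
        -(a / t * (Real.log (A * t) - Real.log ω + 1)) := by ring
    have h10 : A * g * ((Real.exp (-t * y) - Real.exp (-t * A)) / ω) =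
        A * g * (Real.exp (-t * y) / ω) - A * g * (Real.exp (-t * A) / ω) := by ring
    rw [add_mul, h9, h10]
    linarith

/-- A bound that is smaller by a fixed proportion is dominated by the bound for a slow unit. -/
theorem fast_bound_le {A t a g ω : ℝ} (hA : 0 < A) (ht : 0 < t) (ha : 0 < a) (hg : 0 < g)
    (hω : 1 ≤ ω) :
    A * (a - g) ≤ (A + min 0 (-(1 / t) * (Real.log (A * t) - Real.log ω + 1))) * a +
        a / t * |Real.log (g / a)| := by
  have hr1 : 0 ≤ a / t * |Real.log (g / a)| := by positivity
  rcases min_choice 0 (-(1 / t) * (Real.log (A * t) - Real.log ω + 1)) with h | h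
  · rw [h]
    have : 0 < A * g := by positivity
    linarith
  · rw [h]
    have hlω : 0 ≤ Real.log ω := Real.log_nonneg hω
    have hz : 0 < A * g * t / a := by positivity
    -- The logarithmic correction is at most the linear gain `A * g`, up to a constant.
    have h1 := Real.log_le_sub_one_of_pos hz
    have hlog : Real.log (A * g * t / a) = Real.log (A * t) + Real.log (g / a) := by
      rw [← Real.log_mul (by positivity) (by positivity)]
      congr 1
      field_simp
    rw [hlog] at h1
    have h2 : Real.log (A * t) - Real.log ω + 1 ≤ A * g * t / a + |Real.log (g / a)| := by
      linarith [neg_abs_le (Real.log (g / a))]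
    have h3 := mul_le_mul_of_nonneg_left h2 (show 0 ≤ a / t by positivity)
    have h4 : a / t * (A * g * t / a + |Real.log (g / a)|) = A * g + a / t * |Real.log (g / a)| := by
      field_simp
    have h9 : -(1 / t) * (Real.log (A * t) - Real.log ω + 1) * a =
        -(a / t * (Real.log (A * t) - Real.log ω + 1)) := by ring
    rw [add_mul, h9]
    linarith

end Optimization

/-! ### Comparison with the terms of the stated bound -/

section Terms

/-- The numerators telescope to the probability of stopping within the cycle. If that vanishes,
division by zero makes every weight `0`. -/
theorem sum_weight {n : ℕ} (q : Fin n → ℝ) (j : Fin n) :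
    ∑ l ∈ Finset.range n, weight q j l = 0 ∨ ∑ l ∈ Finset.range n, weight q j l = 1 := by
  have h : ∀ k, ∑ l ∈ Finset.range k, q (cyc j l) * ∏ s ∈ Finset.range l, (1 - q (cyc j s)) =
      1 - ∏ s ∈ Finset.range k, (1 - q (cyc j s)) := by
    intro k
    induction k with
    | zero => simp
    | succ k ih => rw [Finset.sum_range_succ, ih, Finset.prod_range_succ]; ring
  simp only [weight]
  rw [← Finset.sum_div, h]
  rcases eq_or_ne (1 - ∏ s ∈ Finset.range n, (1 - q (cyc j s))) 0 with h0 | h0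
  · left; rw [h0, zero_div]
  · right; rw [div_self h0]

variable {K : ℕ} {𝓧 : Fin K → Type*} [∀ k, MeasurableSpace (𝓧 k)]
  {𝒢 : Set (Measure (∀ k, 𝓧 k))} {F G : Measure (∀ k, 𝓧 k)} {m : ℕ}
  {N : ℕ} {U : Fin N → Finset (Fin K)}

/-- With vanishing weights the harmonic mean is `0⁻¹ = 0`, which still obeys the bound. Hence `Phi`
is zero whenever all drifts coincide. -/
theorem Jstar_le_of_const {J : ℝ} (hJ : 0 ≤ J)
    (h : ∀ j, J0 𝒢 F G (affUnit F G m U j) = J) (A : ℝ) (j : Fin (affNum F G m U)) :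
    Jstar 𝒢 F G m U A j ≤ J := by
  simp only [Jstar, h]
  rw [← Finset.sum_mul]
  rcases sum_weight (fun i => qLevel 𝒢 F G (affUnit F G m U i) A) j with h0 | h0
  · rw [h0, zero_mul, inv_zero]
    exact hJ
  · rw [h0, one_mul, one_div, inv_inv]

theorem Phi_eq_zero {A : ℝ} {j : Fin (affNum F G m U)}
    (h : Jstar 𝒢 F G m U A (cyc j 1) ≤ J0 𝒢 F G (affUnit F G m U j)) :
    Phi 𝒢 F G m U j A = 0 := if_pos h

theorem Phi_nonpos (A : ℝ) (j : Fin (affNum F G m U)) : Phi 𝒢 F G m U j A ≤ 0 := by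
  simp only [Phi]
  split_ifs
  · exact le_rfl
  · exact min_le_left _ _

/-- The dropped terms are nonnegative: `log (1 - J / J')` is nonpositive but divided by a negative
number, and `1 / J' - 1 / J` enters with a minus sign. What remains no longer involves the weights.
-/
theorem le_Phi {A : ℝ} (hA : 0 < A) {j : Fin (affNum F G m U)}
    (hJ : 0 < J0 𝒢 F G (affUnit F G m U j)) (ht : 0 < root 𝒢 F G (affUnit F G m U j))
    (hω : 1 ≤ overshoot 𝒢 F G (affUnit F G m U j) A) :
    min 0 (-(1 / root 𝒢 F G (affUnit F G m U j)) *
      (Real.log (A * root 𝒢 F G (affUnit F G m U j)) -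
        Real.log (overshoot 𝒢 F G (affUnit F G m U j) A) + 1)) ≤ Phi 𝒢 F G m U j A := by
  simp only [Phi]
  set t := root 𝒢 F G (affUnit F G m U j)
  set ω := overshoot 𝒢 F G (affUnit F G m U j) A
  set J := J0 𝒢 F G (affUnit F G m U j)
  set J' := Jstar 𝒢 F G m U A (cyc j 1)
  split_ifs with h
  · exact min_le_left _ _
  · refine min_le_min_left 0 ?_
    push Not at h
    have hJ' : 0 < J' := hJ.trans h
    have h1 : Real.log (1 - J / J') ≤ 0 := by
      have h2 : J / J' < 1 := (div_lt_one hJ').2 h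
      have h3 : 0 < J / J' := by positivity
      exact Real.log_nonpos (by linarith) (by linarith)
    have h2 : 1 / J' - 1 / J ≤ 0 := sub_nonpos.2 (one_div_le_one_div_of_le hJ h.le)
    have h3 : J * (A * Real.exp (-t * A) / ω) * (1 / J' - 1 / J) ≤ 0 :=
      mul_nonpos_of_nonneg_of_nonpos (by positivity) h2
    have h4 : -A * -t = A * t := by ring
    rw [h4, one_div_neg_eq_neg_one_div]
    have h5 : -(1 / t) * (Real.log (A * t) - Real.log ω + 1) ≤
        -(1 / t) * (Real.log (A * t) + Real.log (1 - J / J') - Real.log ω + 1) :=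
      mul_le_mul_of_nonpos_left (by linarith) (neg_nonpos.2 (by positivity))
    linarith

/-- `Phi` is nonpositive, and as the overshoot constant is at least one it is bounded below by a
negative multiple of a logarithm; no upper bound on the overshoot is needed. -/
theorem tendsto_Phi_div (j : Fin (affNum F G m U))
    (hJ : 0 < J0 𝒢 F G (affUnit F G m U j)) (ht : 0 < root 𝒢 F G (affUnit F G m U j))
    (hω : ∀ A, 0 < A → 1 ≤ overshoot 𝒢 F G (affUnit F G m U j) A) :
    Tendsto (fun A : ℝ => Phi 𝒢 F G m U j A / A) atTop (𝓝 0) := by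
  set t := root 𝒢 F G (affUnit F G m U j) with htdef
  have hlog : Tendsto (fun A : ℝ => Real.log A / A) atTop (𝓝 0) :=
    Real.isLittleO_log_id_atTop.tendsto_div_nhds_zero
  have hinv : Tendsto (fun A : ℝ => A⁻¹) atTop (𝓝 0) := tendsto_inv_atTop_zero
  have hlim : Tendsto (fun A : ℝ => -(1 / t) * |Real.log A / A + (Real.log t + 1) * A⁻¹|) atTop
      (𝓝 0) := by
    have := ((hlog.add (hinv.const_mul (Real.log t + 1))).abs).const_mul (-(1 / t))
    simpa using this
  refine tendsto_of_tendsto_of_tendsto_of_le_of_le' hlim tendsto_const_nhds ?_ ?_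
  · filter_upwards [eventually_gt_atTop 0] with A hA
    have h1 := le_Phi hA hJ ht (hω A hA)
    rw [← htdef] at h1
    have hl : 0 ≤ Real.log (overshoot 𝒢 F G (affUnit F G m U j) A) :=
      Real.log_nonneg (hω A hA)
    have h2 : -(1 / t) * |Real.log A + Real.log t + 1| ≤ Phi 𝒢 F G m U j A := by
      refine le_trans (le_min ?_ ?_) h1
      · exact mul_nonpos_of_nonpos_of_nonneg (neg_nonpos.2 (by positivity)) (abs_nonneg _)
      · refine mul_le_mul_of_nonpos_left ?_ (neg_nonpos.2 (by positivity))
        rw [Real.log_mul hA.ne' ht.ne']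
        linarith [le_abs_self (Real.log A + Real.log t + 1)]
    have h3 : Real.log A / A + (Real.log t + 1) * A⁻¹ = (Real.log A + Real.log t + 1) / A := by
      rw [div_eq_mul_inv, div_eq_mul_inv]; ring
    rw [h3, abs_div, abs_of_pos hA, ← mul_div_assoc]
    exact div_le_div_of_nonneg_right h2 hA.le
  · filter_upwards [eventually_gt_atTop 0] with A hA
    exact div_nonpos_of_nonpos_of_nonneg (Phi_nonpos A j) hA.le

/-- Of the three entries of the maximum this is the only one that the bound for the delay uses. -/
theorem le_firstOrder (A : ℝ) (j : Fin (affNum F G m U)) :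
    (A + Phi 𝒢 F G m U j A) / J0 𝒢 F G (affUnit F G m U j) ≤ firstOrder 𝒢 F G m U A :=
  le_trans ((le_max_right _ _).trans (le_max_right _ _))
    (le_ciSup (f := fun j : Fin (affNum F G m U) => max (A / Jstar 𝒢 F G m U A j)
      (max ((A + Phi 𝒢 F G m U j A) / Jstar 𝒢 F G m U A (cyc j 1))
        ((A + Phi 𝒢 F G m U j A) / J0 𝒢 F G (affUnit F G m U j))))
      (Set.finite_range _).bddAbove j)

theorem affUnit_mem (j : Fin (affNum F G m U)) :
    ∃ d, U d ∈ affected F G m ∧ affUnit F G m U j = U d := by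
  refine ⟨_, ?_, rfl⟩
  have := Finset.orderEmbOfFin_mem (affIdx F G m U) rfl j
  simpa [affIdx] using this

theorem exists_affUnit_eq {d : Fin N} (hd : U d ∈ affected F G m) :
    ∃ j, affUnit F G m U j = U d := by
  have h : d ∈ Set.range ((affIdx F G m U).orderEmbOfFin rfl) := by
    rw [Finset.range_orderEmbOfFin]
    simpa [affIdx] using hd
  obtain ⟨j, hj⟩ := h
  exact ⟨j, congrArg U hj⟩

end Terms

section Comparison

variable {K : ℕ} {𝓧 : Fin K → Type*} [∀ k, MeasurableSpace (𝓧 k)]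
  {𝒢 : Set (Measure (∀ k, 𝓧 k))} {F G : Measure (∀ k, 𝓧 k)} {m : ℕ}
  {N : ℕ} {U : Fin N → Finset (Fin K)}

/-- The bounds that the potential provides are below the first-order term up to a constant. -/
theorem bounds_le_firstOrder {A a g : ℝ} (hA : 0 < A) (hg : 0 ≤ g) {d : Fin N}
    (hd : U d ∈ affected F G m) (hJ : 0 < J0 𝒢 F G (U d)) (ha : J0 𝒢 F G (U d) = a⁻¹)
    (ht : 0 < root 𝒢 F G (U d)) (hω : 1 ≤ overshoot 𝒢 F G (U d) A)
    (hgz : g = 0 → ∀ d, U d ∈ affected F G m → J0 𝒢 F G (U d) = a⁻¹) :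
    A * (a - g) ≤ firstOrder 𝒢 F G m U A +
      (a / root 𝒢 F G (U d) * |Real.log (g / a)| + g / root 𝒢 F G (U d)) ∧
    ∀ y, 0 ≤ y → y < A → (A - y) * a - A * g * ((Real.exp (-root 𝒢 F G (U d) * y) -
        Real.exp (-root 𝒢 F G (U d) * A)) / overshoot 𝒢 F G (U d) A) ≤
      firstOrder 𝒢 F G m U A +
        (a / root 𝒢 F G (U d) * |Real.log (g / a)| + g / root 𝒢 F G (U d)) := by
  obtain ⟨j, hj⟩ := exists_affUnit_eq hd
  have ha0 : 0 < a := inv_pos.1 (ha ▸ hJ)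
  have hfo := le_firstOrder (𝒢 := 𝒢) A j
  rw [hj, ha, div_inv_eq_mul] at hfo
  have hr1 : 0 ≤ a / root 𝒢 F G (U d) * |Real.log (g / a)| := by positivity
  have hr2 : 0 ≤ g / root 𝒢 F G (U d) := by positivity
  -- If `g = 0` all affected drifts agree, `Phi` vanishes and no logarithm has to be gained.
  rcases hg.eq_or_lt with hg0 | hg0
  · have hΦ : Phi 𝒢 F G m U j A = 0 := by
      refine Phi_eq_zero ?_
      have hconst : ∀ j, J0 𝒢 F G (affUnit F G m U j) = a⁻¹ := fun j => by
        obtain ⟨d', hd', hj'⟩ := affUnit_mem j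
        rw [hj']
        exact hgz hg0.symm d' hd'
      rw [hj, ha]
      exact Jstar_le_of_const (inv_nonneg.2 ha0.le) hconst A _
    rw [hΦ, add_zero] at hfo
    refine ⟨by rw [← hg0] at hr1 hr2 ⊢; linarith, fun y hy hyA => ?_⟩
    rw [← hg0] at hr1 hr2 ⊢
    nlinarith
  · have hΦ := le_Phi (𝒢 := 𝒢) hA (j := j) (by rw [hj]; exact hJ) (by rw [hj]; exact ht)
      (by rw [hj]; exact hω)
    rw [hj] at hΦ
    have h1 := mul_le_mul_of_nonneg_right (add_le_add_right hΦ A) ha0.le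
    refine ⟨?_, fun y hy hyA => ?_⟩
    · have := fast_bound_le hA ht ha0 hg0 hω
      linarith
    · have := slow_bound_le hA ht ha0 hg0 hω hy hyA
      linarith

end Comparison

theorem mainTheorem12 {K : ℕ} {𝓧 : Fin K → Type*} [∀ k, MeasurableSpace (𝓧 k)]
    -- the pre-change distribution and the family of the plausible post-change distributions
    (F : Measure (∀ k, 𝓧 k)) [IsProbabilityMeasure F]
    (𝒢 : Set (Measure (∀ k, 𝓧 k))) (h𝒢 : ∀ P ∈ 𝒢, IsProbabilityMeasure P)
    (m : ℕ)
    (h_ac : ∀ P ∈ 𝒢, ∀ E ∈ affected F P m,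
      localLaw P E ≪ localLaw F E ∧ localLaw F E ≪ localLaw P E)
    -- the units, in the order in which they are sampled
    {N : ℕ} [NeZero N] (U : Fin N → Finset (Fin K)) (hU_inj : Function.Injective U)
    (hU_card : ∀ d, (U d).card = m)
    (hU_fam : ∀ d, (localFamily 𝒢 F (U d)).Nonempty ∧ (localFamily 𝒢 F (U d)).Finite)
    -- the true post-change distribution
    (G : Measure (∀ k, 𝓧 k)) (hG : G ∈ 𝒢)
    (h_aff : ∃ d, U d ∈ affected F G m)
    (h_Jinf : ∀ d, Integrable (llr (localLaw F (U d)) (mixture 𝒢 F (U d))) (localLaw F (U d)) ∧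
      0 < Jinf 𝒢 F (U d))
    (h_J0 : ∀ d, U d ∈ affected F G m →
      Integrable (xi 𝒢 F (U d)) (localLaw G (U d)) ∧ 0 < J0 𝒢 F G (U d))
    (h_W0 : ∀ d, U d ∈ affected F G m →
      Integrable (fun x => (xi 𝒢 F (U d) x - J0 𝒢 F G (U d)) ^ 2) (localLaw G (U d)))
    (h_root : ∀ d, U d ∈ affected F G m → ∃! t : ℝ, IsRoot 𝒢 F G (U d) t) :
    (∀ j : Fin (affNum F G m U), Tendsto (fun A : ℝ => Phi 𝒢 F G m U j A / A) atTop (𝓝 0)) ∧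
    ∃ C : ℝ, 0 < C ∧ ∀ A : ℝ, 0 < A →
      worstDelay F G m (rrSample 𝒢 F U) (rrStop 𝒢 F U A) ≤
        ENNReal.ofReal (firstOrder 𝒢 F G m U A + secondOrder 𝒢 F G m U + C) := by
  have hGp : IsProbabilityMeasure G := h𝒢 G hG
  have hmix := fun d => mixture_properties h𝒢 h_ac (hU_card d) (hU_fam d).1 (hU_fam d).2
  have hmixp : ∀ d, IsProbabilityMeasure (mixture 𝒢 F (U d)) := fun d => (hmix d).1
  have ht : ∀ d, U d ∈ affected F G m → 0 < root 𝒢 F G (U d) := fun d hd =>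
    (isRoot_root (h_root d hd)).1
  have hroot : ∀ d, U d ∈ affected F G m →
      ∫⁻ u, ENNReal.ofReal (Real.exp (-root 𝒢 F G (U d) * u)) ∂xiLaw 𝒢 F G (U d) = 1 :=
    fun d hd => lintegral_exp_root (hmix d).2.2 (h_ac G hG _ hd).1 (h_root d hd)
  have hpost := fun d (hd : U d ∈ affected F G m) => xiLaw_postChange (h_W0 d hd)
  have hpre := fun d => xiLaw_preChange (hmix d).2.1 (hmix d).2.2 (h_Jinf d).1 (h_Jinf d).2
  have hover : ∀ d, U d ∈ affected F G m → ∀ A : ℝ, 0 < A → _ := fun d hd A hA =>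
    overshoot_properties (ht d hd) (hroot d hd) (exit_zero_bounds _ (ht d hd)
      ((hpost d hd).1.integrable (by norm_num)) (by rw [(hpost d hd).2]; exact (h_J0 d hd).2)
      (hroot d hd)).1 hA
  refine ⟨fun j => ?_, ?_⟩
  · obtain ⟨d, hd, hj⟩ := affUnit_mem (F := F) (G := G) (m := m) (U := U) j
    refine tendsto_Phi_div j ?_ ?_ ?_ <;> rw [hj]
    · exact (h_J0 d hd).2
    · exact ht d hd
    · exact fun A hA => (hover d hd A hA).1
  obtain ⟨i, g, C, κ, hi, himax, hg, hgi, hgz, hC, hκ, hpot⟩ :=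
    exists_potential (fun d => xiLaw 𝒢 F G (U d)) (fun d => U d ∈ affected F G m) h_aff
      (fun d => J0 𝒢 F G (U d)) (fun d => root 𝒢 F G (U d))
      (fun d hd => ⟨(hpost d hd).1, (h_J0 d hd).2, (hpost d hd).2, ht d hd, hroot d hd⟩)
      (fun d hd => by
        simp only [xiLaw_eq_of_unaffected (𝒢 := 𝒢) (hU_card d) hd]
        exact ⟨(hpre d).1, (hpre d).2.1⟩)
  choose M hM0 hM using fun d =>
    exists_killed_mean_le (xiLaw 𝒢 F F (U d)) (hpre d).1 (hpre d).2.1 (hpre d).2.2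
  set a : ℝ := (J0 𝒢 F G (U i))⁻¹ with ha
  -- The absolute value keeps `e` nonnegative at unaffected units too, where nothing is known about
  -- the root.
  set e : Fin N → ℝ := fun d => a / |root 𝒢 F G (U d)| * |Real.log (g / a)| +
    g / |root 𝒢 F G (U d)| with he
  have ha0 : 0 < a := inv_pos.2 (h_J0 i hi).2
  have he0 : ∀ d, 0 ≤ e d := fun d => by positivity
  have hκM : ∀ d, 0 ≤ κ d * M d := fun d => mul_nonneg (hκ d) (hM0 d)
  set B : ℝ := ∑ d, (e d + κ d * M d) with hB
  have heB : ∀ d, e d + κ d * M d ≤ B := fun d =>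
    Finset.single_le_sum (f := fun d => e d + κ d * M d)
      (fun d _ => add_nonneg (he0 d) (hκM d)) (Finset.mem_univ d)
  have hB0 : 0 ≤ B := (add_nonneg (he0 i) (hκM i)).trans (heB i)
  -- The constant may depend on everything but `A`. The absolute value offsets the explicit
  -- remainder, `C` comes from the potential, one `B` from the comparison with `firstOrder`, and the
  -- other from the mean height of a run at an unaffected unit.
  refine ⟨|secondOrder 𝒢 F G m U| + C + B + B + 1, by positivity, fun A hA => ?_⟩
  have hsec := neg_abs_le (secondOrder 𝒢 F G m U)
  obtain ⟨Ψ, hΨm, hstep, hslow, hfast, hun⟩ := hpot A (fun d => overshoot 𝒢 F G (U d) A) hA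
    fun d hd => hover d hd A hA
  have hcmp : ∀ d, U d ∈ affected F G m → J0 𝒢 F G (U d) = J0 𝒢 F G (U i) → _ := fun d hd hJ =>
    bounds_le_firstOrder (𝒢 := 𝒢) (a := a) hA hg hd (h_J0 d hd).2 (by rw [hJ, ha, inv_inv])
      (ht d hd) (hover d hd A hA).1 (fun h d hd => by rw [ha, inv_inv]; exact hgz h d hd)
  have hee : ∀ d, U d ∈ affected F G m →
      a / root 𝒢 F G (U d) * |Real.log (g / a)| + g / root 𝒢 F G (U d) ≤ B := fun d hd => by
    have := heB d
    rw [he] at this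
    simp only [abs_of_pos (ht d hd)] at this
    linarith [hκM d]
  refine worstDelay_le 𝒢 F G m U hA Ψ hΨm hstep (fun d hd y hy hyA => ?_) fun d hd => ?_
  · by_cases hJ : J0 𝒢 F G (U d) = J0 𝒢 F G (U i)
    · refine (hslow d hd hJ y hy hyA).trans (ENNReal.ofReal_le_ofReal ?_)
      linarith [(hcmp d hd hJ).2 y hy hyA, hee d hd]
    · refine (hfast d hd hJ y hy hyA).trans (ENNReal.ofReal_le_ofReal ?_)
      linarith [(hcmp i hi rfl).1, hee i hi]
  · have h0 : 0 ≤ A * (a - g) + C := add_nonneg (mul_nonneg hA.le (by linarith)) hC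
    refine ⟨ENNReal.ofReal (A * (a - g) + C), ENNReal.ofReal (κ d), ENNReal.ofReal (M d),
      fun y hy hyA => ?_, fun n => hM d A n hA, ?_⟩
    · refine (hun d hd y).trans ?_
      rw [ENNReal.ofReal_add h0 (mul_nonneg (hκ d) hy), ENNReal.ofReal_mul (hκ d)]
    · rw [← ENNReal.ofReal_mul (hκ d), ← ENNReal.ofReal_add h0 (hκM d)]
      refine ENNReal.ofReal_le_ofReal ?_
      linarith [(hcmp i hi rfl).1, hee i hi, heB d, he0 d]
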